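/- Notation. Fix an integer $m\ge 1$ and $q\in(0,2)$; for $L>0$ put $Q_i=[(i-1)L,iL]\times S^1$ with $S^1=\mathbb R/2\pi\mathbb Z$, and $q'=q-\frac{\log 2}{L}$. For a $C^2$ map $u:[0,lL]\times S^1\to\mathbb R^n$ let $$\varphi(t)=\frac1\pi\Big(\int_0^{2\pi}u\cos m\theta\,d\theta,\int_0^{2\pi}u\sin m\theta\,d\theta\Big),\quad g^+=\varphi'+m\varphi,\quad t_i=\tfrac{(2i-1)L}{2},$$ $$\mathcal F_i(u)=\frac{g^+(t_i)}{2m}e^{m(t-t_i)}\cdot(\cos m\theta,\sin m\theta),\qquad \gamma_i=|g^+(t_i)|e^{-mt_i},\qquad E_i=\int_{Q_i}|u|^2e^{-2mt}\,dt\,d\theta,$$ $$\lambda_i=\frac{\gamma_i}{\sqrt{E_i}},\qquad \nu_i=\frac{\int_{Q_i}|u-\mathcal F_i(u)|^2e^{-2mt}\,dt\,d\theta}{\int_{Q_i}|\mathcal F_i(u)|^2e^{-2mt}\,dt\,d\theta},$$ with the conventions $\lambda_i=0$ if $E_i=0$; $\nu_i=0$ if numerator and denominator both vanish, and $\nu_i=+\infty$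 if only the denominator vanishes. We say that $u$ is a solution on $[0,lL]\times S^1$ with coefficient $\omega$ if $$\Delta u=\phi(x,u,\nabla u),\qquad |\phi(x,u,\nabla u)|\le \omega\,(|u|+|\nabla u|)$$ for some function $\phi$ and some nonnegative function $\omega$ on the cylinder. Theorem 2.11 (decay). For every integer $m\ge1$ and every $q\in(0,2)$ there is $L_1=L_1(m,q)>0$ such that for every $L>L_1$ there is a constant $\epsilon_1>0$, depending only on $m,q,L$, with the following two properties. (A) (three-circle property) There is $\delta_0>0$ such that for every $n$ and every solution $u$ on $Q_1\cup Q_2\cup Q_3$ with coefficient $\omega$, if $\|\omega\|_{L^\infty}<\delta_0$ and $\min\{\lambda_1,\lambda_2,\lambda_3\}\le\epsilon_1$, then $E_2\le e^{-qL}(E_1+E_3)$. (B) There are constants $C>0$, $\delta_2>0$ and, for every real $s$, a constant $\delta(s)>0$, such that for all $n$, $l$ and every solution $u:[0,lL]\times S^1\to\mathbb R^n$ with coefficient $\omega$ there exist integers $0\le\mathfrak a<\mathfrak b\le l+1$ such that: 1) If $\|\omega\|_{L^\infty([0,lL]\times S^1)}<\delta_2$, then, for integers $i$, $$E_i\le Ce^{-iq'L}\sup_{k=1,\dots,l}E_k\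 \text{ for } 1\le i\le\mathfrak a,\qquad E_i\le Ce^{-(l-i)q'L}\sup_{k=1,\dots,l}E_k\ \text{ for }\mathfrak b\le i\le l,$$ $$\lambda_i\ge\epsilon_1\ \text{ for }\mathfrak a+1\le i\le\mathfrak b-1,\qquad \lambda_i<\epsilon_1\ \text{ for } 1\le i\le \mathfrak a \text{ and for } \mathfrak b\le i\le l.$$ 2) For every real $s$ with $2<s<\frac14(\mathfrak b-\mathfrak a)$, if $\|\omega\|_{L^\infty([0,lL]\times S^1)}<\delta(s)$, then $$\nu_i\le 2(1+\epsilon_1^{-2})\,e^{-q'(s-2)L/2}\qquad\text{for all integers } i \text{ with }\mathfrak a+s<i<\mathfrak b-s.$$ -/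

import Mathlib

open Set MeasureTheory

noncomputable section

namespace Cylinder

/-! Functions on the flat cylinder `[0, T] × S¹`, `S¹ = ℝ / 2πℤ`, are written `u t θ` with
`u t` being `2π`-periodic. The target is Euclidean `ℝⁿ`. -/

variable {n : ℕ}

/-- The partial derivative `∂u/∂t`. -/
def dt (u : ℝ → ℝ → EuclideanSpace ℝ (Fin n)) (t θ : ℝ) : EuclideanSpace ℝ (Fin n) :=
  deriv (fun s => u s θ) t

/-- The partial derivative `∂u/∂θ`. -/
def dθ (u : ℝ → ℝ → EuclideanSpace ℝ (Fin n)) (t θ : ℝ) : EuclideanSpace ℝ (Fin n) :=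
  deriv (fun s => u t s) θ

/-- The Laplacian of the flat metric `dt² + dθ²`. -/
def lap (u : ℝ → ℝ → EuclideanSpace ℝ (Fin n)) (t θ : ℝ) : EuclideanSpace ℝ (Fin n) :=
  dt (dt u) t θ + dθ (dθ u) t θ

/-- `|∇u|`. -/
def gradNorm (u : ℝ → ℝ → EuclideanSpace ℝ (Fin n)) (t θ : ℝ) : ℝ :=
  √(‖dt u t θ‖ ^ 2 + ‖dθ u t θ‖ ^ 2)

/-- `u` is a `C²` map `[0, T] × S¹ → ℝⁿ` with `Δu = φ(x, u, ∇u)` and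
`|φ(x, u, ∇u)| ≤ ω (|u| + |∇u|)`, where `ω ≥ 0`. The functions `φ` and `ω` of `x = (t, θ) ∈ [0,T] × S¹`
only matter on the fundamental domain `0 ≤ θ < 2π`. -/
structure IsSolution (T : ℝ) (u : ℝ → ℝ → EuclideanSpace ℝ (Fin n))
    (φ : ℝ → ℝ → EuclideanSpace ℝ (Fin n) → EuclideanSpace ℝ (Fin n) →
      EuclideanSpace ℝ (Fin n) → EuclideanSpace ℝ (Fin n))
    (ω : ℝ → ℝ → ℝ) : Prop where
  contDiffOn : ContDiffOn ℝ 2 (Function.uncurry u) (Icc 0 T ×ˢ univ)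
  periodic : ∀ t ∈ Icc 0 T, Function.Periodic (u t) (2 * Real.pi)
  nonneg : ∀ t ∈ Icc 0 T, ∀ θ ∈ Ico 0 (2 * Real.pi), 0 ≤ ω t θ
  equation : ∀ t ∈ Ioo 0 T, ∀ θ ∈ Ico 0 (2 * Real.pi),
    lap u t θ = φ t θ (u t θ) (dt u t θ) (dθ u t θ)
  bound : ∀ t ∈ Ioo 0 T, ∀ θ ∈ Ico 0 (2 * Real.pi),
    ‖φ t θ (u t θ) (dt u t θ) (dθ u t θ)‖ ≤ ω t θ * (‖u t θ‖ + gradNorm u t θ)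

/-- `‖ω‖_{L^∞([0,T] × S¹)}`. -/
def supNorm (T : ℝ) (ω : ℝ → ℝ → ℝ) : ENNReal :=
  eLpNorm (Function.uncurry ω) ⊤
    ((volume : Measure (ℝ × ℝ)).restrict (Icc 0 T ×ˢ Ico 0 (2 * Real.pi)))

/-- First component of `φ(t)`: the cosine Fourier coefficient of order `m`. -/
def fourierCos (m : ℕ) (u : ℝ → ℝ → EuclideanSpace ℝ (Fin n)) (t : ℝ) :
    EuclideanSpace ℝ (Fin n) :=
  (1 / Real.pi) • ∫ θ in (0 : ℝ)..(2 * Real.pi), Real.cos (m * θ) • u t θ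

/-- Second component of `φ(t)`: the sine Fourier coefficient of order `m`. -/
def fourierSin (m : ℕ) (u : ℝ → ℝ → EuclideanSpace ℝ (Fin n)) (t : ℝ) :
    EuclideanSpace ℝ (Fin n) :=
  (1 / Real.pi) • ∫ θ in (0 : ℝ)..(2 * Real.pi), Real.sin (m * θ) • u t θ

/-- First component of `g⁺(u) = φ' + m φ`. -/
def gCos (m : ℕ) (u : ℝ → ℝ → EuclideanSpace ℝ (Fin n)) (t : ℝ) : EuclideanSpace ℝ (Fin n) :=
  deriv (fourierCos m u) t + (m : ℝ) • fourierCos m u t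

/-- Second component of `g⁺(u) = φ' + m φ`. -/
def gSin (m : ℕ) (u : ℝ → ℝ → EuclideanSpace ℝ (Fin n)) (t : ℝ) : EuclideanSpace ℝ (Fin n) :=
  deriv (fourierSin m u) t + (m : ℝ) • fourierSin m u t

/-- The midpoint `(2i - 1)L/2` of the `i`-th segment `[(i-1)L, iL]`. -/
def mid (L : ℝ) (i : ℕ) : ℝ := (2 * (i : ℝ) - 1) * L / 2

/-- `𝓕ᵢ(u) = (2m)⁻¹ e^{mt - m(2i-1)L/2} g⁺((2i-1)L/2) · (cos mθ, sin mθ)`. -/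
def proj (m : ℕ) (L : ℝ) (i : ℕ) (u : ℝ → ℝ → EuclideanSpace ℝ (Fin n)) (t θ : ℝ) :
    EuclideanSpace ℝ (Fin n) :=
  (Real.exp (m * t - m * mid L i) / (2 * m)) •
    (Real.cos (m * θ) • gCos m u (mid L i) + Real.sin (m * θ) • gSin m u (mid L i))

/-- `γᵢ(u) = |g⁺((2i-1)L/2)| e^{-m(2i-1)L/2}`. -/
def gam (m : ℕ) (L : ℝ) (i : ℕ) (u : ℝ → ℝ → EuclideanSpace ℝ (Fin n)) : ℝ :=
  √(‖gCos m u (mid L i)‖ ^ 2 + ‖gSin m u (mid L i)‖ ^ 2) * Real.exp (-(m * mid L i))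

/-- `∫_{Qᵢ} |v|² e^{-2mt} dt dθ`, where `Qᵢ = [(i-1)L, iL] × S¹`. -/
def energy (m : ℕ) (L : ℝ) (i : ℕ) (v : ℝ → ℝ → EuclideanSpace ℝ (Fin n)) : ℝ :=
  ∫ t in (((i : ℝ) - 1) * L)..((i : ℝ) * L), ∫ θ in (0 : ℝ)..(2 * Real.pi),
    ‖v t θ‖ ^ 2 * Real.exp (-(2 * m * t))

/-- `λᵢ(u) = γᵢ(u) / √Eᵢ(u)`; it is `0` when `Eᵢ(u) = 0`. -/
def lam (m : ℕ) (L : ℝ) (i : ℕ) (u : ℝ → ℝ → EuclideanSpace ℝ (Fin n)) : ℝ :=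
  gam m L i u / √(energy m L i u)

/-- `νᵢ(u) = ∫_{Qᵢ} |u - 𝓕ᵢ(u)|² e^{-2mt} / ∫_{Qᵢ} |𝓕ᵢ(u)|² e^{-2mt}`. Division in `[0, ∞]` gives
`νᵢ = 0` if both integrals vanish and `νᵢ = ∞` if only the denominator does. -/
def nu (m : ℕ) (L : ℝ) (i : ℕ) (u : ℝ → ℝ → EuclideanSpace ℝ (Fin n)) : ENNReal :=
  ENNReal.ofReal (energy m L i (fun t θ => u t θ - proj m L i u t θ)) /
    ENNReal.ofReal (energy m L i (proj m L i u))

/-- `q' = q - log 2 / L`. -/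
def qPrime (q L : ℝ) : ℝ := q - Real.log 2 / L

/-- `ε₁` is a threshold for the three-circle property: there is `δ₀ > 0` such that for every
solution on `Q₁ ∪ Q₂ ∪ Q₃` with `‖ω‖_∞ < δ₀` and `min {λ₁, λ₂, λ₃} ≤ ε₁` one has
`E₂ ≤ e^{-qL} (E₁ + E₃)`. -/
def IsThreeCircleThreshold (m : ℕ) (q L ε₁ : ℝ) : Prop :=
  ∃ δ₀ : ℝ, 0 < δ₀ ∧ ∀ (n : ℕ) (u : ℝ → ℝ → EuclideanSpace ℝ (Fin n))
    (φ : ℝ → ℝ → EuclideanSpace ℝ (Fin n) → EuclideanSpace ℝ (Fin n) →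
      EuclideanSpace ℝ (Fin n) → EuclideanSpace ℝ (Fin n))
    (ω : ℝ → ℝ → ℝ),
    IsSolution (3 * L) u φ ω → supNorm (3 * L) ω < ENNReal.ofReal δ₀ →
    min (lam m L 1 u) (min (lam m L 2 u) (lam m L 3 u)) ≤ ε₁ →
    energy m L 2 u ≤ Real.exp (-(q * L)) * (energy m L 1 u + energy m L 3 u)

end Cylinder

end

/-!
Write `z(t) = e^{-mt} a(t)` for a weighted Fourier coefficient `a` of frequency `k` of `u`. Since
`a'' = k² a + f`, with `f` the coefficient of `Δu`, the weighted coefficient satisfies a second-order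
equation with exponents `k - m` and `-k - m`. Both are at most `-1` if `k < m`; they have different
signs and absolute value at least `1` if `k > m`; and they are `0` and `-2m` if `k = m`. Hence, if
`Δu = 0`, the only component of `u` that does not decay towards the inside of a long cylinder, up
to factors polynomial in the length, is the one along the *neutral* harmonic maps
`e^{mt} (A cos mθ + B sin mθ)`. It is measured by `e^{-mt} g⁺(t)`, which is constant in that case and
is called `phase` below. The estimate `norm_mode_le` makes this quantitative for a single mode,
uniformly in `k`, with the integral of the inhomogeneity as an error term.

Squaring, summing with Parseval's identity and averaging over the end points gives
`IsC2.integral_dens_le`: the energy of the middle one of three segments is at most `κ` times that of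
the outer two, plus a constant times `|phase|² + ∫ |Δu|² e^{-2mt}`. Here `κ` is `e^{-2L}` up to a
polynomial in `L`, hence smaller than `e^{-qL} / 2` for large `L`, because `q < 2`. If
`|Δu| ≤ δ (|u| + |∇u|)`, Caccioppoli's inequality (`IsC2.integral_dens_lap_le`) bounds the integral
of `|Δu|²` by `δ²` times the energy, and by `IsC2.norm_phase_sub_sq_le` the phase is constant up
to the same error. All constants are explicit, so that no compactness argument is needed.

* The three-circle property (`exists_three_circle`) follows at once: if some `λᵢ` is small, the phase
  at the midpoint of `Qᵢ`, whose norm is `γᵢ`, is negligible compared with the energy.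
* If `λᵢ` is small, the three-circle inequality `E_i ≤ e^{-qL} (E_{i-1} + E_{i+1})` shows that `E_i` is
  at most `2e^{-qL} = e^{-q'L}` times one of its neighbours. As the phase is almost constant, `λ` is
  small on that neighbour, too, and the growth continues in the same direction up to the end of the
  cylinder. So the segments with small `λᵢ` form an initial and a final stretch
  (`exists_initial_final_stretch`, `exists_decomposition`), on which the energy decays geometrically
  towards the inside.
* On a stretch where no `λⱼ` is small, the energies of the segments are comparable with the square of
  the phase. Subtracting the neutral harmonic map `𝓕ᵢ(u)` does not change `Δu` and makes the phase
  vanish at the midpoint of `Qᵢ`. So the difference satisfies the three-circle inequality up to a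
  small error, which, iterated from the ends of the stretch, gives the bound for `νᵢ`
  (`exists_energy_sub_proj_le`).
-/

open Set MeasureTheory

namespace Cylinder

/-! ### First-order linear equations -/

theorem integral_norm_mono {E : Type*} [NormedAddCommGroup E] {F : ℝ → E} {α β s t : ℝ}
    (hF : ContinuousOn F (Icc α β)) (h1 : α ≤ s) (h2 : s ≤ t) (h3 : t ≤ β) :
    ∫ x in s..t, ‖F x‖ ≤ ∫ x in α..β, ‖F x‖ := by
  refine intervalIntegral.integral_mono_interval h1 h2 h3 (ae_of_all _ fun x => norm_nonneg _) ?_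
  refine ContinuousOn.intervalIntegrable ?_
  rw [uIcc_of_le (h1.trans (h2.trans h3))]
  exact hF.norm

section FirstOrder

variable {E : Type*} [NormedAddCommGroup E] [NormedSpace ℝ E] [CompleteSpace E]

/-- Variation of constants for `z' = σ z + F`. -/
theorem eq_exp_smul_add_integral {z F : ℝ → E} {σ s t : ℝ}
    (hz : ∀ x ∈ uIcc s t, HasDerivAt z (σ • z x + F x) x) (hF : ContinuousOn F (uIcc s t)) :
    z t = Real.exp (σ * (t - s)) • z s + ∫ x in s..t, Real.exp (σ * (t - x)) • F x := by
  have hd : ∀ x ∈ uIcc s t, HasDerivAt (fun x => Real.exp (σ * (t - x)) • z x)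
      (Real.exp (σ * (t - x)) • F x) x := by
    intro x hx
    have h1 : HasDerivAt (fun x => Real.exp (σ * (t - x))) (Real.exp (σ * (t - x)) * (σ * (-1))) x :=
      (((hasDerivAt_id x).const_sub t).const_mul σ).exp
    refine (h1.smul (hz x hx)).congr_deriv ?_
    module
  have hi : IntervalIntegrable (fun x => Real.exp (σ * (t - x)) • F x) volume s t :=
    (ContinuousOn.smul (by fun_prop) hF).intervalIntegrable
  rw [intervalIntegral.integral_eq_sub_of_hasDerivAt hd hi]
  simp

theorem norm_sub_exp_smul_le {z F : ℝ → E} {σ s t : ℝ} (hst : s ≤ t) (hσ : σ ≤ 0)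
    (hz : ∀ x ∈ Icc s t, HasDerivAt z (σ • z x + F x) x) (hF : ContinuousOn F (Icc s t)) :
    ‖z t - Real.exp (σ * (t - s)) • z s‖ ≤ ∫ x in s..t, ‖F x‖ := by
  rw [← uIcc_of_le hst] at hz hF
  rw [eq_exp_smul_add_integral hz hF, add_sub_cancel_left]
  refine intervalIntegral.norm_integral_le_of_norm_le hst ?_ hF.norm.intervalIntegrable
  refine ae_of_all _ fun x hx => ?_
  rw [norm_smul, Real.norm_eq_abs, Real.abs_exp]
  have : Real.exp (σ * (t - x)) ≤ 1 := Real.exp_le_one_iff.2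
    (mul_nonpos_of_nonpos_of_nonneg hσ (by linarith [hx.2]))
  exact mul_le_of_le_one_left (norm_nonneg _) this

theorem norm_le_exp_mul_add {z F : ℝ → E} {σ s t : ℝ} (hst : s ≤ t) (hσ : σ ≤ -1)
    (hz : ∀ x ∈ Icc s t, HasDerivAt z (σ • z x + F x) x) (hF : ContinuousOn F (Icc s t)) :
    ‖z t‖ ≤ Real.exp (-(t - s)) * ‖z s‖ + ∫ x in s..t, ‖F x‖ := by
  have h := norm_sub_exp_smul_le hst (by linarith) hz hF
  have h2 : ‖Real.exp (σ * (t - s)) • z s‖ ≤ Real.exp (-(t - s)) * ‖z s‖ := by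
    rw [norm_smul, Real.norm_eq_abs, Real.abs_exp]
    gcongr
    nlinarith
  have h3 := norm_sub_norm_le (z t) (Real.exp (σ * (t - s)) • z s)
  linarith

/-- If `v' = μ v + Z` and `Z' = σ Z + F` with `σ ≤ 0`, the initial value of `Z` is controlled by two
values of `v`. -/
theorem integral_exp_mul_norm_le {v Z F : ℝ → E} {μ σ s B : ℝ} (hσ : σ ≤ 0) (hB : 1 ≤ B)
    (hμB : Real.exp (-μ) ≤ B)
    (hv : ∀ x ∈ Icc s (s + 1), HasDerivAt v (μ • v x + Z x) x)
    (hZ : ∀ x ∈ Icc s (s + 1), HasDerivAt Z (σ • Z x + F x) x)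
    (hF : ContinuousOn F (Icc s (s + 1))) :
    (∫ x in s..(s + 1), Real.exp ((σ - μ) * (x - s))) * ‖Z s‖ ≤
      B * (‖v s‖ + ‖v (s + 1)‖ + ∫ x in s..(s + 1), ‖F x‖) := by
  have hs : s ≤ s + 1 := by linarith
  have hZc : ContinuousOn Z (uIcc s (s + 1)) := by
    rw [uIcc_of_le hs]
    exact fun x hx => (hZ x hx).continuousAt.continuousWithinAt
  have hN : ∀ x ∈ Icc s (s + 1), ‖Z x - Real.exp (σ * (x - s)) • Z s‖ ≤
      ∫ x in s..(s + 1), ‖F x‖ := fun x hx =>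
    (norm_sub_exp_smul_le hx.1 hσ (fun y hy => hZ y ⟨hy.1, hy.2.trans hx.2⟩)
      (hF.mono (Icc_subset_Icc le_rfl hx.2))).trans
      (integral_norm_mono hF le_rfl hx.1 hx.2)
  set N := ∫ x in s..(s + 1), ‖F x‖
  have hvs := eq_exp_smul_add_integral (z := v) (F := Z) (σ := μ) (s := s) (t := s + 1)
    (by rwa [uIcc_of_le hs]) hZc
  have hD : ∫ x in s..(s + 1), Real.exp (-μ * (x - s)) • Z x =
      Real.exp (-μ) • v (s + 1) - v s := by
    rw [hvs, smul_add, smul_smul, ← Real.exp_add, ← intervalIntegral.integral_smul]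
    have : -μ + μ * (s + 1 - s) = 0 := by ring
    rw [this, Real.exp_zero, one_smul, add_sub_cancel_left]
    refine intervalIntegral.integral_congr fun x _ => ?_
    simp only [smul_smul, ← Real.exp_add]
    congr 2
    ring
  have hE : ‖(∫ x in s..(s + 1), Real.exp (-μ * (x - s)) • Z x) -
      (∫ x in s..(s + 1), Real.exp ((σ - μ) * (x - s))) • Z s‖ ≤ B * N := by
    have hi1 : IntervalIntegrable (fun x => Real.exp (-μ * (x - s)) • Z x) volume s (s + 1) :=
      (ContinuousOn.smul (by fun_prop) hZc).intervalIntegrable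
    have hi2 : IntervalIntegrable (fun x => Real.exp ((σ - μ) * (x - s)) • Z s) volume s (s + 1) :=
      Continuous.intervalIntegrable (by fun_prop) _ _
    rw [← intervalIntegral.integral_smul_const, ← intervalIntegral.integral_sub hi1 hi2]
    have := intervalIntegral.norm_integral_le_of_norm_le_const (a := s) (b := s + 1) (C := B * N)
      (f := fun x => Real.exp (-μ * (x - s)) • Z x - Real.exp ((σ - μ) * (x - s)) • Z s) ?_
    · simpa using this
    intro x hx
    rw [uIoc_of_le hs] at hx
    have h1 : Real.exp (-μ * (x - s)) • Z x - Real.exp ((σ - μ) * (x - s)) • Z s =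
        Real.exp (-μ * (x - s)) • (Z x - Real.exp (σ * (x - s)) • Z s) := by
      rw [smul_sub, smul_smul, ← Real.exp_add]
      congr 3
      ring
    rw [h1, norm_smul, Real.norm_eq_abs, Real.abs_exp]
    have h2 : Real.exp (-μ * (x - s)) ≤ B := by
      rcases le_or_gt 0 μ with h | h
      · refine (Real.exp_le_one_iff.2 ?_).trans hB
        nlinarith [hx.1]
      · refine (Real.exp_le_exp.2 ?_).trans hμB
        nlinarith [hx.2]
    exact mul_le_mul h2 (hN x ⟨hx.1.le, hx.2⟩) (norm_nonneg _) (by linarith)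
  rw [hD] at hE
  set c := ∫ x in s..(s + 1), Real.exp ((σ - μ) * (x - s))
  have hc : 0 ≤ c := intervalIntegral.integral_nonneg hs fun x _ => (Real.exp_pos _).le
  have h3 : c * ‖Z s‖ = ‖c • Z s‖ := by rw [norm_smul, Real.norm_of_nonneg hc]
  have h4 : ‖Real.exp (-μ) • v (s + 1) - v s‖ ≤ B * ‖v (s + 1)‖ + B * ‖v s‖ := by
    refine (norm_sub_le _ _).trans ?_
    rw [norm_smul, Real.norm_eq_abs, Real.abs_exp]
    gcongr
    exact le_mul_of_one_le_left (norm_nonneg _) hB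
  have h5 := norm_sub_norm_le (c • Z s) (Real.exp (-μ) • v (s + 1) - v s)
  rw [norm_sub_rev (c • Z s)] at h5
  rw [h3]
  linarith

theorem one_div_le_integral_exp {κ : ℝ} (hκ : 1 ≤ κ) (s : ℝ) :
    1 / (2 * κ) ≤ ∫ x in s..(s + 1), Real.exp (-κ * (x - s)) := by
  have hd : ∀ x ∈ uIcc s (s + 1), HasDerivAt (fun x => -(Real.exp (-κ * (x - s)) / κ))
      (Real.exp (-κ * (x - s))) x := by
    intro x _
    have h1 : HasDerivAt (fun x => Real.exp (-κ * (x - s)))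
        (Real.exp (-κ * (x - s)) * (-κ * 1)) x :=
      (((hasDerivAt_id x).sub_const s).const_mul (-κ)).exp
    refine (h1.div_const κ).neg.congr_deriv ?_
    have : κ ≠ 0 := by linarith
    field_simp
  rw [intervalIntegral.integral_eq_sub_of_hasDerivAt hd
    (Continuous.intervalIntegrable (by fun_prop) _ _)]
  have h2 : Real.exp (-κ) ≤ 1 / 2 := by
    have h3 : Real.exp (-κ) ≤ Real.exp (-1) := Real.exp_le_exp.2 (by linarith)
    have h4 := Real.exp_neg_one_lt_d9
    norm_num at h4 ⊢
    linarith
  have h5 : -(Real.exp (-κ * (s + 1 - s)) / κ) - -(Real.exp (-κ * (s - s)) / κ) =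
      (1 - Real.exp (-κ)) / κ := by
    simp
    ring
  rw [h5, div_le_div_iff₀ (by linarith) (by linarith)]
  nlinarith

/-- Decay of the decaying first-order factor `R` of a second-order equation whose other exponent is
nonnegative, controlled by the values of the solution `v` near the left end. The division by the gap
`μ - σ` makes the bound uniform in the mode. -/
theorem norm_decaying_factor_le {v R F : ℝ → E} {μ σ α β s t : ℝ} (hμ : 0 ≤ μ) (hσ : σ ≤ -1)
    (hv : ∀ x ∈ Icc α β, HasDerivAt v (μ • v x + R x) x)
    (hR : ∀ x ∈ Icc α β, HasDerivAt R (σ • R x + F x) x)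
    (hF : ContinuousOn F (Icc α β)) (hs : α ≤ s) (hst : s + 1 ≤ t) (ht : t ≤ β) :
    ‖R t‖ / (μ - σ) ≤ 2 * Real.exp (-(t - s)) * (‖v s‖ + ‖v (s + 1)‖) +
      3 * ∫ x in α..β, ‖F x‖ := by
  have hsub : Icc s (s + 1) ⊆ Icc α β := Icc_subset_Icc hs (by linarith)
  have hsub2 : Icc s t ⊆ Icc α β := Icc_subset_Icc hs (by linarith)
  have h1 := integral_exp_mul_norm_le (B := 1) (by linarith) le_rfl
    (Real.exp_le_one_iff.2 (by linarith)) (fun x hx => hv x (hsub hx)) (fun x hx => hR x (hsub hx))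
    (hF.mono hsub)
  have h2 := norm_le_exp_mul_add (s := s) (t := t) (by linarith) hσ
    (fun x hx => hR x (hsub2 hx)) (hF.mono hsub2)
  have h3 := one_div_le_integral_exp (κ := μ - σ) (by linarith) s
  rw [neg_sub] at h3
  have h4 := integral_norm_mono hF hs (by linarith : s ≤ s + 1) (by linarith)
  have h5 := integral_norm_mono hF hs (by linarith : s ≤ t) (by linarith)
  set N := ∫ x in α..β, ‖F x‖
  have hN : 0 ≤ N := intervalIntegral.integral_nonneg (by linarith) fun x _ => norm_nonneg _
  have hκ : 1 ≤ μ - σ := by linarith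
  set κ := μ - σ
  have h6 : ‖R s‖ / κ ≤ 2 * (‖v s‖ + ‖v (s + 1)‖ + N) := by
    have h7 : 1 / (2 * κ) * ‖R s‖ ≤ ‖v s‖ + ‖v (s + 1)‖ + N :=
      (mul_le_mul_of_nonneg_right h3 (norm_nonneg _)).trans (h1.trans (by linarith))
    have h8 : ‖R s‖ / κ = 2 * (1 / (2 * κ) * ‖R s‖) := by field_simp
    rw [h8]; linarith
  have h9 : ‖R t‖ / κ ≤ Real.exp (-(t - s)) * (‖R s‖ / κ) + N := by
    have : ‖R t‖ / κ ≤ (Real.exp (-(t - s)) * ‖R s‖ + N) / κ := by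
      gcongr; linarith
    refine this.trans ?_
    rw [add_div, mul_div_assoc]
    gcongr
    exact div_le_self hN hκ
  have h10 : Real.exp (-(t - s)) ≤ 1 := Real.exp_le_one_iff.2 (by linarith)
  have h11 := mul_le_mul_of_nonneg_left h6 (Real.exp_pos (-(t - s))).le
  have h12 := mul_le_mul_of_nonneg_right h10 hN
  linarith

/-- The time reversal of `norm_decaying_factor_le`. -/
theorem norm_growing_factor_le {v P F : ℝ → E} {μ σ α β s t : ℝ} (hμ : μ ≤ 0) (hσ : 1 ≤ σ)
    (hv : ∀ x ∈ Icc α β, HasDerivAt v (μ • v x + P x) x)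
    (hP : ∀ x ∈ Icc α β, HasDerivAt P (σ • P x + F x) x)
    (hF : ContinuousOn F (Icc α β)) (hs : s ≤ β) (hst : t ≤ s - 1) (ht : α ≤ t) :
    ‖P t‖ / (σ - μ) ≤ 2 * Real.exp (-(s - t)) * (‖v s‖ + ‖v (s - 1)‖) +
      3 * ∫ x in α..β, ‖F x‖ := by
  have hneg : ∀ x ∈ Icc (-β) (-α), -x ∈ Icc α β := fun x hx =>
    ⟨by linarith [hx.2], by linarith [hx.1]⟩
  have h := norm_decaying_factor_le (v := fun x => v (-x)) (R := fun x => -P (-x))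
    (F := fun x => F (-x)) (μ := -μ) (σ := -σ) (α := -β) (β := -α) (s := -s) (t := -t)
    (by linarith) (by linarith) ?_ ?_ ?_ (by linarith) (by linarith) (by linarith)
  · have h1 : -(-s + 1) = s - 1 := by ring
    have h2 : -μ - -σ = σ - μ := by ring
    have h3 : -t - -s = s - t := by ring
    simp only [neg_neg, norm_neg, h1, h2, h3] at h
    rwa [intervalIntegral.integral_comp_neg (fun x => ‖F x‖), neg_neg, neg_neg] at h
  · intro x hx
    refine ((hv (-x) (hneg x hx)).scomp x (hasDerivAt_neg x)).congr_deriv ?_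
    module
  · intro x hx
    refine ((hP (-x) (hneg x hx)).scomp x (hasDerivAt_neg x)).neg.congr_deriv ?_
    module
  · exact hF.comp (by fun_prop) hneg

/-- Decay when both exponents are at most `-1`; they may coincide, whence the factor linear in the
length. -/
theorem norm_le_of_both_decaying {v P F : ℝ → E} {μ σ α β s t ℓ B : ℝ} (hμ : μ ≤ -1) (hσ : σ ≤ -1)
    (hμσ : μ ≤ σ) (hB : Real.exp (-μ) ≤ B) (hℓ : β - α ≤ ℓ)
    (hv : ∀ x ∈ Icc α β, HasDerivAt v (μ • v x + P x) x)
    (hP : ∀ x ∈ Icc α β, HasDerivAt P (σ • P x + F x) x)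
    (hF : ContinuousOn F (Icc α β)) (hs : α ≤ s) (hst : s + 1 ≤ t) (ht : t ≤ β) :
    ‖v t‖ ≤ (1 + ℓ) * B * Real.exp (-(t - s)) * (‖v s‖ + ‖v (s + 1)‖) +
      ℓ * (B + 1) * ∫ x in α..β, ‖F x‖ := by
  have hsub : Icc s (s + 1) ⊆ Icc α β := Icc_subset_Icc hs (by linarith)
  have hsub2 : Icc s t ⊆ Icc α β := Icc_subset_Icc hs (by linarith)
  have hB1 : 1 ≤ B := (Real.one_le_exp (by linarith)).trans hB
  have h1 := integral_exp_mul_norm_le (B := B) (by linarith) hB1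
    hB (fun x hx => hv x (hsub hx)) (fun x hx => hP x (hsub hx)) (hF.mono hsub)
  have hc : 1 ≤ ∫ x in s..(s + 1), Real.exp ((σ - μ) * (x - s)) := by
    have := intervalIntegral.integral_mono_on (μ := volume) (a := s) (b := s + 1) (f := fun _ => (1 : ℝ))
      (g := fun x => Real.exp ((σ - μ) * (x - s))) (by linarith)
      (Continuous.intervalIntegrable continuous_const _ _)
      (Continuous.intervalIntegrable (by fun_prop) _ _)
      (fun x hx => Real.one_le_exp (mul_nonneg (by linarith) (by linarith [hx.1])))
    simpa using this
  have h4 := integral_norm_mono hF hs (by linarith : s ≤ s + 1) (by linarith)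
  set N := ∫ x in α..β, ‖F x‖
  have hN : 0 ≤ N := intervalIntegral.integral_nonneg (by linarith) fun x _ => norm_nonneg _
  have hPs : ‖P s‖ ≤ B * (‖v s‖ + ‖v (s + 1)‖ + N) := by
    refine (le_mul_of_one_le_left (norm_nonneg _) hc).trans (h1.trans ?_)
    gcongr
  have hPc : ContinuousOn P (Icc s t) := fun x hx =>
    (hP x (hsub2 hx)).continuousAt.continuousWithinAt
  have hst' : s ≤ t := by linarith
  have hrep := eq_exp_smul_add_integral (z := v) (F := P) (σ := μ) (s := s) (t := t)
    (by rw [uIcc_of_le hst']; exact fun x hx => hv x (hsub2 hx)) (by rwa [uIcc_of_le hst'])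
  have hint : ‖∫ x in s..t, Real.exp (μ * (t - x)) • P x‖ ≤
      (Real.exp (-(t - s)) * ‖P s‖ + N) * |t - s| := by
    refine intervalIntegral.norm_integral_le_of_norm_le_const fun x hx => ?_
    rw [uIoc_of_le hst'] at hx
    rw [norm_smul, Real.norm_eq_abs, Real.abs_exp]
    have h5 := norm_le_exp_mul_add (s := s) (t := x) hx.1.le hσ
      (fun y hy => hP y (hsub2 ⟨hy.1, hy.2.trans hx.2⟩))
      (hF.mono (Icc_subset_Icc hs (by linarith [hx.2])))
    have h6 := integral_norm_mono hF hs hx.1.le (by linarith [hx.2])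
    have h7 : Real.exp (μ * (t - x)) ≤ Real.exp (-(t - x)) :=
      Real.exp_le_exp.2 (by nlinarith [hx.2])
    have h8 : Real.exp (-(t - x)) ≤ 1 := Real.exp_le_one_iff.2 (by linarith [hx.2])
    calc Real.exp (μ * (t - x)) * ‖P x‖
        ≤ Real.exp (-(t - x)) * (Real.exp (-(x - s)) * ‖P s‖ + N) := by
          gcongr; linarith
      _ = Real.exp (-(t - s)) * ‖P s‖ + Real.exp (-(t - x)) * N := by
          rw [mul_add, ← mul_assoc, ← Real.exp_add]; ring_nf
      _ ≤ _ := by gcongr; exact mul_le_of_le_one_left hN h8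
  rw [abs_of_nonneg (by linarith)] at hint
  have h9 : ‖v t‖ ≤ Real.exp (-(t - s)) * ‖v s‖ +
      (Real.exp (-(t - s)) * ‖P s‖ + N) * (t - s) := by
    rw [hrep]
    refine (norm_add_le _ _).trans (add_le_add ?_ hint)
    rw [norm_smul, Real.norm_eq_abs, Real.abs_exp]
    gcongr
    nlinarith
  have hA1 : Real.exp (-(t - s)) ≤ 1 := Real.exp_le_one_iff.2 (by linarith)
  set A := Real.exp (-(t - s))
  have hA : 0 < A := Real.exp_pos _
  have hts : t - s ≤ ℓ := by linarith
  set X := ‖v s‖ + ‖v (s + 1)‖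
  have hX : 0 ≤ X := by positivity
  have hvX : ‖v s‖ ≤ X := le_add_of_nonneg_right (norm_nonneg _)
  have h10 : (A * ‖P s‖ + N) * (t - s) ≤ (A * (B * (X + N)) + N) * ℓ := by
    have : 0 ≤ A * (B * (X + N)) + N := by positivity
    gcongr
  have h11 : A * ‖v s‖ ≤ B * (A * X) := by
    have : A * ‖v s‖ ≤ A * X := by gcongr
    refine this.trans (le_mul_of_one_le_left (by positivity) hB1)
  have hℓ0 : 0 ≤ ℓ := by linarith
  have h12 : A * (B * N * ℓ) ≤ B * N * ℓ := mul_le_of_le_one_left (by positivity) hA1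
  nlinarith

end FirstOrder

/-! ### Interior estimates for a single Fourier mode -/

section Modes

variable {E : Type*} [NormedAddCommGroup E] [NormedSpace ℝ E] [CompleteSpace E]

/-- Interior estimate, uniform in the mode `k`, for a solution of `y'' = k² y + f`. With the weight
`e^{-mx}` the exponents are `k - m` and `-k - m`; the solution decays from the left end if `k < m`,
splits into a part decaying from the left and a part decaying from the right end if `k > m`, and
contains the nearly conserved quantity `e^{-mx} (y' + m y)` if `k = m`. -/
theorem norm_mode_le {m k : ℕ} (hm : 1 ≤ m) {y y' f : ℝ → E} {α β ℓ s s' t r : ℝ}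
    (hy : ∀ x ∈ Icc α β, HasDerivAt y (y' x) x)
    (hy' : ∀ x ∈ Icc α β, HasDerivAt y' ((k : ℝ) ^ 2 • y x + f x) x)
    (hf : ContinuousOn f (Icc α β)) (hℓ : β - α ≤ ℓ) (hs : α ≤ s) (hst : s + 1 ≤ t)
    (hts' : t ≤ s' - 1) (hs' : s' ≤ β) (hr : r ∈ Icc α β) :
    ‖Real.exp (-(m * t)) • y t‖ ≤ (2 + ℓ) * Real.exp (2 * m) *
      (Real.exp (-(t - s)) *
        (‖Real.exp (-(m * s)) • y s‖ + ‖Real.exp (-(m * (s + 1))) • y (s + 1)‖) +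
      Real.exp (-(s' - t)) *
        (‖Real.exp (-(m * s')) • y s'‖ + ‖Real.exp (-(m * (s' - 1))) • y (s' - 1)‖)) +
      (6 + 2 * ℓ * Real.exp (2 * m)) * (∫ x in α..β, ‖Real.exp (-(m * x)) • f x‖) +
      if k = m then ‖Real.exp (-(m * r)) • (y' r + (m : ℝ) • y r)‖ else 0 := by
  set v : ℝ → E := fun x => Real.exp (-(m * x)) • y x with hv
  set F : ℝ → E := fun x => Real.exp (-(m * x)) • f x with hFdef
  set P : ℝ → E := fun x => Real.exp (-(m * x)) • (y' x + (k : ℝ) • y x) with hP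
  set R : ℝ → E := fun x => Real.exp (-(m * x)) • (y' x - (k : ℝ) • y x) with hR
  have hexp : ∀ x : ℝ, HasDerivAt (fun x : ℝ => Real.exp (-(m * x)))
      (Real.exp (-(m * x)) * (-(m * 1))) x := fun x =>
    (((hasDerivAt_id x).const_mul (m : ℝ)).neg).exp
  have hF : ContinuousOn F (Icc α β) := ContinuousOn.smul (by fun_prop) hf
  have hvP : ∀ x ∈ Icc α β, HasDerivAt v ((-((m : ℝ) + k)) • v x + P x) x := fun x hx => by
    refine ((hexp x).smul (hy x hx)).congr_deriv ?_
    simp only [hv, hP]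
    module
  have hvR : ∀ x ∈ Icc α β, HasDerivAt v (((k : ℝ) - m) • v x + R x) x := fun x hx => by
    refine ((hexp x).smul (hy x hx)).congr_deriv ?_
    simp only [hv, hR]
    module
  have hPP : ∀ x ∈ Icc α β, HasDerivAt P (((k : ℝ) - m) • P x + F x) x := fun x hx => by
    refine ((hexp x).smul ((hy' x hx).add ((hy x hx).const_smul (k : ℝ)))).congr_deriv ?_
    simp only [hFdef, hP, Pi.add_apply, Pi.smul_apply]
    module
  have hRR : ∀ x ∈ Icc α β, HasDerivAt R ((-((m : ℝ) + k)) • R x + F x) x := fun x hx => by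
    refine ((hexp x).smul ((hy' x hx).sub ((hy x hx).const_smul (k : ℝ)))).congr_deriv ?_
    simp only [hFdef, hR, Pi.sub_apply, Pi.smul_apply]
    module
  have hm' : (1 : ℝ) ≤ m := by exact_mod_cast hm
  have hk0 : (0 : ℝ) ≤ k := by positivity
  have hN : 0 ≤ ∫ x in α..β, ‖F x‖ :=
    intervalIntegral.integral_nonneg (by linarith) fun x _ => norm_nonneg _
  set N := ∫ x in α..β, ‖F x‖
  have hℓ0 : 0 ≤ ℓ := by linarith
  have he1 : 1 ≤ Real.exp (2 * m) := Real.one_le_exp (by positivity)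
  have hB : 2 ≤ (2 + ℓ) * Real.exp (2 * m) := by nlinarith
  have hA : 0 < Real.exp (-(t - s)) := Real.exp_pos _
  have hA' : 0 < Real.exp (-(s' - t)) := Real.exp_pos _
  have hX : 0 ≤ ‖v s‖ + ‖v (s + 1)‖ := by positivity
  have hX' : 0 ≤ ‖v s'‖ + ‖v (s' - 1)‖ := by positivity
  change ‖v t‖ ≤ (2 + ℓ) * Real.exp (2 * m) *
      (Real.exp (-(t - s)) * (‖v s‖ + ‖v (s + 1)‖) +
      Real.exp (-(s' - t)) * (‖v s'‖ + ‖v (s' - 1)‖)) +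
      (6 + 2 * ℓ * Real.exp (2 * m)) * N + _
  rcases lt_trichotomy k m with hkm | hkm | hkm
  · -- Both exponents are at most `-1`.
    have hkm' : (k : ℝ) + 1 ≤ m := by exact_mod_cast hkm
    have h1 := norm_le_of_both_decaying (B := Real.exp (2 * m)) (ℓ := ℓ) (by linarith)
      (by linarith) (by linarith) (Real.exp_le_exp.2 (by linarith)) hℓ hvP hPP hF hs hst
      (by linarith)
    rw [if_neg hkm.ne]
    set A := Real.exp (-(t - s))
    set A' := Real.exp (-(s' - t))
    set D := Real.exp (2 * m)
    set X := ‖v s‖ + ‖v (s + 1)‖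
    set X' := ‖v s'‖ + ‖v (s' - 1)‖
    have h2 : (1 + ℓ) * D * A * X ≤ (2 + ℓ) * D * (A * X + A' * X') := by
      have : 0 ≤ D * (A * X) := by positivity
      have : 0 ≤ (2 + ℓ) * D * (A' * X') := by positivity
      nlinarith
    have h3 : ℓ * (D + 1) * N ≤ (6 + 2 * ℓ * D) * N := by
      gcongr
      nlinarith
    linarith
  -- For `k ≥ m` the solution splits as `2k v = P - R`, where `R` decays from the left end.
  all_goals
    have hk1 : (1 : ℝ) ≤ k := by exact_mod_cast (by omega : 1 ≤ k)
    have hkm' : (m : ℝ) ≤ k := by exact_mod_cast (by omega : m ≤ k)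
    have hRt := norm_decaying_factor_le (s := s) (t := t) (by linarith) (by linarith) hvR hRR hF hs
      hst (by linarith)
    have e1 : (k : ℝ) - m - -(m + k) = 2 * k := by ring
    rw [e1] at hRt
    have hvt : v t = (2 * (k : ℝ))⁻¹ • (P t - R t) := by
      have : P t - R t = (2 * (k : ℝ)) • v t := by simp only [hP, hR, hv]; module
      rw [this, smul_smul, inv_mul_cancel₀ (by positivity), one_smul]
    have hvt2 : ‖v t‖ ≤ ‖P t‖ / (2 * k) + ‖R t‖ / (2 * k) := by
      rw [hvt, norm_smul, norm_inv, Real.norm_of_nonneg (by positivity : (0 : ℝ) ≤ 2 * k),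
        ← add_div, div_eq_inv_mul]
      gcongr
      exact norm_sub_le _ _
    have hKN : 6 * N ≤ (6 + 2 * ℓ * Real.exp (2 * m)) * N := by
      gcongr
      have : 0 ≤ 2 * ℓ * Real.exp (2 * m) := by positivity
      linarith
    have hmain : 2 * (Real.exp (-(t - s)) * (‖v s‖ + ‖v (s + 1)‖) +
        Real.exp (-(s' - t)) * (‖v s'‖ + ‖v (s' - 1)‖)) ≤ (2 + ℓ) * Real.exp (2 * m) *
      (Real.exp (-(t - s)) * (‖v s‖ + ‖v (s + 1)‖) +
      Real.exp (-(s' - t)) * (‖v s'‖ + ‖v (s' - 1)‖)) := by gcongr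
  · -- For `k = m` the factor `P` is constant up to the integral of `F`.
    have hP0 : ∀ x ∈ uIcc r t, HasDerivAt P ((0 : ℝ) • P x + F x) x := by
      intro x hx
      have hx' : x ∈ Icc α β :=
        (convex_Icc α β).ordConnected.uIcc_subset hr ⟨by linarith, by linarith⟩ hx
      refine (hPP x hx').congr_deriv ?_
      rw [hkm, sub_self]
    have hsub : uIcc r t ⊆ Icc α β :=
      (convex_Icc α β).ordConnected.uIcc_subset hr ⟨by linarith, by linarith⟩
    have hPt := eq_exp_smul_add_integral hP0 (hF.mono hsub)
    have h1 : ‖P t‖ ≤ ‖P r‖ + N := by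
      rw [hPt]
      simp only [zero_mul, Real.exp_zero, one_smul]
      refine (norm_add_le _ _).trans (add_le_add le_rfl ?_)
      refine (intervalIntegral.norm_integral_le_abs_integral_norm).trans ?_
      rcases le_total r t with h | h
      · rw [abs_of_nonneg (intervalIntegral.integral_nonneg h fun x _ => norm_nonneg _)]
        exact integral_norm_mono hF hr.1 h (by linarith)
      · rw [intervalIntegral.integral_symm, abs_neg,
          abs_of_nonneg (intervalIntegral.integral_nonneg h fun x _ => norm_nonneg _)]
        exact integral_norm_mono hF (by linarith) h hr.2
    have h2 : ‖P t‖ / (2 * k) ≤ ‖P r‖ + N :=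
      (div_le_self (norm_nonneg _) (by linarith)).trans h1
    have h3 : P r = Real.exp (-(m * r)) • (y' r + (m : ℝ) • y r) := by rw [hP, hkm]
    rw [if_pos hkm, ← h3]
    have := mul_nonneg hA'.le hX'
    linarith
  · -- For `k > m` the factor `P` decays from the right end.
    have hkm2 : (m : ℝ) + 1 ≤ k := by exact_mod_cast hkm
    have hPt := norm_growing_factor_le (s := s') (t := t) (by linarith) (by linarith) hvP hPP hF hs'
      hts' (by linarith)
    have e2 : (k : ℝ) - m - -(m + k) = 2 * k := by ring
    rw [e2] at hPt
    rw [if_neg hkm.ne']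
    linarith

theorem sq_integral_le {g : ℝ → ℝ} {α β ℓ : ℝ} (hαβ : α ≤ β) (hℓ : β - α ≤ ℓ)
    (hg : ContinuousOn g (Icc α β)) :
    (∫ x in α..β, g x) ^ 2 ≤ ℓ * ∫ x in α..β, g x ^ 2 := by
  set N := ∫ x in α..β, g x with hN
  rcases hαβ.eq_or_lt with rfl | hlt
  · simp [hN]
  have hg1 : IntervalIntegrable g volume α β := by
    apply ContinuousOn.intervalIntegrable; rwa [uIcc_of_le hαβ]
  have hg2 : IntervalIntegrable (fun x => g x ^ 2) volume α β := by
    apply ContinuousOn.intervalIntegrable; rw [uIcc_of_le hαβ]; exact hg.pow 2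
  have hQ : 0 ≤ ∫ x in α..β, g x ^ 2 := intervalIntegral.integral_nonneg hαβ fun x _ => sq_nonneg _
  -- Integrate `(g - N / (β - α))² ≥ 0`.
  have h : 0 ≤ ∫ x in α..β, (g x - N / (β - α)) ^ 2 :=
    intervalIntegral.integral_nonneg hαβ fun x _ => sq_nonneg _
  have h2 : ∫ x in α..β, (g x - N / (β - α)) ^ 2 =
      (∫ x in α..β, g x ^ 2) - 2 * (N / (β - α)) * N + (β - α) * (N / (β - α)) ^ 2 := by
    have : ∀ x, (g x - N / (β - α)) ^ 2 =
        g x ^ 2 - 2 * (N / (β - α)) * g x + (N / (β - α)) ^ 2 := fun x => by ring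
    simp_rw [this]
    rw [intervalIntegral.integral_add (hg2.sub (hg1.const_mul _)) (by simp),
      intervalIntegral.integral_sub hg2 (hg1.const_mul _), intervalIntegral.integral_const_mul, ← hN]
    simp
  rw [h2] at h
  have hd : 0 < β - α := by linarith
  have h3 : (∫ x in α..β, g x ^ 2) - 2 * (N / (β - α)) * N + (β - α) * (N / (β - α)) ^ 2 =
      (∫ x in α..β, g x ^ 2) - N ^ 2 / (β - α) := by
    field_simp; ring
  rw [h3, sub_nonneg, div_le_iff₀ hd] at h
  nlinarith

/-- The square of `norm_mode_le`, in the form in which it is summed over the modes. -/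
theorem norm_sq_mode_le {m k : ℕ} (hm : 1 ≤ m) {y y' f : ℝ → E} {α β ℓ s s' t r A : ℝ}
    (hy : ∀ x ∈ Icc α β, HasDerivAt y (y' x) x)
    (hy' : ∀ x ∈ Icc α β, HasDerivAt y' ((k : ℝ) ^ 2 • y x + f x) x)
    (hf : ContinuousOn f (Icc α β)) (hℓ : β - α ≤ ℓ) (hs : α ≤ s) (hst : s + 1 ≤ t)
    (hts' : t ≤ s' - 1) (hs' : s' ≤ β) (hr : r ∈ Icc α β)
    (hA : Real.exp (-(t - s)) ≤ A) (hA' : Real.exp (-(s' - t)) ≤ A) :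
    ‖Real.exp (-(m * t)) • y t‖ ^ 2 ≤ 6 * ((2 + ℓ) * Real.exp (2 * m) * A) ^ 2 *
      (‖Real.exp (-(m * s)) • y s‖ ^ 2 + ‖Real.exp (-(m * (s + 1))) • y (s + 1)‖ ^ 2 +
        (‖Real.exp (-(m * s')) • y s'‖ ^ 2 + ‖Real.exp (-(m * (s' - 1))) • y (s' - 1)‖ ^ 2)) +
      6 * (6 + 2 * ℓ * Real.exp (2 * m)) ^ 2 * ℓ *
        (∫ x in α..β, ‖Real.exp (-(m * x)) • f x‖ ^ 2) +
      6 * if k = m then ‖Real.exp (-(m * r)) • (y' r + (m : ℝ) • y r)‖ ^ 2 else 0 := by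
  have h := norm_mode_le hm hy hy' hf hℓ hs hst hts' hs' hr
  have hF : ContinuousOn (fun x => ‖Real.exp (-(m * x)) • f x‖) (Icc α β) :=
    (ContinuousOn.smul (by fun_prop) hf).norm
  have hN := sq_integral_le (by linarith) hℓ hF
  have hN0 : 0 ≤ ∫ x in α..β, ‖Real.exp (-(m * x)) • f x‖ :=
    intervalIntegral.integral_nonneg (by linarith) fun x _ => norm_nonneg _
  set N := ∫ x in α..β, ‖Real.exp (-(m * x)) • f x‖
  set x1 := ‖Real.exp (-(m * s)) • y s‖
  set x2 := ‖Real.exp (-(m * (s + 1))) • y (s + 1)‖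
  set x3 := ‖Real.exp (-(m * s')) • y s'‖
  set x4 := ‖Real.exp (-(m * (s' - 1))) • y (s' - 1)‖
  set g := if k = m then ‖Real.exp (-(m * r)) • (y' r + (m : ℝ) • y r)‖ else 0 with hg
  have hg2 : (if k = m then ‖Real.exp (-(m * r)) • (y' r + (m : ℝ) • y r)‖ ^ 2 else 0) = g ^ 2 := by
    rw [hg]; split_ifs <;> simp
  have hg0 : 0 ≤ g := by rw [hg]; split_ifs <;> positivity
  rw [hg2]
  have hℓ0 : 0 ≤ ℓ := by linarith
  set K := 6 + 2 * ℓ * Real.exp (2 * m)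
  have hK : 0 ≤ K := by positivity
  set B := (2 + ℓ) * Real.exp (2 * m)
  have hB : 0 ≤ B := by positivity
  have hx1 : 0 ≤ x1 := norm_nonneg _
  have hx2 : 0 ≤ x2 := norm_nonneg _
  have hx3 : 0 ≤ x3 := norm_nonneg _
  have hx4 : 0 ≤ x4 := norm_nonneg _
  have h1 : ‖Real.exp (-(m * t)) • y t‖ ≤ B * A * (x1 + x2 + (x3 + x4)) + K * N + g := by
    refine h.trans ?_
    have : B * (Real.exp (-(t - s)) * (x1 + x2) + Real.exp (-(s' - t)) * (x3 + x4)) ≤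
        B * (A * (x1 + x2) + A * (x3 + x4)) := by gcongr
    linarith
  have h2 : ‖Real.exp (-(m * t)) • y t‖ ^ 2 ≤ (B * A * (x1 + x2 + (x3 + x4)) + K * N + g) ^ 2 := by
    gcongr
  have h3 : (B * A * (x1 + x2 + (x3 + x4)) + K * N + g) ^ 2 ≤
      6 * ((B * A * x1) ^ 2 + (B * A * x2) ^ 2 + (B * A * x3) ^ 2 + (B * A * x4) ^ 2 + (K * N) ^ 2 +
        g ^ 2) := by
    have := sq_sum_le_card_mul_sum_sq (s := Finset.univ)
      (f := ![B * A * x1, B * A * x2, B * A * x3, B * A * x4, K * N, g])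
    simp [Fin.sum_univ_succ] at this
    refine le_trans (le_of_eq ?_) (this.trans (le_of_eq ?_)) <;> ring
  have h4 : (K * N) ^ 2 ≤ K ^ 2 * (ℓ * ∫ x in α..β, ‖Real.exp (-(m * x)) • f x‖ ^ 2) := by
    rw [mul_pow]
    gcongr
  nlinarith

end Modes

/-! ### Parseval's identity -/

section Parseval

theorem hasSum_sq_cos_sin {g : ℝ → ℝ} (hg : Continuous g) :
    HasSum (fun n : ℤ =>
      (1 / Real.pi * ∫ θ in (0 : ℝ)..(2 * Real.pi), Real.cos ((n.natAbs : ℕ) * θ) * g θ) ^ 2 +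
      (1 / Real.pi * ∫ θ in (0 : ℝ)..(2 * Real.pi), Real.sin ((n.natAbs : ℕ) * θ) * g θ) ^ 2)
      (2 / Real.pi * ∫ θ in (0 : ℝ)..(2 * Real.pi), g θ ^ 2) := by
  have hpi := Real.pi_pos
  have hab : (0 : ℝ) < 2 * Real.pi := by positivity
  have hmem : MemLp (fun x => (g x : ℂ)) 2 (volume.restrict (Ioc 0 (2 * Real.pi))) := by
    have hc : Continuous fun x => (g x : ℂ) := by fun_prop
    obtain ⟨C, hC⟩ := (isCompact_Icc (a := 0) (b := 2 * Real.pi)).exists_bound_of_continuousOn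
      hc.continuousOn
    refine MemLp.of_bound hc.aestronglyMeasurable C ?_
    filter_upwards [ae_restrict_mem measurableSet_Ioc] with x hx
    exact hC x (Ioc_subset_Icc_self hx)
  have h := hasSum_sq_fourierCoeffOn hab hmem
  have hcoef : ∀ n : ℤ, ‖fourierCoeffOn hab (fun x => (g x : ℂ)) n‖ ^ 2 =
      1 / 4 * ((1 / Real.pi * ∫ θ in (0 : ℝ)..(2 * Real.pi),
        Real.cos ((n.natAbs : ℕ) * θ) * g θ) ^ 2 +
      (1 / Real.pi * ∫ θ in (0 : ℝ)..(2 * Real.pi), Real.sin ((n.natAbs : ℕ) * θ) * g θ) ^ 2) := by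
    intro n
    rw [fourierCoeffOn_eq_integral]
    have h1 : ∀ x : ℝ, (fourier (-n) (x : AddCircle (2 * Real.pi - 0))) • (g x : ℂ) =
        ((Real.cos (n * x) * g x : ℝ) : ℂ) - ((Real.sin (n * x) * g x : ℝ) : ℂ) * Complex.I := by
      intro x
      rw [fourier_coe_apply]
      have : 2 * (Real.pi : ℂ) * Complex.I * ((-n : ℤ) : ℂ) * (x : ℂ) /
          ((2 * Real.pi - 0 : ℝ) : ℂ) = ((-(n * x) : ℝ) : ℂ) * Complex.I := by
        have : (Real.pi : ℂ) ≠ 0 := by exact_mod_cast hpi.ne'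
        push_cast
        field_simp
        ring
      rw [this, Complex.exp_mul_I, ← Complex.ofReal_cos, ← Complex.ofReal_sin, Real.cos_neg,
        Real.sin_neg, smul_eq_mul]
      push_cast
      ring
    simp_rw [h1]
    rw [intervalIntegral.integral_sub (Continuous.intervalIntegrable (by fun_prop) _ _)
      (Continuous.intervalIntegrable (by fun_prop) _ _), intervalIntegral.integral_mul_const,
      intervalIntegral.integral_ofReal, intervalIntegral.integral_ofReal]
    set X := ∫ x in (0 : ℝ)..(2 * Real.pi), Real.cos (n * x) * g x with hX
    set Y := ∫ x in (0 : ℝ)..(2 * Real.pi), Real.sin (n * x) * g x with hY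
    have hn : ‖(1 / (2 * Real.pi - 0)) • ((X : ℂ) - (Y : ℂ) * Complex.I)‖ ^ 2 =
        1 / 4 * ((1 / Real.pi * X) ^ 2 + (1 / Real.pi * Y) ^ 2) := by
      rw [norm_smul, mul_pow, ← Complex.normSq_eq_norm_sq]
      simp [Complex.normSq_apply, abs_of_pos hpi]
      field_simp
      ring
    rw [hn]
    rcases Int.natAbs_eq n with h | h
    · have h2 : ((n.natAbs : ℕ) : ℝ) = n := by
        conv_rhs => rw [h]
        simp
      rw [h2]
    · have h2 : ((n.natAbs : ℕ) : ℝ) = -n := by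
        conv_rhs => rw [h]
        simp
      simp only [h2, neg_mul, Real.cos_neg, Real.sin_neg, intervalIntegral.integral_neg]
      rw [← hX, ← hY]
      ring
  simp_rw [hcoef] at h
  have e : 2 / Real.pi * ∫ θ in (0 : ℝ)..(2 * Real.pi), g θ ^ 2 =
      4 * ((2 * Real.pi - 0)⁻¹ • ∫ θ in (0 : ℝ)..(2 * Real.pi), ‖(g θ : ℂ)‖ ^ 2) := by
    simp only [Complex.norm_real, Real.norm_eq_abs, sq_abs, smul_eq_mul, sub_zero]
    field_simp
    ring
  rw [e]
  refine (h.mul_left 4).congr_fun ?_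
  intro n
  ring

variable {n : ℕ}

theorem fourierCos_apply {u : ℝ → ℝ → EuclideanSpace ℝ (Fin n)} {t : ℝ} (hu : Continuous (u t))
    (k : ℕ) (j : Fin n) : fourierCos k u t j =
      1 / Real.pi * ∫ θ in (0 : ℝ)..(2 * Real.pi), Real.cos (k * θ) * u t θ j := by
  have hi : IntervalIntegrable (fun θ => Real.cos (k * θ) • u t θ) volume 0 (2 * Real.pi) :=
    Continuous.intervalIntegrable (by fun_prop) _ _
  have := (EuclideanSpace.proj (𝕜 := ℝ) j).intervalIntegral_comp_comm hi
  simp only [PiLp.proj_apply, PiLp.smul_apply, smul_eq_mul] at this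
  rw [fourierCos, PiLp.smul_apply, smul_eq_mul, ← this]

theorem fourierSin_apply {u : ℝ → ℝ → EuclideanSpace ℝ (Fin n)} {t : ℝ} (hu : Continuous (u t))
    (k : ℕ) (j : Fin n) : fourierSin k u t j =
      1 / Real.pi * ∫ θ in (0 : ℝ)..(2 * Real.pi), Real.sin (k * θ) * u t θ j := by
  have hi : IntervalIntegrable (fun θ => Real.sin (k * θ) • u t θ) volume 0 (2 * Real.pi) :=
    Continuous.intervalIntegrable (by fun_prop) _ _
  have := (EuclideanSpace.proj (𝕜 := ℝ) j).intervalIntegral_comp_comm hi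
  simp only [PiLp.proj_apply, PiLp.smul_apply, smul_eq_mul] at this
  rw [fourierSin, PiLp.smul_apply, smul_eq_mul, ← this]

/-- Parseval's identity. Each frequency `k ≥ 1` appears twice, as `k` and as `-k`, so that the
frequency `0` needs no separate normalization. -/
theorem hasSum_norm_sq_fourier {u : ℝ → ℝ → EuclideanSpace ℝ (Fin n)} {t : ℝ}
    (hu : Continuous (u t)) :
    HasSum (fun k : ℤ => ‖fourierCos k.natAbs u t‖ ^ 2 + ‖fourierSin k.natAbs u t‖ ^ 2)
      (2 / Real.pi * ∫ θ in (0 : ℝ)..(2 * Real.pi), ‖u t θ‖ ^ 2) := by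
  have h := hasSum_sum (s := Finset.univ) fun (j : Fin n) _ =>
    hasSum_sq_cos_sin (g := fun θ => u t θ j) (by fun_prop)
  convert h using 1
  · ext k
    simp only [EuclideanSpace.norm_sq_eq, Real.norm_eq_abs, sq_abs, fourierCos_apply hu,
      fourierSin_apply hu, Finset.sum_add_distrib]
  · rw [← Finset.mul_sum, ← intervalIntegral.integral_finsetSum
      fun j _ => Continuous.intervalIntegrable (by fun_prop) _ _]
    simp [EuclideanSpace.norm_sq_eq]

end Parseval

/-! ### Integrals depending on a parameter -/

section Parametric

variable {E : Type*} [NormedAddCommGroup E] [NormedSpace ℝ E]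

theorem continuousOn_integral_param {S : Set ℝ} {g : ℝ → ℝ → E}
    (hg : ContinuousOn (Function.uncurry g) (S ×ˢ univ)) (c d : ℝ) :
    ContinuousOn (fun t => ∫ θ in c..d, g t θ) S := by
  rw [continuousOn_iff_continuous_domRestrict]
  refine intervalIntegral.continuous_parametric_intervalIntegral_of_continuous'
    (f := fun (t : S) θ => g t θ) ?_ c d
  exact hg.comp_continuous (f := fun p : S × ℝ => ((p.1 : ℝ), p.2)) (by fun_prop)
    fun p => ⟨p.1.2, mem_univ _⟩

theorem continuous_of_continuousOn_prod {E : Type*} [TopologicalSpace E] {S : Set ℝ} {g : ℝ → ℝ → E}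
    (hg : ContinuousOn (Function.uncurry g) (S ×ˢ univ)) {t : ℝ} (ht : t ∈ S) :
    Continuous (g t) :=
  hg.comp_continuous (f := fun θ => (t, θ)) (by fun_prop) fun _ => ⟨ht, mem_univ _⟩

theorem hasDerivAt_integral_param {a b : ℝ} {g g' : ℝ → ℝ → E}
    (hg : ContinuousOn (Function.uncurry g) (Ioo a b ×ˢ univ))
    (hg' : ContinuousOn (Function.uncurry g') (Ioo a b ×ˢ univ))
    (hd : ∀ t ∈ Ioo a b, ∀ θ, HasDerivAt (fun s => g s θ) (g' t θ) t) (c d : ℝ)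
    {t : ℝ} (ht : t ∈ Ioo a b) :
    HasDerivAt (fun t => ∫ θ in c..d, g t θ) (∫ θ in c..d, g' t θ) t := by
  obtain ⟨t1, h1⟩ := exists_between ht.1
  obtain ⟨t2, h2⟩ := exists_between ht.2
  have hsub : Icc t1 t2 ⊆ Ioo a b := fun x hx => ⟨h1.1.trans_le hx.1, hx.2.trans_lt h2.2⟩
  have hs : Icc t1 t2 ∈ nhds t := Icc_mem_nhds h1.2 h2.1
  obtain ⟨C, hC⟩ := (isCompact_Icc.prod (isCompact_uIcc (a := c) (b := d))
    : IsCompact (Icc t1 t2 ×ˢ uIcc c d)).exists_bound_of_continuousOn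
    (hg'.mono (prod_mono hsub (subset_univ _)))
  refine (intervalIntegral.hasDerivAt_integral_of_dominated_loc_of_deriv_le
    (F := g) (F' := g') (bound := fun _ => C) hs ?_ ?_ ?_ ?_ ?_ ?_).2
  · filter_upwards [hs] with x hx
    exact (continuous_of_continuousOn_prod hg (hsub hx)).aestronglyMeasurable
  · exact (continuous_of_continuousOn_prod hg ht).intervalIntegrable _ _
  · exact (continuous_of_continuousOn_prod hg' ht).aestronglyMeasurable
  · exact ae_of_all _ fun θ hθ x hx => hC (x, θ) ⟨hx, uIoc_subset_uIcc hθ⟩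
  · exact continuous_const.intervalIntegrable _ _
  · exact ae_of_all _ fun θ _ x hx => hd x (hsub hx) θ

theorem integral_deriv_periodic_eq_zero [CompleteSpace E] {h h' : ℝ → E} {T : ℝ}
    (hp : Function.Periodic h T)
    (hd : ∀ x, HasDerivAt h (h' x) x) (hc : Continuous h') : ∫ x in (0 : ℝ)..T, h' x = 0 := by
  rw [intervalIntegral.integral_eq_sub_of_hasDerivAt (fun x _ => hd x)
    (hc.intervalIntegrable _ _), sub_eq_zero]
  simpa using hp 0

end Parametric

/-! ### `C²` maps on the cylinder and their Fourier coefficients -/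

section Regularity

variable {n : ℕ} {a b : ℝ} {g : ℝ → ℝ → EuclideanSpace ℝ (Fin n)}

theorem isOpen_strip (a b : ℝ) : IsOpen (Ioo a b ×ˢ (univ : Set ℝ)) :=
  isOpen_Ioo.prod isOpen_univ

theorem differentiableAt_of_contDiffOn (hg : ContDiffOn ℝ 1 (Function.uncurry g) (Ioo a b ×ˢ univ))
    {t : ℝ} (ht : t ∈ Ioo a b) (θ : ℝ) : DifferentiableAt ℝ (Function.uncurry g) (t, θ) :=
  (hg.differentiableOn (by norm_num)).differentiableAt
    ((isOpen_strip a b).mem_nhds ⟨ht, mem_univ _⟩)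

theorem hasDerivAt_fst (hg : ContDiffOn ℝ 1 (Function.uncurry g) (Ioo a b ×ˢ univ))
    {t : ℝ} (ht : t ∈ Ioo a b) (θ : ℝ) :
    HasDerivAt (fun s => g s θ) (fderiv ℝ (Function.uncurry g) (t, θ) (1, 0)) t :=
  HasFDerivAt.comp_hasDerivAt (l := Function.uncurry g) (f := fun s => (s, θ)) t
    (differentiableAt_of_contDiffOn hg ht θ).hasFDerivAt
    ((hasDerivAt_id' t).prodMk (hasDerivAt_const t θ))

theorem hasDerivAt_snd (hg : ContDiffOn ℝ 1 (Function.uncurry g) (Ioo a b ×ˢ univ))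
    {t : ℝ} (ht : t ∈ Ioo a b) (θ : ℝ) :
    HasDerivAt (fun s => g t s) (fderiv ℝ (Function.uncurry g) (t, θ) (0, 1)) θ :=
  (differentiableAt_of_contDiffOn hg ht θ).hasFDerivAt.comp_hasDerivAt θ
    ((hasDerivAt_const θ t).prodMk (hasDerivAt_id' θ))

theorem hasDerivAt_dt (hg : ContDiffOn ℝ 1 (Function.uncurry g) (Ioo a b ×ˢ univ))
    {t : ℝ} (ht : t ∈ Ioo a b) (θ : ℝ) : HasDerivAt (fun s => g s θ) (dt g t θ) t :=
  (hasDerivAt_fst hg ht θ).differentiableAt.hasDerivAt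

theorem hasDerivAt_dθ (hg : ContDiffOn ℝ 1 (Function.uncurry g) (Ioo a b ×ˢ univ))
    {t : ℝ} (ht : t ∈ Ioo a b) (θ : ℝ) : HasDerivAt (g t) (dθ g t θ) θ :=
  (hasDerivAt_snd hg ht θ).differentiableAt.hasDerivAt

theorem contDiffOn_dt {N : ℕ}
    (hg : ContDiffOn ℝ (N + 1 : ℕ) (Function.uncurry g) (Ioo a b ×ˢ univ)) :
    ContDiffOn ℝ N (Function.uncurry (dt g)) (Ioo a b ×ˢ univ) := by
  have h : ContDiffOn ℝ N (fun p => fderiv ℝ (Function.uncurry g) p (1, 0)) (Ioo a b ×ˢ univ) :=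
    (hg.fderiv_of_isOpen (isOpen_strip a b) (by norm_cast)).clm_apply contDiffOn_const
  refine h.congr ?_
  rintro ⟨t, θ⟩ ⟨ht, -⟩
  exact (hasDerivAt_fst (hg.of_le (by norm_cast; omega)) ht θ).deriv

theorem contDiffOn_dθ {N : ℕ}
    (hg : ContDiffOn ℝ (N + 1 : ℕ) (Function.uncurry g) (Ioo a b ×ˢ univ)) :
    ContDiffOn ℝ N (Function.uncurry (dθ g)) (Ioo a b ×ˢ univ) := by
  have h : ContDiffOn ℝ N (fun p => fderiv ℝ (Function.uncurry g) p (0, 1)) (Ioo a b ×ˢ univ) :=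
    (hg.fderiv_of_isOpen (isOpen_strip a b) (by norm_cast)).clm_apply contDiffOn_const
  refine h.congr ?_
  rintro ⟨t, θ⟩ ⟨ht, -⟩
  exact (hasDerivAt_snd (hg.of_le (by norm_cast; omega)) ht θ).deriv

theorem periodic_dθ {T t : ℝ} (h : Function.Periodic (g t) T) : Function.Periodic (dθ g t) T := by
  intro θ
  have h1 : (fun s => g t (s + T)) = g t := funext h
  unfold dθ
  conv_rhs => rw [show (fun s => g t s) = fun s => g t (s + T) from h1.symm]
  rw [deriv_comp_add_const]

/-- A `C²` map on the closed cylinder `[0, T] × S¹`. -/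
structure IsC2 (T : ℝ) (u : ℝ → ℝ → EuclideanSpace ℝ (Fin n)) : Prop where
  contDiffOn : ContDiffOn ℝ 2 (Function.uncurry u) (Icc 0 T ×ˢ univ)
  periodic : ∀ t ∈ Icc 0 T, Function.Periodic (u t) (2 * Real.pi)

variable {T : ℝ} {u : ℝ → ℝ → EuclideanSpace ℝ (Fin n)}

namespace IsC2

theorem interior (hu : IsC2 T u) : ContDiffOn ℝ 2 (Function.uncurry u) (Ioo 0 T ×ˢ univ) :=
  hu.contDiffOn.mono (prod_mono Ioo_subset_Icc_self le_rfl)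

theorem interior_one (hu : IsC2 T u) : ContDiffOn ℝ 1 (Function.uncurry u) (Ioo 0 T ×ˢ univ) :=
  hu.interior.of_le (by norm_num)

theorem contDiffOn_dt (hu : IsC2 T u) :
    ContDiffOn ℝ 1 (Function.uncurry (dt u)) (Ioo 0 T ×ˢ univ) := by
  simpa using Cylinder.contDiffOn_dt (N := 1) (by exact_mod_cast hu.interior)

theorem contDiffOn_dθ (hu : IsC2 T u) :
    ContDiffOn ℝ 1 (Function.uncurry (dθ u)) (Ioo 0 T ×ˢ univ) := by
  simpa using Cylinder.contDiffOn_dθ (N := 1) (by exact_mod_cast hu.interior)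

theorem continuousOn_dt_dt (hu : IsC2 T u) :
    ContinuousOn (Function.uncurry (dt (dt u))) (Ioo 0 T ×ˢ univ) :=
  (Cylinder.contDiffOn_dt (N := 0) (by exact_mod_cast hu.contDiffOn_dt)).continuousOn

theorem continuousOn_dθ_dθ (hu : IsC2 T u) :
    ContinuousOn (Function.uncurry (dθ (dθ u))) (Ioo 0 T ×ˢ univ) :=
  (Cylinder.contDiffOn_dθ (N := 0) (by exact_mod_cast hu.contDiffOn_dθ)).continuousOn

theorem continuousOn_lap (hu : IsC2 T u) :
    ContinuousOn (Function.uncurry (lap u)) (Ioo 0 T ×ˢ univ) :=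
  hu.continuousOn_dt_dt.add hu.continuousOn_dθ_dθ

theorem continuous (hu : IsC2 T u) {t : ℝ} (ht : t ∈ Icc 0 T) : Continuous (u t) :=
  continuous_of_continuousOn_prod hu.contDiffOn.continuousOn ht

/-- The Fourier integrals of the Laplacian. The two integrations by parts in `θ` have no boundary
terms, since everything is `2π`-periodic. -/
theorem integral_smul_dt_dt (hu : IsC2 T u) {c c' : ℝ → ℝ} {κ : ℝ}
    (hc : ∀ θ, HasDerivAt c (c' θ) θ) (hc' : ∀ θ, HasDerivAt c' (-κ * c θ) θ)
    (hp : Function.Periodic c (2 * Real.pi)) (hp' : Function.Periodic c' (2 * Real.pi))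
    {t : ℝ} (ht : t ∈ Ioo 0 T) :
    ∫ θ in (0 : ℝ)..(2 * Real.pi), c θ • dt (dt u) t θ =
      κ • (∫ θ in (0 : ℝ)..(2 * Real.pi), c θ • u t θ) +
        ∫ θ in (0 : ℝ)..(2 * Real.pi), c θ • lap u t θ := by
  have hcc : Continuous c := continuous_iff_continuousAt.2 fun x => (hc x).continuousAt
  have hcu : Continuous (u t) := hu.continuous (Ioo_subset_Icc_self ht)
  have h1 : Continuous (dt (dt u) t) := continuous_of_continuousOn_prod hu.continuousOn_dt_dt ht
  have h2 : Continuous (dθ (dθ u) t) := continuous_of_continuousOn_prod hu.continuousOn_dθ_dθ ht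
  have hpu := hu.periodic t (Ioo_subset_Icc_self ht)
  have hd : ∀ θ, HasDerivAt (fun θ => c θ • dθ u t θ - c' θ • u t θ)
      (c θ • dθ (dθ u) t θ + κ • (c θ • u t θ)) θ := fun θ => by
    refine (((hc θ).smul (hasDerivAt_dθ hu.contDiffOn_dθ ht θ)).sub
      ((hc' θ).smul (hasDerivAt_dθ hu.interior_one ht θ))).congr_deriv ?_
    module
  have hz := integral_deriv_periodic_eq_zero (T := 2 * Real.pi) (fun θ => by
    simp only [hp θ, hp' θ, hpu θ, periodic_dθ hpu θ]) hd (by fun_prop)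
  have h3 : Continuous (lap u t) := h1.add h2
  rw [← intervalIntegral.integral_smul, ← intervalIntegral.integral_add
    (Continuous.intervalIntegrable (by fun_prop) _ _)
    (Continuous.intervalIntegrable (by fun_prop) _ _), ← sub_eq_zero,
    ← intervalIntegral.integral_sub (Continuous.intervalIntegrable (by fun_prop) _ _)
    (Continuous.intervalIntegrable (by fun_prop) _ _), ← neg_eq_zero,
    ← intervalIntegral.integral_neg, ← hz]
  refine intervalIntegral.integral_congr fun θ _ => ?_
  simp only [lap]
  module

theorem hasDerivAt_integral_smul {g : ℝ → ℝ → EuclideanSpace ℝ (Fin n)}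
    (hg : ContDiffOn ℝ 1 (Function.uncurry g) (Ioo 0 T ×ˢ univ)) {c : ℝ → ℝ} (hc : Continuous c)
    {t : ℝ} (ht : t ∈ Ioo 0 T) :
    HasDerivAt (fun t => ∫ θ in (0 : ℝ)..(2 * Real.pi), c θ • g t θ)
      (∫ θ in (0 : ℝ)..(2 * Real.pi), c θ • dt g t θ) t := by
  have h0 : ContinuousOn (Function.uncurry (dt g)) (Ioo 0 T ×ˢ univ) :=
    (Cylinder.contDiffOn_dt (N := 0) (by exact_mod_cast hg)).continuousOn
  refine hasDerivAt_integral_param (g := fun t θ => c θ • g t θ) (g' := fun t θ => c θ • dt g t θ)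
    ?_ ?_ (fun t ht θ => (hasDerivAt_dt hg ht θ).const_smul (c θ)) _ _ ht
  · exact (hc.comp continuous_snd).continuousOn.smul hg.continuousOn
  · exact (hc.comp continuous_snd).continuousOn.smul h0

end IsC2

theorem periodic_cos_nat_mul (k : ℕ) :
    Function.Periodic (fun θ => Real.cos (k * θ)) (2 * Real.pi) := fun θ => by
  simp only [mul_add]
  exact Real.cos_add_nat_mul_two_pi _ k

theorem periodic_sin_nat_mul (k : ℕ) :
    Function.Periodic (fun θ => Real.sin (k * θ)) (2 * Real.pi) := fun θ => by
  simp only [mul_add]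
  exact Real.sin_add_nat_mul_two_pi _ k

theorem hasDerivAt_cos_nat_mul (k : ℕ) (θ : ℝ) :
    HasDerivAt (fun θ => Real.cos (k * θ)) (-(k : ℝ) * Real.sin (k * θ)) θ := by
  refine (((hasDerivAt_id θ).const_mul (k : ℝ)).cos).congr_deriv ?_
  simp
  ring

theorem hasDerivAt_sin_nat_mul (k : ℕ) (θ : ℝ) :
    HasDerivAt (fun θ => Real.sin (k * θ)) ((k : ℝ) * Real.cos (k * θ)) θ := by
  refine (((hasDerivAt_id θ).const_mul (k : ℝ)).sin).congr_deriv ?_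
  simp
  ring

namespace IsC2

theorem hasDerivAt_fourierCos {g : ℝ → ℝ → EuclideanSpace ℝ (Fin n)}
    (hg : ContDiffOn ℝ 1 (Function.uncurry g) (Ioo 0 T ×ˢ univ)) (k : ℕ)
    {t : ℝ} (ht : t ∈ Ioo 0 T) : HasDerivAt (fourierCos k g) (fourierCos k (dt g) t) t :=
  (hasDerivAt_integral_smul hg (c := fun θ => Real.cos (k * θ)) (by fun_prop) ht).const_smul
    (1 / Real.pi)

theorem hasDerivAt_fourierSin {g : ℝ → ℝ → EuclideanSpace ℝ (Fin n)}
    (hg : ContDiffOn ℝ 1 (Function.uncurry g) (Ioo 0 T ×ˢ univ)) (k : ℕ)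
    {t : ℝ} (ht : t ∈ Ioo 0 T) : HasDerivAt (fourierSin k g) (fourierSin k (dt g) t) t :=
  (hasDerivAt_integral_smul hg (c := fun θ => Real.sin (k * θ)) (by fun_prop) ht).const_smul
    (1 / Real.pi)

theorem hasDerivAt_fourierCos_dt (hu : IsC2 T u) (k : ℕ) {t : ℝ} (ht : t ∈ Ioo 0 T) :
    HasDerivAt (fourierCos k (dt u))
      ((k : ℝ) ^ 2 • fourierCos k u t + fourierCos k (lap u) t) t := by
  refine (hasDerivAt_fourierCos hu.contDiffOn_dt k ht).congr_deriv ?_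
  rw [fourierCos, hu.integral_smul_dt_dt (c' := fun θ => -(k : ℝ) * Real.sin (k * θ))
    (κ := (k : ℝ) ^ 2) (hasDerivAt_cos_nat_mul k)
    (fun θ => ((hasDerivAt_sin_nat_mul k θ).const_mul (-(k : ℝ))).congr_deriv (by ring))
    (periodic_cos_nat_mul k) (fun θ => by simp only [periodic_sin_nat_mul k θ]) ht]
  simp only [fourierCos]
  module

theorem hasDerivAt_fourierSin_dt (hu : IsC2 T u) (k : ℕ) {t : ℝ} (ht : t ∈ Ioo 0 T) :
    HasDerivAt (fourierSin k (dt u))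
      ((k : ℝ) ^ 2 • fourierSin k u t + fourierSin k (lap u) t) t := by
  refine (hasDerivAt_fourierSin hu.contDiffOn_dt k ht).congr_deriv ?_
  rw [fourierSin, hu.integral_smul_dt_dt (c' := fun θ => (k : ℝ) * Real.cos (k * θ))
    (κ := (k : ℝ) ^ 2) (hasDerivAt_sin_nat_mul k)
    (fun θ => ((hasDerivAt_cos_nat_mul k θ).const_mul (k : ℝ)).congr_deriv (by ring))
    (periodic_sin_nat_mul k) (fun θ => by simp only [periodic_cos_nat_mul k θ]) ht]
  simp only [fourierSin]
  module

theorem gCos_eq (hu : IsC2 T u) (m : ℕ) {t : ℝ} (ht : t ∈ Ioo 0 T) :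
    gCos m u t = fourierCos m (dt u) t + (m : ℝ) • fourierCos m u t := by
  rw [gCos, (hasDerivAt_fourierCos hu.interior_one m ht).deriv]

theorem gSin_eq (hu : IsC2 T u) (m : ℕ) {t : ℝ} (ht : t ∈ Ioo 0 T) :
    gSin m u t = fourierSin m (dt u) t + (m : ℝ) • fourierSin m u t := by
  rw [gSin, (hasDerivAt_fourierSin hu.interior_one m ht).deriv]

theorem continuousOn_fourierCos_lap (hu : IsC2 T u) (k : ℕ) :
    ContinuousOn (fourierCos k (lap u)) (Ioo 0 T) := by
  have hc : Continuous fun p : ℝ × ℝ => Real.cos (k * p.2) := by fun_prop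
  exact (continuousOn_integral_param (g := fun t θ => Real.cos (k * θ) • lap u t θ)
    (hc.continuousOn.smul hu.continuousOn_lap) _ _).const_smul (1 / Real.pi)

theorem continuousOn_fourierSin_lap (hu : IsC2 T u) (k : ℕ) :
    ContinuousOn (fourierSin k (lap u)) (Ioo 0 T) := by
  have hc : Continuous fun p : ℝ × ℝ => Real.sin (k * p.2) := by fun_prop
  exact (continuousOn_integral_param (g := fun t θ => Real.sin (k * θ) • lap u t θ)
    (hc.continuousOn.smul hu.continuousOn_lap) _ _).const_smul (1 / Real.pi)

end IsC2

end Regularity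

/-! ### The weighted density and Caccioppoli's inequality -/

section Slices

variable {n : ℕ}

/-- `∫_{S¹} |u(t, θ)|² dθ`. -/
noncomputable def slice (u : ℝ → ℝ → EuclideanSpace ℝ (Fin n)) (t : ℝ) : ℝ :=
  ∫ θ in (0 : ℝ)..(2 * Real.pi), ‖u t θ‖ ^ 2

/-- The density `e^{-2mt} ∫_{S¹} |u(t, θ)|² dθ`, whose integral over a segment is `energy`. -/
noncomputable def dens (m : ℕ) (u : ℝ → ℝ → EuclideanSpace ℝ (Fin n)) (t : ℝ) : ℝ :=
  slice u t * Real.exp (-(2 * m * t))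

variable {T : ℝ} {u : ℝ → ℝ → EuclideanSpace ℝ (Fin n)}

theorem energy_eq_integral_dens (m : ℕ) (L : ℝ) (i : ℕ) (u : ℝ → ℝ → EuclideanSpace ℝ (Fin n)) :
    energy m L i u = ∫ t in (((i : ℝ) - 1) * L)..((i : ℝ) * L), dens m u t := by
  simp only [energy, dens, slice, intervalIntegral.integral_mul_const]

theorem slice_nonneg (u : ℝ → ℝ → EuclideanSpace ℝ (Fin n)) (t : ℝ) : 0 ≤ slice u t :=
  intervalIntegral.integral_nonneg (by positivity) fun _ _ => by positivity

theorem dens_nonneg (m : ℕ) (u : ℝ → ℝ → EuclideanSpace ℝ (Fin n)) (t : ℝ) : 0 ≤ dens m u t :=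
  mul_nonneg (slice_nonneg u t) (Real.exp_pos _).le

theorem continuousOn_slice {S : Set ℝ} (hu : ContinuousOn (Function.uncurry u) (S ×ˢ univ)) :
    ContinuousOn (slice u) S := by
  have h : ContinuousOn (Function.uncurry fun t θ => ‖u t θ‖ ^ 2) (S ×ˢ univ) := hu.norm.pow 2
  exact continuousOn_integral_param h _ _

theorem continuousOn_dens {S : Set ℝ} (m : ℕ)
    (hu : ContinuousOn (Function.uncurry u) (S ×ˢ univ)) : ContinuousOn (dens m u) S :=
  (continuousOn_slice hu).mul (by fun_prop)

theorem slice_congr {u v : ℝ → ℝ → EuclideanSpace ℝ (Fin n)} {t : ℝ} (h : u t = v t) :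
    slice u t = slice v t := by
  simp only [slice, h]

/-- `Δu` is pointwise at most `δ (|u| + |∇u|)` on the interior of the fundamental domain; the rest of
the cylinder is negligible for all integrals. -/
def NearHarmonic (δ T : ℝ) (u : ℝ → ℝ → EuclideanSpace ℝ (Fin n)) : Prop :=
  ∀ t ∈ Ioo 0 T, ∀ θ ∈ Ioo 0 (2 * Real.pi), ‖lap u t θ‖ ≤ δ * (‖u t θ‖ + gradNorm u t θ)

theorem gradNorm_sq (u : ℝ → ℝ → EuclideanSpace ℝ (Fin n)) (t θ : ℝ) :
    gradNorm u t θ ^ 2 = ‖dt u t θ‖ ^ 2 + ‖dθ u t θ‖ ^ 2 := Real.sq_sqrt (by positivity)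

namespace IsC2

theorem hasDerivAt_slice (hu : IsC2 T u) {t : ℝ} (ht : t ∈ Ioo 0 T) :
    HasDerivAt (slice u) (∫ θ in (0 : ℝ)..(2 * Real.pi), 2 * inner ℝ (u t θ) (dt u t θ)) t := by
  have hc : ContinuousOn (Function.uncurry u) (Ioo 0 T ×ˢ univ) := hu.interior.continuousOn
  refine hasDerivAt_integral_param (g := fun t θ => ‖u t θ‖ ^ 2)
    (g' := fun t θ => 2 * inner ℝ (u t θ) (dt u t θ)) ?_ ?_ ?_ _ _ ht
  · exact hc.norm.pow 2
  · exact (hc.inner hu.contDiffOn_dt.continuousOn).const_mul 2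
  · exact fun t ht θ => (hasDerivAt_dt hu.interior_one ht θ).norm_sq

/-- The second derivative of `∫ |u|² dθ`, after one integration by parts in `θ`. -/
theorem hasDerivAt_integral_inner (hu : IsC2 T u) {t : ℝ} (ht : t ∈ Ioo 0 T) :
    HasDerivAt (fun t => ∫ θ in (0 : ℝ)..(2 * Real.pi), 2 * inner ℝ (u t θ) (dt u t θ))
      (∫ θ in (0 : ℝ)..(2 * Real.pi),
        2 * (gradNorm u t θ ^ 2 + inner ℝ (u t θ) (lap u t θ))) t := by
  have hc : ContinuousOn (Function.uncurry u) (Ioo 0 T ×ˢ univ) := hu.interior.continuousOn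
  have h1 := hu.contDiffOn_dt.continuousOn
  have h2 := hu.continuousOn_dt_dt
  have h3 := hasDerivAt_integral_param (g := fun t θ => 2 * inner ℝ (u t θ) (dt u t θ))
    (g' := fun t θ => 2 * (inner ℝ (u t θ) (dt (dt u) t θ) + inner ℝ (dt u t θ) (dt u t θ)))
    (a := 0) (b := T) ((hc.inner h1).const_mul 2)
    (((hc.inner h2).add (h1.inner h1)).const_mul 2)
    (fun t ht θ => ((hasDerivAt_dt hu.interior_one ht θ).inner ℝ
      (hasDerivAt_dt hu.contDiffOn_dt ht θ)).const_mul 2) 0 (2 * Real.pi) ht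
  refine h3.congr_deriv ?_
  have hpu := hu.periodic t (Ioo_subset_Icc_self ht)
  have c0 : Continuous (u t) := hu.continuous (Ioo_subset_Icc_self ht)
  have c1 : Continuous (dt u t) := continuous_of_continuousOn_prod h1 ht
  have c2 : Continuous (dt (dt u) t) := continuous_of_continuousOn_prod h2 ht
  have c3 : Continuous (dθ u t) := continuous_of_continuousOn_prod hu.contDiffOn_dθ.continuousOn ht
  have c4 : Continuous (dθ (dθ u) t) := continuous_of_continuousOn_prod hu.continuousOn_dθ_dθ ht
  have c5 : Continuous (lap u t) := c2.add c4
  have hz := integral_deriv_periodic_eq_zero (T := 2 * Real.pi)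
    (h := fun θ => 2 * inner ℝ (u t θ) (dθ u t θ)) (fun θ => by
      simp only [hpu θ, periodic_dθ hpu θ])
    (fun θ => ((hasDerivAt_dθ hu.interior_one ht θ).inner ℝ
      (hasDerivAt_dθ hu.contDiffOn_dθ ht θ)).const_mul 2) (by fun_prop)
  have c6 : Continuous fun θ => gradNorm u t θ ^ 2 := by
    simp only [gradNorm_sq]; fun_prop
  rw [← sub_eq_zero, ← intervalIntegral.integral_sub
    (Continuous.intervalIntegrable (by fun_prop) _ _)
    (Continuous.intervalIntegrable (by fun_prop) _ _), ← neg_eq_zero,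
    ← intervalIntegral.integral_neg]
  refine Eq.trans ?_ hz
  refine intervalIntegral.integral_congr fun θ _ => ?_
  simp only [lap, gradNorm_sq, inner_add_right, real_inner_self_eq_norm_sq]
  ring

theorem continuousOn_integral_grad (hu : IsC2 T u) :
    ContinuousOn (fun t => ∫ θ in (0 : ℝ)..(2 * Real.pi),
        2 * (gradNorm u t θ ^ 2 + inner ℝ (u t θ) (lap u t θ))) (Ioo 0 T) := by
  refine continuousOn_integral_param
    (g := fun t θ => 2 * (gradNorm u t θ ^ 2 + inner ℝ (u t θ) (lap u t θ))) ?_ _ _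
  have h1 : ContinuousOn (fun p : ℝ × ℝ => gradNorm u p.1 p.2 ^ 2) (Ioo 0 T ×ˢ univ) := by
    simp only [gradNorm_sq]
    have h2 := hu.contDiffOn_dt.continuousOn.norm.pow 2
    have h3 := hu.contDiffOn_dθ.continuousOn.norm.pow 2
    exact h2.add h3
  have h4 : ContinuousOn (fun p : ℝ × ℝ => inner ℝ (u p.1 p.2) (lap u p.1 p.2))
      (Ioo 0 T ×ˢ univ) :=
    ContinuousOn.inner hu.interior.continuousOn hu.continuousOn_lap
  exact (h1.add h4).const_mul 2

/-- As `∫ |u|² dθ` has the second derivative `2 ∫ (|∇u|² + ⟨u, Δu⟩) dθ`, it controls the gradient in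
the bound for `Δu`. -/
theorem slice_lap_le (hu : IsC2 T u) {δ : ℝ} (hδ1 : δ ≤ 1) (h : NearHarmonic δ T u)
    {t : ℝ} (ht : t ∈ Ioo 0 T) :
    slice (lap u) t ≤ 2 * δ ^ 2 * ((∫ θ in (0 : ℝ)..(2 * Real.pi),
        2 * (gradNorm u t θ ^ 2 + inner ℝ (u t θ) (lap u t θ))) + 4 * slice u t) := by
  have c0 : Continuous (u t) := hu.continuous (Ioo_subset_Icc_self ht)
  have c1 : Continuous (dt u t) :=
    continuous_of_continuousOn_prod hu.contDiffOn_dt.continuousOn ht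
  have c3 : Continuous (dθ u t) := continuous_of_continuousOn_prod hu.contDiffOn_dθ.continuousOn ht
  have c5 : Continuous (lap u t) := continuous_of_continuousOn_prod hu.continuousOn_lap ht
  have c6 : Continuous fun θ => gradNorm u t θ ^ 2 := by
    simp only [gradNorm_sq]; fun_prop
  rw [slice, slice, ← intervalIntegral.integral_const_mul, ← intervalIntegral.integral_add
    (Continuous.intervalIntegrable (by fun_prop) _ _)
    (Continuous.intervalIntegrable (by fun_prop) _ _), ← intervalIntegral.integral_const_mul]
  refine intervalIntegral.integral_mono_on_of_le_Ioo (by positivity)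
    (Continuous.intervalIntegrable (by fun_prop) _ _)
    (Continuous.intervalIntegrable (by fun_prop) _ _) fun θ hθ => ?_
  have h1 := h t ht θ hθ
  have hG : 0 ≤ gradNorm u t θ := Real.sqrt_nonneg _
  have hi := (abs_le.1 (abs_real_inner_le_norm (u t θ) (lap u t θ))).1
  set G := gradNorm u t θ
  have hX : 0 ≤ ‖u t θ‖ := norm_nonneg _
  have hlap0 : 0 ≤ ‖lap u t θ‖ := norm_nonneg _
  set X := ‖u t θ‖
  set Y := ‖lap u t θ‖
  have h2 : Y ^ 2 ≤ δ ^ 2 * (X + G) ^ 2 := by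
    rw [← mul_pow]; gcongr
  have h3 : Y ≤ X + G := h1.trans (mul_le_of_le_one_left (by positivity) hδ1)
  have h4 : X * Y ≤ X * (X + G) := by gcongr
  have h5 : (X + G) ^ 2 ≤ 2 * (2 * (G ^ 2 + inner ℝ (u t θ) (lap u t θ)) + 4 * X ^ 2) := by
    nlinarith [sq_nonneg (X - G)]
  calc Y ^ 2 ≤ δ ^ 2 * (X + G) ^ 2 := h2
    _ ≤ δ ^ 2 * (2 * (2 * (G ^ 2 + inner ℝ (u t θ) (lap u t θ)) + 4 * X ^ 2)) := by gcongr
    _ = _ := by ring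

/-- Caccioppoli's inequality, in the form of a bound for `Δu`: with `e = ∫ |u|² dθ` and a cutoff `ψ`
vanishing to second order at both ends, `∫ ψ e'' = ∫ ψ'' e`, and `e''` controls `∫ |∇u|² dθ`. -/
theorem integral_slice_lap_le (hu : IsC2 T u) {δ : ℝ} (hδ1 : δ ≤ 1)
    (h : NearHarmonic δ T u) {c ℓ : ℝ} (hc : 0 ≤ c) (hℓ : 2 ≤ ℓ) (hcℓ : c + ℓ ≤ T) :
    ∫ t in (c + 1)..(c + ℓ - 1), slice (lap u) t ≤
      128 * (ℓ ^ 2 + ℓ ^ 4) * δ ^ 2 * ∫ t in c..(c + ℓ), slice u t := by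
  set α := c + 1 / 2 with hα
  set β := c + ℓ - 1 / 2 with hβ
  have hαβ : α ≤ β := by linarith
  have hsub : Icc α β ⊆ Ioo 0 T := fun x hx => ⟨by linarith [hx.1], by linarith [hx.2]⟩
  set e1 : ℝ → ℝ := fun t => ∫ θ in (0 : ℝ)..(2 * Real.pi), 2 * inner ℝ (u t θ) (dt u t θ) with he1
  set e2 : ℝ → ℝ := fun t => ∫ θ in (0 : ℝ)..(2 * Real.pi),
        2 * (gradNorm u t θ ^ 2 + inner ℝ (u t θ) (lap u t θ)) with he2
  set ψ : ℝ → ℝ := fun t => ((t - α) * (β - t)) ^ 2 with hψ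
  set ψ1 : ℝ → ℝ := fun t => 2 * ((t - α) * (β - t)) * (α + β - 2 * t) with hψ1
  set ψ2 : ℝ → ℝ := fun t => 2 * (α + β - 2 * t) ^ 2 - 4 * ((t - α) * (β - t)) with hψ2
  have hq : ∀ t, HasDerivAt (fun t => (t - α) * (β - t)) (α + β - 2 * t) t := fun t => by
    refine (((hasDerivAt_id t).sub_const α).mul ((hasDerivAt_id t).const_sub β)).congr_deriv ?_
    simp
    ring
  have hdψ : ∀ t, HasDerivAt ψ (ψ1 t) t := fun t => by
    refine ((hq t).pow 2).congr_deriv ?_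
    simp only [hψ1]
    ring
  have hdψ1 : ∀ t, HasDerivAt ψ1 (ψ2 t) t := fun t => by
    refine (((hq t).const_mul 2).mul (((hasDerivAt_id t).const_mul 2).const_sub (α + β))).congr_deriv
      ?_
    simp only [hψ2, id]
    ring
  have ce0 : ContinuousOn (slice u) (Icc 0 T) := continuousOn_slice hu.contDiffOn.continuousOn
  have ce2 : ContinuousOn e2 (Ioo 0 T) := hu.continuousOn_integral_grad
  have clap : ContinuousOn (slice (lap u)) (Ioo 0 T) := continuousOn_slice hu.continuousOn_lap
  have cψ : Continuous ψ := by simp only [hψ]; fun_prop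
  have cψ2 : Continuous ψ2 := by simp only [hψ2]; fun_prop
  have hI : ∀ {f : ℝ → ℝ}, ContinuousOn f (Ioo 0 T) → IntervalIntegrable f volume α β := by
    intro f hf
    refine ContinuousOn.intervalIntegrable ?_
    rw [uIcc_of_le hαβ]
    exact hf.mono hsub
  have ce0' := ce0.mono Ioo_subset_Icc_self
  have hbp : ∫ t in α..β, (ψ t * e2 t - ψ2 t * slice u t) = 0 := by
    have hd : ∀ t ∈ uIcc α β, HasDerivAt (fun t => ψ t * e1 t - ψ1 t * slice u t)
        (ψ t * e2 t - ψ2 t * slice u t) t := by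
      intro t ht
      rw [uIcc_of_le hαβ] at ht
      refine (((hdψ t).mul (hu.hasDerivAt_integral_inner (hsub ht))).sub
        ((hdψ1 t).mul (hu.hasDerivAt_slice (hsub ht)))).congr_deriv ?_
      simp only [he2]
      ring
    rw [intervalIntegral.integral_eq_sub_of_hasDerivAt hd
      (hI ((cψ.continuousOn.mul ce2).sub (cψ2.continuousOn.mul ce0')))]
    simp [hψ, hψ1]
  have hmain : ∫ t in α..β, ψ t * slice (lap u) t ≤
      2 * δ ^ 2 * (4 * ℓ ^ 2 + 4 * ℓ ^ 4) * ∫ t in α..β, slice u t := by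
    have i1 : IntervalIntegrable (fun t => 2 * δ ^ 2 * (ψ t * e2 t - ψ2 t * slice u t))
        volume α β :=
      hI (((cψ.continuousOn.mul ce2).sub (cψ2.continuousOn.mul ce0')).const_mul _)
    have i2 : IntervalIntegrable (fun t => 2 * δ ^ 2 * (4 * ℓ ^ 2 + 4 * ℓ ^ 4) * slice u t)
        volume α β := hI (ce0'.const_mul _)
    have h1 : ∫ t in α..β, ψ t * slice (lap u) t ≤
        ∫ t in α..β, (2 * δ ^ 2 * (ψ t * e2 t - ψ2 t * slice u t) +
          2 * δ ^ 2 * (4 * ℓ ^ 2 + 4 * ℓ ^ 4) * slice u t) := by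
      refine intervalIntegral.integral_mono_on hαβ (hI (cψ.continuousOn.mul clap))
        (i1.add i2) fun t ht => ?_
      have h2 := hu.slice_lap_le hδ1 h (hsub ht)
      have hψ0 : 0 ≤ ψ t := sq_nonneg _
      have h3 := mul_le_mul_of_nonneg_left h2 hψ0
      have ha : 0 ≤ t - α := by linarith [ht.1]
      have hb : 0 ≤ β - t := by linarith [ht.2]
      have hal : t - α ≤ ℓ := by linarith [ht.2]
      have hbl : β - t ≤ ℓ := by linarith [ht.1]
      have hab : (t - α) * (β - t) ≤ ℓ * ℓ := by gcongr
      have hab0 : 0 ≤ (t - α) * (β - t) := mul_nonneg ha hb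
      have h4 : ψ t ≤ ℓ ^ 4 := by
        have : ψ t ≤ (ℓ * ℓ) ^ 2 := by simp only [hψ]; gcongr
        linarith [show (ℓ * ℓ) ^ 2 = ℓ ^ 4 by ring]
      have h5 : ψ2 t ≤ 4 * ℓ ^ 2 := by
        have h6 : (α + β - 2 * t) ^ 2 ≤ ℓ ^ 2 := by
          apply sq_le_sq'
          · linarith
          · linarith
        simp only [hψ2]
        nlinarith
      have h7 : (ψ2 t + 4 * ψ t) * slice u t ≤ (4 * ℓ ^ 2 + 4 * ℓ ^ 4) * slice u t := by
        have := slice_nonneg u t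
        gcongr
      have h8 : 0 ≤ 2 * δ ^ 2 := by positivity
      have h9 := mul_le_mul_of_nonneg_left h7 h8
      simp only [he2]
      linarith
    rw [intervalIntegral.integral_add i1 i2, intervalIntegral.integral_const_mul,
      intervalIntegral.integral_const_mul, hbp, mul_zero, zero_add] at h1
    exact h1
  have hin : ∫ t in (c + 1)..(c + ℓ - 1), slice (lap u) t ≤
      16 * ∫ t in α..β, ψ t * slice (lap u) t := by
    have hle : c + 1 ≤ c + ℓ - 1 := by linarith
    have hsub' : uIcc (c + 1) (c + ℓ - 1) ⊆ Ioo 0 T := by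
      rw [uIcc_of_le hle]
      exact (Icc_subset_Icc (by linarith) (by linarith)).trans hsub
    rw [← intervalIntegral.integral_const_mul]
    refine le_trans (intervalIntegral.integral_mono_on hle
      (clap.mono hsub').intervalIntegrable
      (((cψ.continuousOn.mul clap).const_mul 16).mono hsub').intervalIntegrable
      (g := fun t => 16 * (ψ t * slice (lap u) t)) fun t ht => ?_) ?_
    · have ha : 1 / 2 ≤ t - α := by linarith [ht.1]
      have hb : 1 / 2 ≤ β - t := by linarith [ht.2]
      have h1 : 1 / 4 ≤ (t - α) * (β - t) := by nlinarith
      have h2 : 1 ≤ 16 * ψ t := by simp only [hψ]; nlinarith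
      rw [← mul_assoc]
      exact le_mul_of_one_le_left (slice_nonneg _ _) h2
    · refine intervalIntegral.integral_mono_interval (by linarith) hle (by linarith)
        (ae_of_all _ fun t => ?_) (hI ((cψ.continuousOn.mul clap).const_mul 16))
      exact mul_nonneg (by norm_num) (mul_nonneg (sq_nonneg _) (slice_nonneg _ _))
  have hout : ∫ t in α..β, slice u t ≤ ∫ t in c..(c + ℓ), slice u t := by
    refine intervalIntegral.integral_mono_interval (by linarith) hαβ (by linarith)
      (ae_of_all _ fun t => slice_nonneg u t) ?_
    refine (ce0.mono ?_).intervalIntegrable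
    rw [uIcc_of_le (by linarith)]
    exact Icc_subset_Icc hc hcℓ
  calc _ ≤ 16 * (2 * δ ^ 2 * (4 * ℓ ^ 2 + 4 * ℓ ^ 4) * ∫ t in c..(c + ℓ), slice u t) := by
        refine hin.trans ?_
        gcongr
        exact hmain.trans (by gcongr)
    _ = _ := by ring

theorem integral_dens_lap_le (hu : IsC2 T u) (m : ℕ) {δ : ℝ} (hδ1 : δ ≤ 1)
    (h : NearHarmonic δ T u) {c ℓ : ℝ} (hc : 0 ≤ c) (hℓ : 2 ≤ ℓ) (hcℓ : c + ℓ ≤ T) :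
    ∫ t in (c + 1)..(c + ℓ - 1), dens m (lap u) t ≤
      Real.exp (2 * m * ℓ) * (128 * (ℓ ^ 2 + ℓ ^ 4)) * δ ^ 2 * ∫ t in c..(c + ℓ), dens m u t := by
  have h0 := hu.integral_slice_lap_le hδ1 h hc hℓ hcℓ
  have hle : c + 1 ≤ c + ℓ - 1 := by linarith
  have hsub : uIcc (c + 1) (c + ℓ - 1) ⊆ Ioo 0 T := by
    rw [uIcc_of_le hle]
    exact fun x hx => ⟨by linarith [hx.1], by linarith [hx.2]⟩
  have hsub2 : uIcc c (c + ℓ) ⊆ Icc 0 T := by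
    rw [uIcc_of_le (by linarith)]
    exact Icc_subset_Icc hc hcℓ
  have cu : ContinuousOn (slice u) (uIcc c (c + ℓ)) :=
    (continuousOn_slice hu.contDiffOn.continuousOn).mono hsub2
  have cd : ContinuousOn (dens m u) (uIcc c (c + ℓ)) :=
    (continuousOn_dens m hu.contDiffOn.continuousOn).mono hsub2
  have h1 : ∫ t in (c + 1)..(c + ℓ - 1), dens m (lap u) t ≤
      ∫ t in (c + 1)..(c + ℓ - 1), Real.exp (-(2 * m * c)) * slice (lap u) t := by
    refine intervalIntegral.integral_mono_on hle
      ((continuousOn_dens m hu.continuousOn_lap).mono hsub).intervalIntegrable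
      (((continuousOn_slice hu.continuousOn_lap).mono hsub).const_mul _).intervalIntegrable
      fun t ht => ?_
    rw [dens, mul_comm]
    have := slice_nonneg (lap u) t
    gcongr
    linarith [ht.1]
  have h2 : ∫ t in c..(c + ℓ), slice u t ≤
      ∫ t in c..(c + ℓ), Real.exp (2 * m * (c + ℓ)) * dens m u t := by
    refine intervalIntegral.integral_mono_on (by linarith) cu.intervalIntegrable
      (cd.const_mul _).intervalIntegrable fun t ht => ?_
    have h3 : Real.exp (2 * m * (c + ℓ)) * dens m u t =
        Real.exp (2 * m * (c + ℓ) + -(2 * m * t)) * slice u t := by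
      rw [dens, Real.exp_add]; ring
    rw [h3]
    refine le_mul_of_one_le_left (slice_nonneg u t) (Real.one_le_exp ?_)
    have : 0 ≤ 2 * (m : ℝ) * (c + ℓ - t) := mul_nonneg (by positivity) (by linarith [ht.2])
    linarith
  rw [intervalIntegral.integral_const_mul] at h1 h2
  have h4 : Real.exp (2 * m * ℓ) = Real.exp (-(2 * m * c)) * Real.exp (2 * m * (c + ℓ)) := by
    rw [← Real.exp_add]; ring_nf
  calc _ ≤ Real.exp (-(2 * m * c)) * (128 * (ℓ ^ 2 + ℓ ^ 4) * δ ^ 2 *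
        (Real.exp (2 * m * (c + ℓ)) * ∫ t in c..(c + ℓ), dens m u t)) := by
        refine h1.trans ?_
        gcongr
        exact h0.trans (by gcongr)
    _ = _ := by rw [h4]; ring

end IsC2

end Slices

/-! ### The three-circle inequality with error terms -/

section ThreeCircles

variable {n : ℕ} {T : ℝ} {u : ℝ → ℝ → EuclideanSpace ℝ (Fin n)}

/-- The weighted square of the pair of Fourier coefficients of frequency `k`. -/
noncomputable def modeSq (m : ℕ) (u : ℝ → ℝ → EuclideanSpace ℝ (Fin n)) (k : ℕ) (t : ℝ) : ℝ :=
  ‖Real.exp (-(m * t)) • fourierCos k u t‖ ^ 2 + ‖Real.exp (-(m * t)) • fourierSin k u t‖ ^ 2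

/-- The pair `e^{-mt} g⁺(t)` of the cosine and sine components, in the Euclidean product. It is
constant along solutions of `Δu = 0`, and its norm at the midpoints of the segments is `γᵢ`. -/
noncomputable def phase (m : ℕ) (u : ℝ → ℝ → EuclideanSpace ℝ (Fin n)) (t : ℝ) :
    WithLp 2 (EuclideanSpace ℝ (Fin n) × EuclideanSpace ℝ (Fin n)) :=
  WithLp.toLp 2 (Real.exp (-(m * t)) • gCos m u t, Real.exp (-(m * t)) • gSin m u t)

theorem norm_toLp_pair_sq (x y : EuclideanSpace ℝ (Fin n)) :
    ‖(WithLp.toLp 2 (x, y) : WithLp 2 (EuclideanSpace ℝ (Fin n) × EuclideanSpace ℝ (Fin n)))‖ ^ 2 =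
      ‖x‖ ^ 2 + ‖y‖ ^ 2 := by
  rw [WithLp.prod_norm_sq_eq_of_L2]
  simp only [WithLp.toLp_fst, WithLp.toLp_snd]

theorem gam_eq_norm_phase (m : ℕ) (L : ℝ) (i : ℕ) (u : ℝ → ℝ → EuclideanSpace ℝ (Fin n)) :
    gam m L i u = ‖phase m u (mid L i)‖ := by
  have h : 0 ≤ gam m L i u := mul_nonneg (Real.sqrt_nonneg _) (Real.exp_pos _).le
  rw [← sq_eq_sq₀ h (norm_nonneg _), phase, norm_toLp_pair_sq, gam, mul_pow,
    Real.sq_sqrt (by positivity)]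
  simp only [norm_smul, Real.norm_eq_abs, Real.abs_exp]
  ring

theorem hasSum_modeSq (m : ℕ) {t : ℝ} (hu : Continuous (u t)) :
    HasSum (fun k : ℤ => modeSq m u k.natAbs t) (2 / Real.pi * dens m u t) := by
  have h := (hasSum_norm_sq_fourier hu).mul_right (Real.exp (-(2 * m * t)))
  have e : Real.exp (-(2 * m * t)) = Real.exp (-(m * t)) ^ 2 := by
    rw [← Real.exp_nat_mul]; congr 1; push_cast; ring
  have e2 : 2 / Real.pi * dens m u t = (2 / Real.pi * ∫ θ in (0 : ℝ)..(2 * Real.pi), ‖u t θ‖ ^ 2) *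
      Real.exp (-(2 * m * t)) := by
    simp only [dens, slice]
    ring
  rw [e2]
  refine h.congr_fun fun k => ?_
  simp only [modeSq, norm_smul, Real.norm_eq_abs, Real.abs_exp, e]
  ring

theorem modeSq_nonneg (m : ℕ) (u : ℝ → ℝ → EuclideanSpace ℝ (Fin n)) (k : ℕ) (t : ℝ) :
    0 ≤ modeSq m u k t := by unfold modeSq; positivity

/-- Bessel's inequality. -/
theorem sum_modeSq_le (m : ℕ) {t : ℝ} (hu : Continuous (u t)) (S : Finset ℤ) :
    ∑ k ∈ S, modeSq m u k.natAbs t ≤ 2 / Real.pi * dens m u t :=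
  sum_le_hasSum S (fun k _ => modeSq_nonneg m u k.natAbs t) (hasSum_modeSq m hu)

theorem sum_ite_natAbs_le (m : ℕ) {x : ℝ} (hx : 0 ≤ x) (S : Finset ℤ) :
    ∑ k ∈ S, (if k.natAbs = m then x else 0) ≤ 2 * x := by
  rw [← Finset.sum_filter, Finset.sum_const, nsmul_eq_mul]
  gcongr
  have h : S.filter (fun k => k.natAbs = m) ⊆ {(m : ℤ), -(m : ℤ)} := by
    intro k hk
    have := (Finset.mem_filter.1 hk).2
    simp only [Finset.mem_insert, Finset.mem_singleton]
    omega
  exact_mod_cast (Finset.card_le_card h).trans Finset.card_le_two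

namespace IsC2

theorem continuousOn_modeSq_lap (hu : IsC2 T u) (m k : ℕ) :
    ContinuousOn (modeSq m (lap u) k) (Ioo 0 T) := by
  have hc := hu.continuousOn_fourierCos_lap k
  have hs := hu.continuousOn_fourierSin_lap k
  unfold modeSq
  fun_prop

theorem sum_integral_modeSq_lap_le (hu : IsC2 T u) (m : ℕ) {α β : ℝ} (hαβ : α ≤ β)
    (hsub : Icc α β ⊆ Ioo 0 T) (S : Finset ℤ) :
    ∑ k ∈ S, ∫ t in α..β, modeSq m (lap u) k.natAbs t ≤
      2 / Real.pi * ∫ t in α..β, dens m (lap u) t := by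
  have hi : ∀ {f : ℝ → ℝ}, ContinuousOn f (Ioo 0 T) → IntervalIntegrable f volume α β :=
    fun hf => ContinuousOn.intervalIntegrable (by rw [uIcc_of_le hαβ]; exact hf.mono hsub)
  rw [← intervalIntegral.integral_finsetSum fun k _ => hi (hu.continuousOn_modeSq_lap m k.natAbs),
    ← intervalIntegral.integral_const_mul]
  refine intervalIntegral.integral_mono_on hαβ
    (hi (continuousOn_finsetSum _ fun k _ => hu.continuousOn_modeSq_lap m k.natAbs))
    (hi ((continuousOn_dens m hu.continuousOn_lap).const_mul _)) fun t ht => ?_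
  exact sum_modeSq_le m (continuous_of_continuousOn_prod hu.continuousOn_lap (hsub ht)) S

theorem integral_modeSq_lap_eq (hu : IsC2 T u) (m k : ℕ) {α β : ℝ} (hαβ : α ≤ β)
    (hsub : Icc α β ⊆ Ioo 0 T) :
    ∫ t in α..β, modeSq m (lap u) k t =
      (∫ t in α..β, ‖Real.exp (-(m * t)) • fourierCos k (lap u) t‖ ^ 2) +
      ∫ t in α..β, ‖Real.exp (-(m * t)) • fourierSin k (lap u) t‖ ^ 2 := by
  have hi : ∀ {f : ℝ → EuclideanSpace ℝ (Fin n)}, ContinuousOn f (Ioo 0 T) →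
      IntervalIntegrable (fun t => ‖Real.exp (-(m * t)) • f t‖ ^ 2) volume α β := fun hf => by
    refine ContinuousOn.intervalIntegrable ?_
    rw [uIcc_of_le hαβ]
    have hf' := hf.mono hsub
    fun_prop
  exact intervalIntegral.integral_add (hi (hu.continuousOn_fourierCos_lap k))
    (hi (hu.continuousOn_fourierSin_lap k))

theorem modeSq_le (hu : IsC2 T u) {m : ℕ} (hm : 1 ≤ m) (k : ℕ) {α β ℓ s s' t r A : ℝ}
    (hsub : Icc α β ⊆ Ioo 0 T) (hℓ : β - α ≤ ℓ) (hs : α ≤ s) (hst : s + 1 ≤ t)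
    (hts' : t ≤ s' - 1) (hs' : s' ≤ β) (hr : r ∈ Icc α β)
    (hA : Real.exp (-(t - s)) ≤ A) (hA' : Real.exp (-(s' - t)) ≤ A) :
    modeSq m u k t ≤ 6 * ((2 + ℓ) * Real.exp (2 * m) * A) ^ 2 *
      (modeSq m u k s + modeSq m u k (s + 1) + (modeSq m u k s' + modeSq m u k (s' - 1))) +
      6 * (6 + 2 * ℓ * Real.exp (2 * m)) ^ 2 * ℓ * (∫ x in α..β, modeSq m (lap u) k x) +
      6 * if k = m then ‖phase m u r‖ ^ 2 else 0 := by
  have hαβ : α ≤ β := hr.1.trans hr.2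
  have h1 := norm_sq_mode_le hm (y := fourierCos k u) (y' := fourierCos k (dt u))
    (f := fourierCos k (lap u)) (fun x hx => hasDerivAt_fourierCos hu.interior_one k (hsub hx))
    (fun x hx => hu.hasDerivAt_fourierCos_dt k (hsub hx))
    ((hu.continuousOn_fourierCos_lap k).mono hsub) hℓ hs hst hts' hs' hr hA hA'
  have h2 := norm_sq_mode_le hm (y := fourierSin k u) (y' := fourierSin k (dt u))
    (f := fourierSin k (lap u)) (fun x hx => hasDerivAt_fourierSin hu.interior_one k (hsub hx))
    (fun x hx => hu.hasDerivAt_fourierSin_dt k (hsub hx))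
    ((hu.continuousOn_fourierSin_lap k).mono hsub) hℓ hs hst hts' hs' hr hA hA'
  rw [hu.integral_modeSq_lap_eq m k hαβ hsub]
  have h3 : (if k = m then ‖phase m u r‖ ^ 2 else 0) =
      (if k = m then ‖Real.exp (-(m * r)) •
        (fourierCos k (dt u) r + (m : ℝ) • fourierCos k u r)‖ ^ 2 else 0) +
      (if k = m then ‖Real.exp (-(m * r)) •
        (fourierSin k (dt u) r + (m : ℝ) • fourierSin k u r)‖ ^ 2 else 0) := by
    split_ifs with h
    · rw [phase, norm_toLp_pair_sq, hu.gCos_eq m (hsub hr), hu.gSin_eq m (hsub hr), h]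
    · simp
  rw [h3]
  simp only [modeSq]
  linarith

/-- The mode estimates summed over all frequencies. -/
theorem dens_le (hu : IsC2 T u) {m : ℕ} (hm : 1 ≤ m) {α β ℓ s s' t r A : ℝ}
    (hsub : Icc α β ⊆ Ioo 0 T) (hℓ : β - α ≤ ℓ) (hs : α ≤ s) (hst : s + 1 ≤ t)
    (hts' : t ≤ s' - 1) (hs' : s' ≤ β) (hr : r ∈ Icc α β)
    (hA : Real.exp (-(t - s)) ≤ A) (hA' : Real.exp (-(s' - t)) ≤ A) :
    dens m u t ≤ 6 * ((2 + ℓ) * Real.exp (2 * m) * A) ^ 2 *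
      (dens m u s + dens m u (s + 1) + (dens m u s' + dens m u (s' - 1))) +
      6 * (6 + 2 * ℓ * Real.exp (2 * m)) ^ 2 * ℓ * (∫ x in α..β, dens m (lap u) x) +
      6 * Real.pi * ‖phase m u r‖ ^ 2 := by
  have hαβ : α ≤ β := hr.1.trans hr.2
  have hpi := Real.pi_pos
  have hc : ∀ x, α ≤ x → x ≤ β → Continuous (u x) := fun x h1 h2 =>
    hu.continuous (Ioo_subset_Icc_self (hsub ⟨h1, h2⟩))
  have hℓ0 : 0 ≤ ℓ := by linarith
  set X := 6 * ((2 + ℓ) * Real.exp (2 * m) * A) ^ 2 with hX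
  set Y := 6 * (6 + 2 * ℓ * Real.exp (2 * m)) ^ 2 * ℓ with hY
  have hX0 : 0 ≤ X := by positivity
  have hY0 : 0 ≤ Y := by positivity
  have hfin : ∀ S : Finset ℤ, ∑ k ∈ S, modeSq m u k.natAbs t ≤
      X * (2 / Real.pi * (dens m u s + dens m u (s + 1) + (dens m u s' + dens m u (s' - 1)))) +
      Y * (2 / Real.pi * ∫ x in α..β, dens m (lap u) x) + 6 * (2 * ‖phase m u r‖ ^ 2) := by
    intro S
    refine (Finset.sum_le_sum fun k _ =>
      hu.modeSq_le hm k.natAbs hsub hℓ hs hst hts' hs' hr hA hA').trans ?_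
    rw [Finset.sum_add_distrib, Finset.sum_add_distrib, ← Finset.mul_sum, ← Finset.mul_sum,
      ← Finset.mul_sum]
    have h1 := hu.sum_integral_modeSq_lap_le m hαβ hsub S
    have h2 := sum_ite_natAbs_le m (sq_nonneg ‖phase m u r‖) S
    have h3 := sum_modeSq_le m (hc s (by linarith) (by linarith)) S
    have h4 := sum_modeSq_le m (hc (s + 1) (by linarith) (by linarith)) S
    have h5 := sum_modeSq_le m (hc s' (by linarith) (by linarith)) S
    have h6 := sum_modeSq_le m (hc (s' - 1) (by linarith) (by linarith)) S
    simp only [Finset.sum_add_distrib]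
    gcongr
    linarith
  have hle := hasSum_le_of_sum_le (hasSum_modeSq m (hc t (by linarith) (by linarith))) hfin
  have h7 := mul_le_mul_of_nonneg_left hle (by positivity : 0 ≤ Real.pi / 2)
  have h8 : Real.pi / 2 * (2 / Real.pi * dens m u t) = dens m u t := by field_simp
  rw [h8] at h7
  refine h7.trans (le_of_eq ?_)
  field_simp

/-- The three-circle inequality without smallness assumptions: the neutral mode and the
inhomogeneity appear as error terms, and all other modes gain almost a factor `e^{-2L}`. -/
theorem integral_dens_le (hu : IsC2 T u) {m : ℕ} (hm : 1 ≤ m) {c L r : ℝ} (hL : 3 ≤ L)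
    (hc : 0 ≤ c) (hcL : c + 3 * L ≤ T) (hr : r ∈ Icc (c + 1) (c + 3 * L - 1)) :
    ∫ t in (c + L)..(c + 2 * L), dens m u t ≤
      12 * L * ((2 + 3 * L) * Real.exp (2 * m) * Real.exp (-(L - 2))) ^ 2 *
        ((∫ t in c..(c + L), dens m u t) + ∫ t in (c + 2 * L)..(c + 3 * L), dens m u t) +
      L * (18 * L * (6 + 6 * L * Real.exp (2 * m)) ^ 2 + 6 * Real.pi) *
        (‖phase m u r‖ ^ 2 + ∫ t in (c + 1)..(c + 3 * L - 1), dens m (lap u) t) := by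
  have hcd : ContinuousOn (dens m u) (Icc 0 T) := continuousOn_dens m hu.contDiffOn.continuousOn
  have hsub : Icc (c + 1) (c + 3 * L - 1) ⊆ Ioo 0 T := fun x hx =>
    ⟨by linarith [hx.1], by linarith [hx.2]⟩
  have hint : ∀ a b, a ∈ Icc 0 T → b ∈ Icc 0 T → IntervalIntegrable (dens m u) volume a b :=
    fun a b ha hb => (hcd.mono ((convex_Icc 0 T).ordConnected.uIcc_subset ha hb)).intervalIntegrable
  set H := ∫ t in (c + 1)..(c + 3 * L - 1), dens m (lap u) t with hH
  have hH0 : 0 ≤ H := intervalIntegral.integral_nonneg (by linarith) fun t _ => dens_nonneg m _ t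
  set E1 := ∫ t in c..(c + L), dens m u t with hE1
  set E3 := ∫ t in (c + 2 * L)..(c + 3 * L), dens m u t with hE3
  set X := 6 * ((2 + 3 * L) * Real.exp (2 * m) * Real.exp (-(L - 2))) ^ 2 with hX
  have hX0 : 0 ≤ X := by positivity
  set Y := 6 * (6 + 2 * (3 * L) * Real.exp (2 * m)) ^ 2 * (3 * L) with hY
  set G := ‖phase m u r‖ ^ 2
  have hG0 : 0 ≤ G := sq_nonneg _
  -- Average the pointwise estimate over the position of the outer points.
  have hpt : ∀ t ∈ Icc (c + L) (c + 2 * L), dens m u t ≤ 2 * X * (E1 + E3) + Y * H +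
      6 * Real.pi * G := by
    intro t ht
    have hx : ∀ x ∈ Icc (0 : ℝ) 1, dens m u t ≤ X * (dens m u (c + 1 + x) +
        dens m u (c + 2 + x) + (dens m u (c + 3 * L - 1 - x) + dens m u (c + 3 * L - 2 - x))) +
        (Y * H + 6 * Real.pi * G) := by
      intro x hx
      have h := hu.dens_le hm (t := t) (s := c + 1 + x) (s' := c + 3 * L - 1 - x) (ℓ := 3 * L)
        (A := Real.exp (-(L - 2))) hsub (by linarith) (by linarith [hx.1])
        (by linarith [hx.2, ht.1]) (by linarith [hx.2, ht.2]) (by linarith [hx.1]) hr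
        (Real.exp_le_exp.2 (by linarith [hx.2, ht.1])) (Real.exp_le_exp.2 (by linarith [hx.2, ht.2]))
      rw [show c + 1 + x + 1 = c + 2 + x by ring,
        show c + 3 * L - 1 - x - 1 = c + 3 * L - 2 - x by ring] at h
      linarith
    have hca : ∀ y, 0 ≤ y → y + 1 ≤ T →
        IntervalIntegrable (fun x => dens m u (y + x)) volume 0 1 := fun y h1 h2 => by
      refine (hcd.comp (by fun_prop) ?_).intervalIntegrable
      rw [uIcc_of_le zero_le_one]
      exact fun x hx => ⟨by linarith [hx.1], by linarith [hx.2]⟩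
    have hcb : ∀ y, 1 ≤ y → y ≤ T →
        IntervalIntegrable (fun x => dens m u (y - x)) volume 0 1 := fun y h1 h2 => by
      refine (hcd.comp (by fun_prop) ?_).intervalIntegrable
      rw [uIcc_of_le zero_le_one]
      exact fun x hx => ⟨by linarith [hx.2], by linarith [hx.1]⟩
    have i1 := hca (c + 1) (by linarith) (by linarith)
    have i2 := hca (c + 2) (by linarith) (by linarith)
    have i3 := hcb (c + 3 * L - 1) (by linarith) (by linarith)
    have i4 := hcb (c + 3 * L - 2) (by linarith) (by linarith)
    have hmono := intervalIntegral.integral_mono_on (μ := volume) (a := 0) (b := 1) zero_le_one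
      (continuous_const.intervalIntegrable _ _)
      ((((i1.add i2).add (i3.add i4)).const_mul X).add
        (continuous_const.intervalIntegrable (μ := volume) (u := fun _ => Y * H + 6 * Real.pi * G)
          0 1)) hx
    have hsumint : ∫ x in (0 : ℝ)..1, (X * (dens m u (c + 1 + x) +
        dens m u (c + 2 + x) + (dens m u (c + 3 * L - 1 - x) + dens m u (c + 3 * L - 2 - x))) +
        (Y * H + 6 * Real.pi * G)) =
        X * ((∫ x in (0 : ℝ)..1, dens m u (c + 1 + x)) + (∫ x in (0 : ℝ)..1, dens m u (c + 2 + x)) +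
          ((∫ x in (0 : ℝ)..1, dens m u (c + 3 * L - 1 - x)) +
          ∫ x in (0 : ℝ)..1, dens m u (c + 3 * L - 2 - x))) + (Y * H + 6 * Real.pi * G) := by
      rw [← intervalIntegral.integral_add i1 i2, ← intervalIntegral.integral_add i3 i4,
        ← intervalIntegral.integral_add (i1.add i2) (i3.add i4),
        ← intervalIntegral.integral_const_mul]
      refine (intervalIntegral.integral_add (((i1.add i2).add (i3.add i4)).const_mul X)
        (continuous_const.intervalIntegrable (μ := volume) _ _)).trans ?_
      simp
    have hlin : ∀ a b p q, p ∈ Icc 0 T → q ∈ Icc 0 T → p ≤ a → a ≤ b → b ≤ q →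
        ∫ x in a..b, dens m u x ≤ ∫ x in p..q, dens m u x := fun a b p q hp hq h1 h2 h3 =>
      intervalIntegral.integral_mono_interval h1 h2 h3 (ae_of_all _ fun x => dens_nonneg m u x)
        (hint p q hp hq)
    have b1 : ∫ x in (0 : ℝ)..1, dens m u (c + 1 + x) ≤ E1 := by
      rw [intervalIntegral.integral_comp_add_left (dens m u)]
      exact hlin _ _ _ _ ⟨by linarith, by linarith⟩ ⟨by linarith, by linarith⟩ (by linarith)
        (by linarith) (by linarith)
    have b2 : ∫ x in (0 : ℝ)..1, dens m u (c + 2 + x) ≤ E1 := by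
      rw [intervalIntegral.integral_comp_add_left (dens m u)]
      exact hlin _ _ _ _ ⟨by linarith, by linarith⟩ ⟨by linarith, by linarith⟩ (by linarith)
        (by linarith) (by linarith)
    have b3 : ∫ x in (0 : ℝ)..1, dens m u (c + 3 * L - 1 - x) ≤ E3 := by
      rw [intervalIntegral.integral_comp_sub_left (dens m u)]
      exact hlin _ _ _ _ ⟨by linarith, by linarith⟩ ⟨by linarith, by linarith⟩ (by linarith)
        (by linarith) (by linarith)
    have b4 : ∫ x in (0 : ℝ)..1, dens m u (c + 3 * L - 2 - x) ≤ E3 := by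
      rw [intervalIntegral.integral_comp_sub_left (dens m u)]
      exact hlin _ _ _ _ ⟨by linarith, by linarith⟩ ⟨by linarith, by linarith⟩ (by linarith)
        (by linarith) (by linarith)
    have hmono' := hmono.trans (le_of_eq hsumint)
    rw [intervalIntegral.integral_const, sub_zero, one_smul] at hmono'
    refine hmono'.trans ?_
    have : X * ((∫ x in (0 : ℝ)..1, dens m u (c + 1 + x)) +
          (∫ x in (0 : ℝ)..1, dens m u (c + 2 + x)) +
          ((∫ x in (0 : ℝ)..1, dens m u (c + 3 * L - 1 - x)) +
          ∫ x in (0 : ℝ)..1, dens m u (c + 3 * L - 2 - x))) ≤ X * (E1 + E1 + (E3 + E3)) := by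
      gcongr
    linarith
  have hfinal := intervalIntegral.integral_mono_on (μ := volume) (a := c + L) (b := c + 2 * L)
    (by linarith) (hint _ _ ⟨by linarith, by linarith⟩ ⟨by linarith, by linarith⟩)
    (continuous_const.intervalIntegrable _ _) hpt
  rw [intervalIntegral.integral_const, smul_eq_mul] at hfinal
  have hpi := Real.pi_pos
  have e1 : Y = 18 * L * (6 + 6 * L * Real.exp (2 * m)) ^ 2 := by rw [hY]; ring
  rw [← e1]
  have hY0 : 0 ≤ Y := by positivity
  have h1 : 0 ≤ L * (Y * G) := by positivity
  have h2 : 0 ≤ L * (6 * Real.pi * H) := by positivity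
  rw [hX] at hfinal
  linarith

/-- The derivative of `e^{-mt} g⁺` is `e^{-mt}` times the pair of Fourier coefficients of `Δu` of
frequency `m`. -/
theorem norm_phase_sub_sq_le (hu : IsC2 T u) (m : ℕ) {α β ℓ t r : ℝ}
    (hsub : Icc α β ⊆ Ioo 0 T) (hℓ : β - α ≤ ℓ) (ht : t ∈ Icc α β) (hr : r ∈ Icc α β) :
    ‖phase m u t - phase m u r‖ ^ 2 ≤ ℓ * ∫ x in α..β, dens m (lap u) x := by
  have hαβ : α ≤ β := hr.1.trans hr.2
  have hℓ0 : 0 ≤ ℓ := by linarith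
  have key : ∀ {y y' f G : ℝ → EuclideanSpace ℝ (Fin n)},
      (∀ x ∈ Ioo 0 T, HasDerivAt y (y' x) x) →
      (∀ x ∈ Ioo 0 T, HasDerivAt y' ((m : ℝ) ^ 2 • y x + f x) x) → ContinuousOn f (Ioo 0 T) →
      (∀ x ∈ Ioo 0 T, G x = y' x + (m : ℝ) • y x) →
      ‖Real.exp (-(m * t)) • G t - Real.exp (-(m * r)) • G r‖ ^ 2 ≤
        ℓ * ∫ x in α..β, ‖Real.exp (-(m * x)) • f x‖ ^ 2 := by
    intro y y' f G hy hy' hf hG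
    have hseg : uIcc r t ⊆ Icc α β := (convex_Icc α β).ordConnected.uIcc_subset hr ht
    have hd : ∀ x ∈ uIcc r t, HasDerivAt (fun x => Real.exp (-(m * x)) • (y' x + (m : ℝ) • y x))
        (Real.exp (-(m * x)) • f x) x := fun x hx => by
      have hx' := hsub (hseg hx)
      have hexp : HasDerivAt (fun x : ℝ => Real.exp (-(m * x)))
          (Real.exp (-(m * x)) * (-(m * 1))) x := (((hasDerivAt_id x).const_mul (m : ℝ)).neg).exp
      refine (hexp.smul ((hy' x hx').add ((hy x hx').const_smul (m : ℝ)))).congr_deriv ?_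
      simp only [Pi.add_apply, Pi.smul_apply]
      module
    have hcf : ContinuousOn (fun x => Real.exp (-(m * x)) • f x) (Icc α β) := by
      have hf' := hf.mono hsub
      fun_prop
    have h1 := intervalIntegral.integral_eq_sub_of_hasDerivAt hd (hcf.mono hseg).intervalIntegrable
    rw [hG t (hsub ht), hG r (hsub hr), ← h1]
    refine le_trans ?_ (sq_integral_le hαβ hℓ hcf.norm)
    gcongr
    refine (intervalIntegral.norm_integral_le_abs_integral_norm).trans ?_
    rcases le_total r t with h | h
    · rw [abs_of_nonneg (intervalIntegral.integral_nonneg h fun x _ => norm_nonneg _)]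
      exact integral_norm_mono hcf hr.1 h ht.2
    · rw [intervalIntegral.integral_symm, abs_neg,
        abs_of_nonneg (intervalIntegral.integral_nonneg h fun x _ => norm_nonneg _)]
      exact integral_norm_mono hcf ht.1 h hr.2
  have h1 := key (fun x hx => hasDerivAt_fourierCos hu.interior_one m hx)
    (fun x hx => hu.hasDerivAt_fourierCos_dt m hx) (hu.continuousOn_fourierCos_lap m)
    (fun x hx => hu.gCos_eq m hx)
  have h2 := key (fun x hx => hasDerivAt_fourierSin hu.interior_one m hx)
    (fun x hx => hu.hasDerivAt_fourierSin_dt m hx) (hu.continuousOn_fourierSin_lap m)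
    (fun x hx => hu.gSin_eq m hx)
  have h3 := hu.sum_integral_modeSq_lap_le m hαβ hsub {(m : ℤ)}
  rw [Finset.sum_singleton, Int.natAbs_natCast, hu.integral_modeSq_lap_eq m m hαβ hsub] at h3
  have h4 : 0 ≤ ∫ x in α..β, dens m (lap u) x :=
    intervalIntegral.integral_nonneg hαβ fun t _ => dens_nonneg m _ t
  have h5 : 2 / Real.pi ≤ 1 := by
    rw [div_le_one Real.pi_pos]; linarith [Real.pi_gt_three]
  have h6 := mul_le_mul_of_nonneg_right h5 h4
  have h7 := mul_le_mul_of_nonneg_left (h3.trans h6) hℓ0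
  rw [phase, phase, ← WithLp.toLp_sub, Prod.mk_sub_mk, norm_toLp_pair_sq]
  linarith

end IsC2

end ThreeCircles

/-! ### Solutions with small coefficient -/

section Solutions

variable {n : ℕ} {T : ℝ} {u : ℝ → ℝ → EuclideanSpace ℝ (Fin n)}

theorem NearHarmonic.mono {δ δ' : ℝ} (h : NearHarmonic δ T u) (hδ : δ ≤ δ') :
    NearHarmonic δ' T u := fun t ht θ hθ => (h t ht θ hθ).trans
  (mul_le_mul_of_nonneg_right hδ (add_nonneg (norm_nonneg _) (Real.sqrt_nonneg _)))

section

variable {φ : ℝ → ℝ → EuclideanSpace ℝ (Fin n) → EuclideanSpace ℝ (Fin n) →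
      EuclideanSpace ℝ (Fin n) → EuclideanSpace ℝ (Fin n)} {ω : ℝ → ℝ → ℝ}

theorem IsSolution.isC2 (h : IsSolution T u φ ω) : IsC2 T u := ⟨h.contDiffOn, h.periodic⟩

/-- The essential bound on `ω` gives a bound almost everywhere, hence everywhere, because both sides
of the inequality are continuous. -/
theorem IsSolution.nearHarmonic (h : IsSolution T u φ ω) {δ : ℝ}
    (hω : supNorm T ω < ENNReal.ofReal δ) : NearHarmonic δ T u := by
  have hu := h.isC2
  set U : Set (ℝ × ℝ) := Ioo 0 T ×ˢ Ioo 0 (2 * Real.pi) with hU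
  have hUo : IsOpen U := isOpen_Ioo.prod isOpen_Ioo
  have hδ : 0 < δ := ENNReal.ofReal_pos.1 (pos_of_gt hω)
  have hae : ∀ᵐ p ∂(volume : Measure (ℝ × ℝ)).restrict (Icc 0 T ×ˢ Ico 0 (2 * Real.pi)),
      ‖Function.uncurry ω p‖ₑ ≤ supNorm T ω := by
    rw [supNorm, eLpNorm_exponent_top]
    exact ae_le_eLpNormEssSup
  have hae2 : ∀ᵐ p ∂(volume : Measure (ℝ × ℝ)).restrict U,
      ‖Function.uncurry ω p‖ₑ ≤ supNorm T ω :=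
    ae_mono (Measure.restrict_mono (prod_mono Ioo_subset_Icc_self Ioo_subset_Ico_self) le_rfl) hae
  have hUs : U ⊆ Ioo 0 T ×ˢ univ := prod_mono le_rfl (subset_univ _)
  have c1 : ContinuousOn (fun p : ℝ × ℝ => ‖lap u p.1 p.2‖) U := (hu.continuousOn_lap.mono hUs).norm
  have c2 : ContinuousOn (fun p : ℝ × ℝ => ‖u p.1 p.2‖) U :=
    (hu.interior.continuousOn.mono hUs).norm
  have c3 : ContinuousOn (fun p : ℝ × ℝ => gradNorm u p.1 p.2) U := by
    have h1 : ContinuousOn (fun p : ℝ × ℝ => ‖dt u p.1 p.2‖) U :=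
      (hu.contDiffOn_dt.continuousOn.mono hUs).norm
    have h2 : ContinuousOn (fun p : ℝ × ℝ => ‖dθ u p.1 p.2‖) U :=
      (hu.contDiffOn_dθ.continuousOn.mono hUs).norm
    exact ((h1.pow 2).add (h2.pow 2)).sqrt
  have hkey : EqOn (fun p : ℝ × ℝ => max (‖lap u p.1 p.2‖ -
      δ * (‖u p.1 p.2‖ + gradNorm u p.1 p.2)) 0) (fun _ => 0) U := by
    refine Measure.eqOn_open_of_ae_eq (μ := (volume : Measure (ℝ × ℝ))) ?_ hUo ?_ continuousOn_const
    · filter_upwards [hae2, ae_restrict_mem hUo.measurableSet] with p hp hpU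
      refine max_eq_right (sub_nonpos.2 ?_)
      have hθ : p.2 ∈ Ico 0 (2 * Real.pi) := Ioo_subset_Ico_self hpU.2
      have h1 : ω p.1 p.2 ≤ δ := by
        have h2 : ‖ω p.1 p.2‖ₑ ≤ ENNReal.ofReal δ := hp.trans hω.le
        rw [← ofReal_norm, ENNReal.ofReal_le_ofReal_iff hδ.le] at h2
        exact (le_abs_self _).trans h2
      rw [h.equation p.1 hpU.1 p.2 hθ]
      refine (h.bound p.1 hpU.1 p.2 hθ).trans ?_
      exact mul_le_mul_of_nonneg_right h1 (add_nonneg (norm_nonneg _) (Real.sqrt_nonneg _))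
    · exact (c1.sub ((c2.add c3).const_mul δ)).sup continuousOn_const
  intro t ht θ hθ
  have := hkey (show (t, θ) ∈ U from ⟨ht, hθ⟩)
  exact sub_nonpos.1 (max_eq_right_iff.1 this)

end

theorem energy_nonneg (m : ℕ) {L : ℝ} (hL : 0 ≤ L) (i : ℕ)
    (u : ℝ → ℝ → EuclideanSpace ℝ (Fin n)) : 0 ≤ energy m L i u := by
  rw [energy_eq_integral_dens]
  exact intervalIntegral.integral_nonneg (by nlinarith) fun t _ => dens_nonneg m u t

namespace IsC2

theorem intervalIntegrable_dens (hu : IsC2 T u) (m : ℕ) {a b : ℝ} (ha : a ∈ Icc 0 T)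
    (hb : b ∈ Icc 0 T) : IntervalIntegrable (dens m u) volume a b :=
  ((continuousOn_dens m hu.contDiffOn.continuousOn).mono
    ((convex_Icc 0 T).ordConnected.uIcc_subset ha hb)).intervalIntegrable

theorem sum_energy_eq (hu : IsC2 T u) (m : ℕ) {L : ℝ} (hL : 0 ≤ L) {j : ℕ} (hj : 1 ≤ j) (N : ℕ)
    (hT : ((j : ℝ) + N - 1) * L ≤ T) :
    ∑ i ∈ Finset.range N, energy m L (j + i) u =
      ∫ t in (((j : ℝ) - 1) * L)..(((j : ℝ) - 1) * L + N * L), dens m u t := by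
  have hj' : (1 : ℝ) ≤ j := by exact_mod_cast hj
  have h := intervalIntegral.sum_integral_adjacent_intervals (μ := volume) (f := dens m u)
    (a := fun i : ℕ => ((j : ℝ) - 1) * L + i * L) (n := N) fun i hi => by
      have hi' : ((i : ℝ) + 1) ≤ N := by exact_mod_cast hi
      have h1 : 0 ≤ ((j : ℝ) - 1) * L := mul_nonneg (by linarith) hL
      have h3 : ((i : ℝ) + 1) * L ≤ N * L := by gcongr
      have h4 : 0 ≤ (i : ℝ) * L := by positivity
      refine hu.intervalIntegrable_dens m ⟨by linarith, by linarith⟩ ⟨?_, ?_⟩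
      · push_cast; linarith
      · push_cast; linarith
  simp only [Nat.cast_zero, zero_mul, add_zero] at h
  rw [← h]
  refine Finset.sum_congr rfl fun i _ => ?_
  rw [energy_eq_integral_dens]
  congr 1 <;> · push_cast; ring

/-- On a segment where `u` vanishes, so does `γᵢ`; hence the convention `λᵢ = 0` for `Eᵢ = 0` hides
nothing. -/
theorem gam_eq_zero (hu : IsC2 T u) (m : ℕ) {L : ℝ} (hL : 0 < L) {i : ℕ} (hi : 1 ≤ i)
    (hT : (i : ℝ) * L ≤ T) (hE : energy m L i u = 0) : gam m L i u = 0 := by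
  have hi' : (1 : ℝ) ≤ i := by exact_mod_cast hi
  have h0 : 0 ≤ ((i : ℝ) - 1) * L := mul_nonneg (by linarith) hL.le
  have hlt : ((i : ℝ) - 1) * L < i * L := by nlinarith
  have hsub : Icc (((i : ℝ) - 1) * L) (i * L) ⊆ Icc 0 T := Icc_subset_Icc h0 hT
  have hdens : ∀ t ∈ Icc (((i : ℝ) - 1) * L) (i * L), dens m u t = 0 := by
    by_contra! hcon
    obtain ⟨t, ht, hne⟩ := hcon
    have := intervalIntegral.integral_pos hlt
      ((continuousOn_dens m hu.contDiffOn.continuousOn).mono hsub)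
      (fun x _ => dens_nonneg m u x) ⟨t, ht, lt_of_le_of_ne (dens_nonneg m u t) hne.symm⟩
    rw [← energy_eq_integral_dens, hE] at this
    exact lt_irrefl _ this
  have hmode : ∀ t ∈ Icc (((i : ℝ) - 1) * L) (i * L),
      fourierCos m u t = 0 ∧ fourierSin m u t = 0 := by
    intro t ht
    have h1 := sum_modeSq_le m (hu.continuous (hsub ht)) {(m : ℤ)}
    rw [Finset.sum_singleton, Int.natAbs_natCast, hdens t ht, mul_zero, modeSq] at h1
    have h2 : ∀ x y : ℝ, x ^ 2 + y ^ 2 ≤ 0 → x = 0 ∧ y = 0 := fun x y h =>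
      ⟨by nlinarith [sq_nonneg x, sq_nonneg y], by nlinarith [sq_nonneg x, sq_nonneg y]⟩
    obtain ⟨h3, h4⟩ := h2 _ _ h1
    have h5 := (Real.exp_pos (-((m : ℝ) * t))).ne'
    exact ⟨(smul_eq_zero.1 (norm_eq_zero.1 h3)).resolve_left h5,
      (smul_eq_zero.1 (norm_eq_zero.1 h4)).resolve_left h5⟩
  have hmid : mid L i ∈ Ioo (((i : ℝ) - 1) * L) (i * L) := by
    constructor <;> · rw [mid]; nlinarith
  have hnhds := Icc_mem_nhds hmid.1 hmid.2
  have h1 : fourierCos m u =ᶠ[nhds (mid L i)] fun _ => 0 :=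
    Filter.mem_of_superset hnhds fun t ht => (hmode t ht).1
  have h2 : fourierSin m u =ᶠ[nhds (mid L i)] fun _ => 0 :=
    Filter.mem_of_superset hnhds fun t ht => (hmode t ht).2
  rw [gam, gCos, gSin, h1.deriv_eq, h2.deriv_eq, h1.eq_of_nhds, h2.eq_of_nhds]
  simp

theorem gam_le_of_lam_le (hu : IsC2 T u) (m : ℕ) {L ε : ℝ} (hL : 0 < L) {i : ℕ} (hi : 1 ≤ i)
    (hT : (i : ℝ) * L ≤ T) (h : lam m L i u ≤ ε) : gam m L i u ≤ ε * √(energy m L i u) := by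
  rcases (energy_nonneg m hL.le i u).eq_or_lt with h0 | h0
  · rw [hu.gam_eq_zero m hL hi hT h0.symm, ← h0]
    simp
  · rwa [lam, div_le_iff₀ (Real.sqrt_pos.2 h0)] at h

/-- The inhomogeneity on `N` consecutive segments is small compared with the energy. -/
theorem integral_dens_lap_le_sum (hu : IsC2 T u) (m : ℕ) {δ L : ℝ} (hδ1 : δ ≤ 1)
    (h : NearHarmonic δ T u) (hL : 2 ≤ L) {j N : ℕ} (hj : 1 ≤ j) (hN : 1 ≤ N)
    (hT : ((j : ℝ) + N - 1) * L ≤ T) :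
    ∫ t in (((j : ℝ) - 1) * L + 1)..(((j : ℝ) - 1) * L + N * L - 1), dens m (lap u) t ≤
      Real.exp (2 * m * (N * L)) * (128 * ((N * L) ^ 2 + (N * L) ^ 4)) * δ ^ 2 *
        ∑ i ∈ Finset.range N, energy m L (j + i) u := by
  have hj' : (1 : ℝ) ≤ j := by exact_mod_cast hj
  have hN' : (1 : ℝ) ≤ N := by exact_mod_cast hN
  rw [hu.sum_energy_eq m (by linarith) hj N hT]
  exact hu.integral_dens_lap_le m hδ1 h (mul_nonneg (by linarith) (by linarith)) (by nlinarith)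
    (by linarith)

/-- `e^{-mt} g⁺` is almost constant: its values at any two midpoints among `N` consecutive segments
are close. -/
theorem norm_phase_mid_sub_sq_le (hu : IsC2 T u) (m : ℕ) {δ L : ℝ} (hδ1 : δ ≤ 1)
    (h : NearHarmonic δ T u) (hL : 2 ≤ L) {j N i i' : ℕ} (hj : 1 ≤ j)
    (hT : ((j : ℝ) + N - 1) * L ≤ T) (hi : j ≤ i) (hiN : i < j + N) (hi' : j ≤ i')
    (hiN' : i' < j + N) :
    ‖phase m u (mid L i) - phase m u (mid L i')‖ ^ 2 ≤
      N * L * (Real.exp (2 * m * (N * L)) * (128 * ((N * L) ^ 2 + (N * L) ^ 4))) * δ ^ 2 *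
        ∑ i ∈ Finset.range N, energy m L (j + i) u := by
  have hN : 1 ≤ N := by omega
  have hj' : (1 : ℝ) ≤ j := by exact_mod_cast hj
  have hN' : (1 : ℝ) ≤ N := by exact_mod_cast hN
  have hc : 0 ≤ ((j : ℝ) - 1) * L := mul_nonneg (by linarith) (by linarith)
  have hm : ∀ i : ℕ, j ≤ i → i < j + N →
      mid L i ∈ Icc (((j : ℝ) - 1) * L + 1) (((j : ℝ) - 1) * L + N * L - 1) := by
    intro i h1 h2
    have h1' : (j : ℝ) ≤ i := by exact_mod_cast h1
    have h2' : (i : ℝ) + 1 ≤ j + N := by exact_mod_cast h2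
    constructor <;> · rw [mid]; nlinarith
  have h1 := hu.norm_phase_sub_sq_le m (ℓ := N * L)
    (α := ((j : ℝ) - 1) * L + 1) (β := ((j : ℝ) - 1) * L + N * L - 1)
    (fun x hx => ⟨by linarith [hx.1], by linarith [hx.2]⟩) (by linarith) (hm i hi hiN)
    (hm i' hi' hiN')
  have h2 := hu.integral_dens_lap_le_sum m hδ1 h hL hj hN hT
  refine h1.trans ?_
  have h3 : 0 ≤ (N : ℝ) * L := by positivity
  have h4 := mul_le_mul_of_nonneg_left h2 h3
  linarith

/-- `IsC2.integral_dens_le` for three consecutive segments. -/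
theorem energy_le (hu : IsC2 T u) {m : ℕ} (hm : 1 ≤ m) {L r : ℝ} (hL : 3 ≤ L) {j : ℕ} (hj : 1 ≤ j)
    (hT : ((j : ℝ) + 2) * L ≤ T)
    (hr : r ∈ Icc (((j : ℝ) - 1) * L + 1) (((j : ℝ) - 1) * L + 3 * L - 1)) :
    energy m L (j + 1) u ≤
      12 * L * ((2 + 3 * L) * Real.exp (2 * m) * Real.exp (-(L - 2))) ^ 2 *
        (energy m L j u + energy m L (j + 2) u) +
      L * (18 * L * (6 + 6 * L * Real.exp (2 * m)) ^ 2 + 6 * Real.pi) *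
        (‖phase m u r‖ ^ 2 +
          ∫ t in (((j : ℝ) - 1) * L + 1)..(((j : ℝ) - 1) * L + 3 * L - 1), dens m (lap u) t) := by
  have hj' : (1 : ℝ) ≤ j := by exact_mod_cast hj
  have h := hu.integral_dens_le hm hL (c := ((j : ℝ) - 1) * L)
    (mul_nonneg (by linarith) (by linarith)) (by linarith) hr
  simp only [energy_eq_integral_dens]
  convert h using 1
  · congr 1 <;> · push_cast; ring
  · congr 3
    · congr 1; ring
    · congr 1 <;> · push_cast; ring

end IsC2

/-- The three-circle inequality holds for three consecutive segments of any cylinder, as soon as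
`λᵢ` is small on one of them. -/
theorem exists_three_circle {m : ℕ} (hm : 1 ≤ m) {q L : ℝ} (hL : 3 ≤ L) (hqL : 0 ≤ q * L)
    (hκ : 12 * L * ((2 + 3 * L) * Real.exp (2 * m) * Real.exp (-(L - 2))) ^ 2 ≤
      1 / 2 * Real.exp (-(q * L))) :
    ∃ ε δ₀ : ℝ, 0 < ε ∧ 0 < δ₀ ∧ δ₀ ≤ 1 ∧
      ∀ (n : ℕ) (T : ℝ) (u : ℝ → ℝ → EuclideanSpace ℝ (Fin n)), IsC2 T u → NearHarmonic δ₀ T u →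
        ∀ j i : ℕ, 1 ≤ j → ((j : ℝ) + 2) * L ≤ T → j ≤ i → i ≤ j + 2 → lam m L i u ≤ ε →
        energy m L (j + 1) u ≤ Real.exp (-(q * L)) * (energy m L j u + energy m L (j + 2) u) := by
  set κ := 12 * L * ((2 + 3 * L) * Real.exp (2 * m) * Real.exp (-(L - 2))) ^ 2 with hκdef
  set K := L * (18 * L * (6 + 6 * L * Real.exp (2 * m)) ^ 2 + 6 * Real.pi) with hK
  have hpi := Real.pi_pos
  have hK0 : 0 < K := by positivity
  set K' := Real.exp (2 * m * ((3 : ℕ) * L)) * (128 * (((3 : ℕ) * L) ^ 2 + ((3 : ℕ) * L) ^ 4))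
    with hK'
  have hK'0 : 0 < K' := by positivity
  set e := Real.exp (-(q * L)) with he
  have he0 : 0 < e := Real.exp_pos _
  have he1 : e ≤ 1 := Real.exp_le_one_iff.2 (by linarith)
  refine ⟨√(e / (8 * K)), min 1 (√(e / (8 * K * K'))), by positivity, by positivity,
    min_le_left _ _, ?_⟩
  intro n T u hu h j i hj hT hji hij hlam
  set δ := min 1 (√(e / (8 * K * K')))
  have hδ0 : 0 < δ := by positivity
  have hδ2 : K * (K' * δ ^ 2) ≤ e / 8 := by
    have h1 : δ ^ 2 ≤ √(e / (8 * K * K')) ^ 2 := by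
      gcongr; exact min_le_right _ _
    rw [Real.sq_sqrt (by positivity)] at h1
    have h2 : K * (K' * (e / (8 * K * K'))) = e / 8 := by field_simp
    rw [← h2]
    gcongr
  have hi1 : 1 ≤ i := hj.trans hji
  have hji' : (j : ℝ) ≤ i := by exact_mod_cast hji
  have hij' : (i : ℝ) ≤ j + 2 := by exact_mod_cast hij
  have hδ1 : δ ≤ 1 := min_le_left _ _
  clear_value K K' e δ κ
  have hgam := hu.gam_le_of_lam_le m (by linarith) hi1 (by nlinarith) hlam
  have h1 := hu.energy_le hm hL hj hT (r := mid L i) (by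
    constructor <;> · rw [mid]; nlinarith)
  have h2 := hu.integral_dens_lap_le_sum m hδ1 h (by linarith : 2 ≤ L) hj
    (N := 3) (by norm_num) (by push_cast; linarith)
  simp only [Finset.sum_range_succ, Finset.sum_range_zero, zero_add, add_zero] at h2
  rw [← hK', Nat.cast_ofNat] at h2
  rw [← hK, ← hκdef] at h1
  rw [gam_eq_norm_phase] at hgam
  have n1 := energy_nonneg m (by linarith : 0 ≤ L) j u
  have n2 := energy_nonneg m (by linarith : 0 ≤ L) (j + 1) u
  have n3 := energy_nonneg m (by linarith : 0 ≤ L) (j + 2) u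
  have ni := energy_nonneg m (by linarith : 0 ≤ L) i u
  have hEi : energy m L i u ≤ energy m L j u + energy m L (j + 1) u + energy m L (j + 2) u := by
    obtain rfl | rfl | rfl : i = j ∨ i = j + 1 ∨ i = j + 2 := by omega
    all_goals linarith
  have h3 : K * ‖phase m u (mid L i)‖ ^ 2 ≤ e / 8 * energy m L i u := by
    have h4 : ‖phase m u (mid L i)‖ ^ 2 ≤ (√(e / (8 * K)) * √(energy m L i u)) ^ 2 := by gcongr
    rw [mul_pow, Real.sq_sqrt (by positivity), Real.sq_sqrt ni] at h4
    have h5 : K * (e / (8 * K) * energy m L i u) = e / 8 * energy m L i u := by field_simp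
    rw [← h5]
    gcongr
  set E1 := energy m L j u
  set E2 := energy m L (j + 1) u
  set E3 := energy m L (j + 2) u
  have h6 := mul_le_mul_of_nonneg_left h2 hK0.le
  have h7 : K * (K' * δ ^ 2 * (E1 + E2 + E3)) ≤ e / 8 * (E1 + E2 + E3) := by
    rw [← mul_assoc]
    gcongr
  have h8 : e / 8 * energy m L i u ≤ e / 8 * (E1 + E2 + E3) := by gcongr
  have h9 := mul_le_mul_of_nonneg_right hκ (add_nonneg n1 n3)
  have h10 : e * E2 ≤ E2 := mul_le_of_le_one_left n2 he1
  linarith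

end Solutions

/-! ### The neutral harmonic maps -/

section Neutral

variable {n : ℕ} {T : ℝ} {u : ℝ → ℝ → EuclideanSpace ℝ (Fin n)}

theorem integral_cos_sq_nat_mul {m : ℕ} (hm : 1 ≤ m) :
    ∫ θ in (0 : ℝ)..(2 * Real.pi), Real.cos (m * θ) ^ 2 = Real.pi := by
  have hm' : (m : ℝ) ≠ 0 := by positivity
  have h := integral_deriv_periodic_eq_zero (T := 2 * Real.pi)
    (h := fun θ => Real.sin (m * θ) * Real.cos (m * θ) / (2 * m))
    (h' := fun θ => Real.cos (m * θ) ^ 2 - 1 / 2) (fun θ => by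
      simp only [periodic_sin_nat_mul m θ, periodic_cos_nat_mul m θ])
    (fun θ => by
      refine (((hasDerivAt_sin_nat_mul m θ).mul (hasDerivAt_cos_nat_mul m θ)).div_const
        (2 * (m : ℝ))).congr_deriv ?_
      have := Real.sin_sq_add_cos_sq (m * θ)
      field_simp
      linear_combination -this) (by fun_prop)
  rw [intervalIntegral.integral_sub (Continuous.intervalIntegrable (by fun_prop) _ _)
    (Continuous.intervalIntegrable (by fun_prop) _ _)] at h
  simp at h
  linarith

theorem integral_sin_sq_nat_mul {m : ℕ} (hm : 1 ≤ m) :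
    ∫ θ in (0 : ℝ)..(2 * Real.pi), Real.sin (m * θ) ^ 2 = Real.pi := by
  simp only [Real.sin_sq]
  rw [intervalIntegral.integral_sub (Continuous.intervalIntegrable (by fun_prop) _ _)
    (Continuous.intervalIntegrable (by fun_prop) _ _), integral_cos_sq_nat_mul hm]
  simp
  ring

theorem integral_cos_mul_sin_nat_mul {m : ℕ} (hm : 1 ≤ m) :
    ∫ θ in (0 : ℝ)..(2 * Real.pi), Real.cos (m * θ) * Real.sin (m * θ) = 0 := by
  have hm' : (m : ℝ) ≠ 0 := by positivity
  refine integral_deriv_periodic_eq_zero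
    (h := fun θ => Real.sin (m * θ) * Real.sin (m * θ) / (2 * m)) (fun θ => by
      simp only [periodic_sin_nat_mul m θ]) (fun θ => ?_) (by fun_prop)
  refine (((hasDerivAt_sin_nat_mul m θ).mul (hasDerivAt_sin_nat_mul m θ)).div_const
    (2 * (m : ℝ))).congr_deriv ?_
  field_simp
  ring

/-- The neutral harmonic maps `e^{mt} (A cos mθ + B sin mθ)`. -/
noncomputable def neutral (m : ℕ) (A B : EuclideanSpace ℝ (Fin n)) (t θ : ℝ) :
    EuclideanSpace ℝ (Fin n) :=
  Real.exp (m * t) • (Real.cos (m * θ) • A + Real.sin (m * θ) • B)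

theorem proj_eq_neutral (m : ℕ) (L : ℝ) (i : ℕ) (u : ℝ → ℝ → EuclideanSpace ℝ (Fin n)) :
    proj m L i u = neutral m ((Real.exp (-(m * mid L i)) / (2 * m)) • gCos m u (mid L i))
      ((Real.exp (-(m * mid L i)) / (2 * m)) • gSin m u (mid L i)) := by
  funext t θ
  rw [proj, neutral, sub_eq_add_neg, Real.exp_add]
  module

variable (m : ℕ) (A B : EuclideanSpace ℝ (Fin n))

theorem contDiff_neutral : ContDiff ℝ 2 (Function.uncurry (neutral m A B)) := by
  unfold Function.uncurry neutral
  fun_prop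

theorem hasDerivAt_neutral_fst (t θ : ℝ) :
    HasDerivAt (fun s => neutral m A B s θ) ((m : ℝ) • neutral m A B t θ) t := by
  have hexp : HasDerivAt (fun x : ℝ => Real.exp (m * x))
      (Real.exp (m * t) * (m * 1)) t := ((hasDerivAt_id t).const_mul (m : ℝ)).exp
  refine (hexp.smul_const (Real.cos (m * θ) • A + Real.sin (m * θ) • B)).congr_deriv ?_
  rw [neutral]
  module

theorem hasDerivAt_neutral_snd (t θ : ℝ) :
    HasDerivAt (neutral m A B t) ((m : ℝ) • neutral m B (-A) t θ) θ := by
  refine ((((hasDerivAt_cos_nat_mul m θ).smul_const A).add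
    ((hasDerivAt_sin_nat_mul m θ).smul_const B)).const_smul (Real.exp (m * t))).congr_deriv ?_
  rw [neutral]
  module

theorem IsC2.sub_neutral (hu : IsC2 T u) : IsC2 T (fun t θ => u t θ - neutral m A B t θ) := by
  refine ⟨hu.contDiffOn.sub (contDiff_neutral m A B).contDiffOn, fun t ht θ => ?_⟩
  simp only [neutral, hu.periodic t ht θ, periodic_cos_nat_mul m θ, periodic_sin_nat_mul m θ]

/-- Subtracting a neutral harmonic map does not change the Laplacian. -/
theorem IsC2.lap_sub_neutral (hu : IsC2 T u) {t : ℝ} (ht : t ∈ Ioo 0 T) (θ : ℝ) :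
    lap (fun t θ => u t θ - neutral m A B t θ) t θ = lap u t θ := by
  have h1 : ∀ s ∈ Ioo 0 T, dt (fun t θ => u t θ - neutral m A B t θ) s θ =
      dt u s θ - (m : ℝ) • neutral m A B s θ := fun s hs =>
    ((hasDerivAt_dt hu.interior_one hs θ).sub (hasDerivAt_neutral_fst m A B s θ)).deriv
  have h2 : dt (dt (fun t θ => u t θ - neutral m A B t θ)) t θ =
      dt (dt u) t θ - (m : ℝ) • (m : ℝ) • neutral m A B t θ := by
    have he : (fun s => dt (fun t θ => u t θ - neutral m A B t θ) s θ) =ᶠ[nhds t]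
        fun s => dt u s θ - (m : ℝ) • neutral m A B s θ :=
      Filter.mem_of_superset (isOpen_Ioo.mem_nhds ht) h1
    rw [dt, he.deriv_eq]
    exact ((hasDerivAt_dt hu.contDiffOn_dt ht θ).sub
      ((hasDerivAt_neutral_fst m A B t θ).const_smul (m : ℝ))).deriv
  have h3 : dθ (fun t θ => u t θ - neutral m A B t θ) t =
      fun θ => dθ u t θ - (m : ℝ) • neutral m B (-A) t θ := funext fun θ =>
    ((hasDerivAt_dθ hu.interior_one ht θ).sub (hasDerivAt_neutral_snd m A B t θ)).deriv
  have h4 : dθ (dθ (fun t θ => u t θ - neutral m A B t θ)) t θ =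
      dθ (dθ u) t θ - (m : ℝ) • (m : ℝ) • neutral m (-A) (-B) t θ := by
    rw [dθ]
    simp only [h3]
    exact ((hasDerivAt_dθ hu.contDiffOn_dθ ht θ).sub
      ((hasDerivAt_neutral_snd m B (-A) t θ).const_smul (m : ℝ))).deriv
  rw [lap, lap, h2, h4, neutral, neutral]
  module

theorem IsC2.dens_lap_sub_neutral (hu : IsC2 T u) {t : ℝ} (ht : t ∈ Ioo 0 T) :
    dens m (lap (fun t θ => u t θ - neutral m A B t θ)) t = dens m (lap u) t := by
  rw [dens, dens, slice_congr (funext fun θ => hu.lap_sub_neutral m A B ht θ)]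

variable {m}

theorem fourierCos_neutral (hm : 1 ≤ m) (t : ℝ) :
    fourierCos m (neutral m A B) t = Real.exp (m * t) • A := by
  have h : ∀ θ, Real.cos (m * θ) • neutral m A B t θ =
      (Real.cos (m * θ) ^ 2) • (Real.exp (m * t) • A) +
        (Real.cos (m * θ) * Real.sin (m * θ)) • (Real.exp (m * t) • B) := fun θ => by
    rw [neutral]; module
  rw [fourierCos]
  simp only [h]
  rw [intervalIntegral.integral_add (Continuous.intervalIntegrable (by fun_prop) _ _)
    (Continuous.intervalIntegrable (by fun_prop) _ _), intervalIntegral.integral_smul_const,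
    intervalIntegral.integral_smul_const, integral_cos_sq_nat_mul hm,
    integral_cos_mul_sin_nat_mul hm, zero_smul, add_zero, smul_smul, one_div,
    inv_mul_cancel₀ Real.pi_ne_zero, one_smul]

theorem fourierSin_neutral (hm : 1 ≤ m) (t : ℝ) :
    fourierSin m (neutral m A B) t = Real.exp (m * t) • B := by
  have h : ∀ θ, Real.sin (m * θ) • neutral m A B t θ =
      (Real.cos (m * θ) * Real.sin (m * θ)) • (Real.exp (m * t) • A) +
        (Real.sin (m * θ) ^ 2) • (Real.exp (m * t) • B) := fun θ => by
    rw [neutral]; module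
  rw [fourierSin]
  simp only [h]
  rw [intervalIntegral.integral_add (Continuous.intervalIntegrable (by fun_prop) _ _)
    (Continuous.intervalIntegrable (by fun_prop) _ _), intervalIntegral.integral_smul_const,
    intervalIntegral.integral_smul_const, integral_sin_sq_nat_mul hm,
    integral_cos_mul_sin_nat_mul hm, zero_smul, zero_add, smul_smul, one_div,
    inv_mul_cancel₀ Real.pi_ne_zero, one_smul]

theorem continuous_neutral (t : ℝ) : Continuous (neutral m A B t) := by
  unfold neutral; fun_prop

theorem gCos_sub_neutral (hu : IsC2 T u) (hm : 1 ≤ m) {t : ℝ} (ht : t ∈ Ioo 0 T) :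
    gCos m (fun t θ => u t θ - neutral m A B t θ) t =
      gCos m u t - (2 * m : ℝ) • Real.exp (m * t) • A := by
  have h1 : ∀ s ∈ Ioo 0 T, fourierCos m (fun t θ => u t θ - neutral m A B t θ) s =
      fourierCos m u s - Real.exp (m * s) • A := fun s hs => by
    have hc := hu.continuous (Ioo_subset_Icc_self hs)
    have hn := continuous_neutral (m := m) A B s
    rw [← fourierCos_neutral A B hm s]
    simp only [fourierCos, smul_sub]
    rw [intervalIntegral.integral_sub (Continuous.intervalIntegrable (by fun_prop) _ _)
      (Continuous.intervalIntegrable (by fun_prop) _ _), smul_sub]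
  have he : fourierCos m (fun t θ => u t θ - neutral m A B t θ) =ᶠ[nhds t]
      fun s => fourierCos m u s - Real.exp (m * s) • A :=
    Filter.mem_of_superset (isOpen_Ioo.mem_nhds ht) h1
  have hexp : HasDerivAt (fun x : ℝ => Real.exp (m * x))
      (Real.exp (m * t) * (m * 1)) t := ((hasDerivAt_id t).const_mul (m : ℝ)).exp
  have hd := (IsC2.hasDerivAt_fourierCos hu.interior_one m ht)
  rw [gCos, he.deriv_eq, h1 t ht, gCos, hd.deriv]
  rw [(hd.fun_sub (hexp.smul_const A)).deriv]
  module

theorem gSin_sub_neutral (hu : IsC2 T u) (hm : 1 ≤ m) {t : ℝ} (ht : t ∈ Ioo 0 T) :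
    gSin m (fun t θ => u t θ - neutral m A B t θ) t =
      gSin m u t - (2 * m : ℝ) • Real.exp (m * t) • B := by
  have h1 : ∀ s ∈ Ioo 0 T, fourierSin m (fun t θ => u t θ - neutral m A B t θ) s =
      fourierSin m u s - Real.exp (m * s) • B := fun s hs => by
    have hc := hu.continuous (Ioo_subset_Icc_self hs)
    have hn := continuous_neutral (m := m) A B s
    rw [← fourierSin_neutral A B hm s]
    simp only [fourierSin, smul_sub]
    rw [intervalIntegral.integral_sub (Continuous.intervalIntegrable (by fun_prop) _ _)
      (Continuous.intervalIntegrable (by fun_prop) _ _), smul_sub]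
  have he : fourierSin m (fun t θ => u t θ - neutral m A B t θ) =ᶠ[nhds t]
      fun s => fourierSin m u s - Real.exp (m * s) • B :=
    Filter.mem_of_superset (isOpen_Ioo.mem_nhds ht) h1
  have hexp : HasDerivAt (fun x : ℝ => Real.exp (m * x))
      (Real.exp (m * t) * (m * 1)) t := ((hasDerivAt_id t).const_mul (m : ℝ)).exp
  have hd := (IsC2.hasDerivAt_fourierSin hu.interior_one m ht)
  rw [gSin, he.deriv_eq, h1 t ht, gSin, hd.deriv]
  rw [(hd.fun_sub (hexp.smul_const B)).deriv]
  module

/-- Subtracting the projection `𝓕ᵢ(u)` subtracts the value of `e^{-mt} g⁺` at the midpoint. -/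
theorem phase_sub_proj (hu : IsC2 T u) (hm : 1 ≤ m) (L : ℝ) (i : ℕ) {t : ℝ} (ht : t ∈ Ioo 0 T) :
    phase m (fun t θ => u t θ - proj m L i u t θ) t = phase m u t - phase m u (mid L i) := by
  have hm' : (m : ℝ) ≠ 0 := by positivity
  have he : Real.exp (-(m * t)) * Real.exp (m * t) = 1 := by
    rw [← Real.exp_add]; simp
  have key : ∀ g x : EuclideanSpace ℝ (Fin n), Real.exp (-(m * t)) • (g - (2 * m : ℝ) •
      Real.exp (m * t) • (Real.exp (-(m * mid L i)) / (2 * m)) • x) =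
      Real.exp (-(m * t)) • g - Real.exp (-(m * mid L i)) • x := fun g x => by
    rw [smul_sub]
    congr 1
    simp only [smul_smul]
    congr 1
    field_simp
    linear_combination he
  simp only [proj_eq_neutral, phase, gCos_sub_neutral _ _ hu hm ht, gSin_sub_neutral _ _ hu hm ht,
    key, ← WithLp.toLp_sub, Prod.mk_sub_mk]

theorem dens_neutral (hm : 1 ≤ m) (t : ℝ) :
    dens m (neutral m A B) t = Real.pi * (‖A‖ ^ 2 + ‖B‖ ^ 2) := by
  have h : ∀ θ, ‖neutral m A B t θ‖ ^ 2 = Real.exp (m * t) ^ 2 *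
      (Real.cos (m * θ) ^ 2 * ‖A‖ ^ 2 + Real.cos (m * θ) * Real.sin (m * θ) * (2 * inner ℝ A B) +
        Real.sin (m * θ) ^ 2 * ‖B‖ ^ 2) := fun θ => by
    rw [neutral, norm_smul, mul_pow, Real.norm_eq_abs, Real.abs_exp, norm_add_sq_real,
      norm_smul, norm_smul, mul_pow, mul_pow, Real.norm_eq_abs, Real.norm_eq_abs, sq_abs, sq_abs,
      real_inner_smul_left, real_inner_smul_right]
    ring
  have he : Real.exp (m * t) ^ 2 * Real.exp (-(2 * m * t)) = 1 := by
    rw [← Real.exp_nat_mul, ← Real.exp_add, Real.exp_eq_one_iff]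
    push_cast
    ring
  rw [dens, slice]
  simp only [h]
  rw [intervalIntegral.integral_const_mul,
    intervalIntegral.integral_add (Continuous.intervalIntegrable (by fun_prop) _ _)
    (Continuous.intervalIntegrable (by fun_prop) _ _),
    intervalIntegral.integral_add (Continuous.intervalIntegrable (by fun_prop) _ _)
    (Continuous.intervalIntegrable (by fun_prop) _ _), intervalIntegral.integral_mul_const,
    intervalIntegral.integral_mul_const, intervalIntegral.integral_mul_const,
    integral_cos_sq_nat_mul hm, integral_sin_sq_nat_mul hm, integral_cos_mul_sin_nat_mul hm]
  linear_combination (Real.pi * ‖A‖ ^ 2 + Real.pi * ‖B‖ ^ 2) * he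

/-- The energy of `𝓕ᵢ(u)` is the same on all segments. -/
theorem energy_proj (hm : 1 ≤ m) (L : ℝ) (i j : ℕ) (u : ℝ → ℝ → EuclideanSpace ℝ (Fin n)) :
    energy m L j (proj m L i u) = Real.pi * L / (4 * m ^ 2) * gam m L i u ^ 2 := by
  have hm' : (m : ℝ) ≠ 0 := by positivity
  rw [energy_eq_integral_dens, proj_eq_neutral]
  simp only [dens_neutral _ _ hm]
  rw [intervalIntegral.integral_const, gam, mul_pow, Real.sq_sqrt (by positivity), norm_smul,
    norm_smul, mul_pow, mul_pow, Real.norm_of_nonneg (by positivity), smul_eq_mul]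
  field_simp
  ring

theorem energy_sub_proj_le (hu : IsC2 T u) {L : ℝ} (hL : 0 ≤ L) (i : ℕ) {j : ℕ}
    (hj : 1 ≤ j) (hT : (j : ℝ) * L ≤ T) :
    energy m L j (fun t θ => u t θ - proj m L i u t θ) ≤
      2 * energy m L j u + 2 * energy m L j (proj m L i u) := by
  have hj' : (1 : ℝ) ≤ j := by exact_mod_cast hj
  have h0 : ((j : ℝ) - 1) * L ∈ Icc 0 T := ⟨mul_nonneg (by linarith) hL, by nlinarith⟩
  have h1 : (j : ℝ) * L ∈ Icc 0 T := ⟨by positivity, hT⟩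
  have h01 : ((j : ℝ) - 1) * L ≤ j * L := by nlinarith
  rw [energy_eq_integral_dens, energy_eq_integral_dens, energy_eq_integral_dens, proj_eq_neutral]
  set A := (Real.exp (-(m * mid L i)) / (2 * m)) • gCos m u (mid L i)
  set B := (Real.exp (-(m * mid L i)) / (2 * m)) • gSin m u (mid L i)
  have hi1 := hu.intervalIntegrable_dens m h0 h1
  have hi2 := (hu.sub_neutral m A B).intervalIntegrable_dens m h0 h1
  have hi3 : IntervalIntegrable (dens m (neutral m A B)) volume (((j : ℝ) - 1) * L) (j * L) :=
    (continuousOn_dens (S := univ) m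
      (contDiff_neutral m A B).continuous.continuousOn).mono (subset_univ _) |>.intervalIntegrable
  rw [← intervalIntegral.integral_const_mul, ← intervalIntegral.integral_const_mul,
    ← intervalIntegral.integral_add (hi1.const_mul 2) (hi3.const_mul 2)]
  refine intervalIntegral.integral_mono_on h01 hi2 ((hi1.const_mul 2).add (hi3.const_mul 2))
    fun t ht => ?_
  have hc := hu.continuous (t := t) ⟨h0.1.trans ht.1, ht.2.trans h1.2⟩
  have hn := continuous_neutral (m := m) A B t
  have hs : slice (fun t θ => u t θ - neutral m A B t θ) t ≤
      2 * slice u t + 2 * slice (neutral m A B) t := by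
    simp only [slice]
    rw [← intervalIntegral.integral_const_mul, ← intervalIntegral.integral_const_mul,
      ← intervalIntegral.integral_add (Continuous.intervalIntegrable (by fun_prop) _ _)
      (Continuous.intervalIntegrable (by fun_prop) _ _)]
    refine intervalIntegral.integral_mono_on (by positivity)
      (Continuous.intervalIntegrable (by fun_prop) _ _)
      (Continuous.intervalIntegrable (by fun_prop) _ _) fun θ _ => ?_
    have h2 : ‖u t θ - neutral m A B t θ‖ ^ 2 ≤ (‖u t θ‖ + ‖neutral m A B t θ‖) ^ 2 := by
      gcongr; exact norm_sub_le _ _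
    nlinarith [sq_nonneg (‖u t θ‖ - ‖neutral m A B t θ‖)]
  have h3 := mul_le_mul_of_nonneg_right hs (Real.exp_pos (-(2 * m * t))).le
  simp only [dens]
  linarith

end Neutral

/-! ### Sequences with three-term inequalities -/

section Sequences

/-- If an index satisfying `P` always lies on a decaying or on a growing stretch of `E`, and both
kinds of stretches propagate up to the ends of `{1, …, l}`, then `P` holds exactly on an initial and
on a final stretch. -/
theorem exists_initial_final_stretch {l : ℕ} {P : ℕ → Prop} {E : ℕ → ℝ} {ϑ : ℝ}
    (hPE : ∀ i, 1 ≤ i → i + 2 ≤ l → P (i + 1) →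
      E (i + 1) ≤ ϑ * E i ∨ E (i + 1) ≤ ϑ * E (i + 2))
    (hR : ∀ i, 1 ≤ i → i + 1 ≤ l → P i → E i ≤ ϑ * E (i + 1) →
      P (i + 1) ∧ (i + 2 ≤ l → E (i + 1) ≤ ϑ * E (i + 2)))
    (hL : ∀ i, 1 ≤ i → i + 1 ≤ l → P (i + 1) → E (i + 1) ≤ ϑ * E i →
      P i ∧ ∀ k, 1 ≤ k → i = k + 1 → E i ≤ ϑ * E k) :
    ∃ a b : ℕ, a < b ∧ b ≤ l + 1 ∧ (∀ i, 1 ≤ i → i ≤ a → P i) ∧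
      (∀ i, a < i → i < b → ¬ P i) ∧ (∀ i, b ≤ i → i ≤ l → P i) ∧
      (∀ i, 1 ≤ i → i + 1 ≤ a → E (i + 1) ≤ ϑ * E i) ∧
      (∀ i, b ≤ i → i + 1 ≤ l → E i ≤ ϑ * E (i + 1)) := by
  classical
  -- The end of the decaying stretch.
  obtain ⟨a, hal, haP, haE, haL⟩ : ∃ a, a ≤ l ∧ (∀ i, 1 ≤ i → i ≤ a → P i) ∧
      (∀ i, 1 ≤ i → i + 1 ≤ a → E (i + 1) ≤ ϑ * E i) ∧
      (∀ i, 1 ≤ i → i ≤ l → a < i → P i → 2 ≤ i ∧ (i + 1 ≤ l → E i ≤ ϑ * E (i + 1))) := by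
    let Q : ℕ → Prop := fun i => 1 ≤ i ∧ i + 2 ≤ l ∧ P (i + 1) ∧ E (i + 1) ≤ ϑ * E i
    have hQ : ∀ d i, Q (i + d) → 1 ≤ i → Q i := by
      intro d
      induction d with
      | zero => exact fun i h _ => h
      | succ d ih =>
        intro i h hi
        refine ih i ?_ hi
        obtain ⟨h1, h2, h3, h4⟩ := h
        obtain ⟨h5, h6⟩ := hL (i + d + 1) (by omega) (by omega) h3 h4
        exact ⟨by omega, by omega, h5, h6 (i + d) (by omega) rfl⟩
    by_cases hex : ∃ i, Q i
    · obtain ⟨i₀, hi₀⟩ := hex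
      have hg := Nat.findGreatest_spec (P := Q) (n := l) (m := i₀)
        (by have := hi₀.2.1; omega) hi₀
      set g := Nat.findGreatest Q l with hgdef
      have hdown : ∀ i, 1 ≤ i → i ≤ g → Q i := fun i h1 h2 =>
        hQ (g - i) i (by rwa [Nat.add_sub_cancel' h2]) h1
      have hg1 := hg.1
      have hg2 := hg.2.1
      refine ⟨g + 1, by omega, fun i h1 h2 => ?_, fun i h1 h2 => (hdown i h1 (by omega)).2.2.2,
        fun i h1 h2 h3 hP => ⟨by omega, fun h4 => ?_⟩⟩
      · rcases Nat.lt_or_ge i 2 with h | h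
        · obtain rfl : i = 1 := by omega
          have hq := hdown 1 le_rfl hg1
          exact (hL 1 le_rfl (by omega) hq.2.2.1 hq.2.2.2).1
        · obtain ⟨k, rfl⟩ : ∃ k, i = k + 1 := ⟨i - 1, by omega⟩
          exact (hdown k (by omega) (by omega)).2.2.1
      · obtain ⟨k, rfl⟩ : ∃ k, i = k + 1 := ⟨i - 1, by omega⟩
        refine (hPE k (by omega) (by omega) hP).resolve_left fun h5 => ?_
        exact Nat.findGreatest_is_greatest (P := Q) (n := l) (k := k) (by omega) (by omega)
          ⟨by omega, by omega, hP, h5⟩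
    · have hPR : ∀ i, 1 < i → i ≤ l → P i → 2 ≤ i ∧ (i + 1 ≤ l → E i ≤ ϑ * E (i + 1)) := by
        refine fun i h1 h2 hP => ⟨h1, fun h4 => ?_⟩
        obtain ⟨k, rfl⟩ : ∃ k, i = k + 1 := ⟨i - 1, by omega⟩
        refine (hPE k (by omega) (by omega) hP).resolve_left fun h5 => ?_
        exact hex ⟨k, by omega, by omega, hP, h5⟩
      by_cases h1 : 1 ≤ l ∧ P 1
      · refine ⟨1, h1.1, fun i h2 h3 => ?_, fun i h2 h3 => by omega,
          fun i h2 h3 h4 hP => hPR i h4 h3 hP⟩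
        rw [show i = 1 by omega]
        exact h1.2
      · refine ⟨0, by omega, fun i h2 h3 => by omega, fun i h2 h3 => by omega,
          fun i h2 h3 h4 hP => hPR i ?_ h3 hP⟩
        rcases h2.eq_or_lt with rfl | h
        · exact absurd ⟨h3, hP⟩ h1
        · exact h
  -- The start of the growing stretch.
  by_cases hex : ∃ i, a < i ∧ i ≤ l ∧ P i
  · have hb := Nat.find_spec hex
    have hmin := fun i => Nat.find_min (H := hex) (m := i)
    set b := Nat.find hex
    have hup : ∀ d, b + d ≤ l → P (b + d) ∧ (b + d + 1 ≤ l → E (b + d) ≤ ϑ * E (b + d + 1)) := by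
      intro d
      induction d with
      | zero => exact fun h => ⟨hb.2.2, (haL b (by omega) hb.2.1 hb.1 hb.2.2).2⟩
      | succ d ih =>
        intro h
        obtain ⟨h1, h2⟩ := ih (by omega)
        exact hR (b + d) (by omega) (by omega) h1 (h2 (by omega))
    refine ⟨a, b, hb.1, by omega, haP, fun i h1 h2 hP => hmin i h2 ⟨h1, by omega, hP⟩,
      fun i h1 h2 => ?_, haE, fun i h1 h2 => ?_⟩
    · have := (hup (i - b) (by omega)).1
      rwa [Nat.add_sub_cancel' h1] at this
    · have := (hup (i - b) (by omega)).2
      rw [Nat.add_sub_cancel' h1] at this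
      exact this h2
  · exact ⟨a, l + 1, by omega, le_rfl, haP, fun i h1 h2 hP => hex ⟨i, h1, by omega, hP⟩,
      fun i h1 h2 => by omega, haE, fun i h1 h2 => by omega⟩

theorem le_pow_mul_of_decay {E : ℕ → ℝ} {ϑ : ℝ} (hϑ : 0 ≤ ϑ) {a : ℕ}
    (h : ∀ i, 1 ≤ i → i + 1 ≤ a → E (i + 1) ≤ ϑ * E i) (i : ℕ) (hi : i + 1 ≤ a) :
    E (i + 1) ≤ ϑ ^ i * E 1 := by
  induction i with
  | zero => simp
  | succ i ih =>
    refine (h (i + 1) (by omega) hi).trans ?_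
    rw [pow_succ', mul_assoc]
    exact mul_le_mul_of_nonneg_left (ih (by omega)) hϑ

theorem le_pow_mul_of_growth {E : ℕ → ℝ} {ϑ : ℝ} (hϑ : 0 ≤ ϑ) {b l : ℕ}
    (h : ∀ i, b ≤ i → i + 1 ≤ l → E i ≤ ϑ * E (i + 1)) (d i : ℕ) (hi : b ≤ i) (hd : i + d = l) :
    E i ≤ ϑ ^ d * E l := by
  induction d generalizing i with
  | zero => simp [← hd]
  | succ d ih =>
    refine (h i hi (by omega)).trans ?_
    rw [pow_succ', mul_assoc]
    exact mul_le_mul_of_nonneg_left (ih (i + 1) (by omega) (by omega)) hϑ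

/-- A sequence which is bounded by `M` on `2N + 1` consecutive indices and at each inner index is at
most `ϑ` times its larger neighbour, up to an error `κ`, is small in the middle. -/
theorem le_pow_mul_add_of_max {e : ℕ → ℝ} {ϑ κ M : ℝ} (hϑ : 0 ≤ ϑ) (hϑ1 : ϑ ≤ 1) (hκ : 0 ≤ κ)
    {i N : ℕ} (hM : ∀ j, i ≤ j → j ≤ i + 2 * N → e j ≤ M)
    (h : ∀ j, i ≤ j → j + 2 ≤ i + 2 * N → e (j + 1) ≤ ϑ * max (e j) (e (j + 2)) + κ) :
    e (i + N) ≤ ϑ ^ N * M + N * κ := by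
  have key : ∀ r : ℕ, r ≤ N → ∀ j, i + r ≤ j → j + r ≤ i + 2 * N → e j ≤ ϑ ^ r * M + r * κ := by
    intro r
    induction r with
    | zero => intro _ j h1 h2; simpa using hM j h1 h2
    | succ r ih =>
      intro hr j h1 h2
      obtain ⟨k, rfl⟩ : ∃ k, j = k + 1 := ⟨j - 1, by omega⟩
      have h3 := ih (by omega) k (by omega) (by omega)
      have h4 := ih (by omega) (k + 2) (by omega) (by omega)
      refine (h k (by omega) (by omega)).trans ?_
      have h5 := mul_le_mul_of_nonneg_left (max_le h3 h4) hϑ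
      have h6 : ϑ * ((r : ℝ) * κ) ≤ r * κ := mul_le_of_le_one_left (by positivity) hϑ1
      rw [pow_succ']
      push_cast
      linarith
  exact key N le_rfl (i + N) le_rfl (by omega)

end Sequences

/-! ### Decay towards the middle of the cylinder -/

section Decay

/-- If `γᵢ` is small compared with `√Eᵢ` and the energy of a neighbouring segment is much larger,
then the corresponding quotient of that neighbour is small, too. -/
theorem lam_lt_of_neighbour {n m : ℕ} {L ε ϑ K δ : ℝ} {u : ℝ → ℝ → EuclideanSpace ℝ (Fin n)}
    {i i' : ℕ} (hL : 0 ≤ L) (hε : 0 < ε) (hϑ : ϑ ≤ 1 / 4)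
    (hgam : gam m L i u ≤ ε * √(energy m L i u)) (hE : energy m L i u ≤ ϑ * energy m L i' u)
    (hδ : K * δ ^ 2 ≤ ε ^ 2 / 32)
    (hph : ‖phase m u (mid L i') - phase m u (mid L i)‖ ^ 2 ≤
      K * δ ^ 2 * (energy m L i u + energy m L i' u)) :
    lam m L i' u < ε := by
  have n1 := energy_nonneg m hL i u
  have n2 := energy_nonneg m hL i' u
  rw [lam]
  rcases n2.eq_or_lt with h0 | h0
  · rw [← h0]; simpa using hε
  rw [div_lt_iff₀ (Real.sqrt_pos.2 h0)]
  rw [gam_eq_norm_phase] at hgam ⊢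
  have h1 : √(energy m L i u) ≤ 1 / 2 * √(energy m L i' u) := by
    rw [Real.sqrt_le_left (by positivity), mul_pow, Real.sq_sqrt n2]
    nlinarith
  have h2 : ‖phase m u (mid L i') - phase m u (mid L i)‖ ≤ ε / 4 * √(energy m L i' u) := by
    rw [← sq_le_sq₀ (norm_nonneg _) (by positivity), mul_pow, Real.sq_sqrt n2]
    refine hph.trans ?_
    have h3 : energy m L i u + energy m L i' u ≤ 2 * energy m L i' u := by nlinarith
    have h4 : K * δ ^ 2 * (energy m L i u + energy m L i' u) ≤
        ε ^ 2 / 32 * (2 * energy m L i' u) :=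
      mul_le_mul hδ h3 (add_nonneg n1 n2) (by positivity)
    linarith
  have h5 := norm_sub_norm_le (phase m u (mid L i')) (phase m u (mid L i))
  have h6 : ε * √(energy m L i u) ≤ ε * (1 / 2 * √(energy m L i' u)) := by gcongr
  have h7 : 0 < ε * √(energy m L i' u) := mul_pos hε (Real.sqrt_pos.2 h0)
  linarith

/-- Away from a middle stretch, the energy decays geometrically towards the middle and `λᵢ` is small;
on the middle stretch it is not. -/
theorem exists_decomposition {m : ℕ} {q L ε δ₀ : ℝ} (hL : 2 ≤ L) (hε : 0 < ε) (hδ₀ : 0 < δ₀)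
    (hϑ : 2 * Real.exp (-(q * L)) ≤ 1 / 4)
    (h3 : ∀ (n : ℕ) (T : ℝ) (u : ℝ → ℝ → EuclideanSpace ℝ (Fin n)), IsC2 T u → NearHarmonic δ₀ T u →
        ∀ j i : ℕ, 1 ≤ j → ((j : ℝ) + 2) * L ≤ T → j ≤ i → i ≤ j + 2 → lam m L i u ≤ ε →
        energy m L (j + 1) u ≤ Real.exp (-(q * L)) * (energy m L j u + energy m L (j + 2) u)) :
    ∃ δ₂ : ℝ, 0 < δ₂ ∧ ∀ (n l : ℕ) (u : ℝ → ℝ → EuclideanSpace ℝ (Fin n)), IsC2 (l * L) u →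
      NearHarmonic δ₂ (l * L) u → ∃ a b : ℕ, a < b ∧ b ≤ l + 1 ∧
        (∀ i, 1 ≤ i → i ≤ a → lam m L i u < ε) ∧ (∀ i, a < i → i < b → ¬ lam m L i u < ε) ∧
        (∀ i, b ≤ i → i ≤ l → lam m L i u < ε) ∧
        (∀ i, 1 ≤ i → i + 1 ≤ a →
          energy m L (i + 1) u ≤ 2 * Real.exp (-(q * L)) * energy m L i u) ∧
        (∀ i, b ≤ i → i + 1 ≤ l →
          energy m L i u ≤ 2 * Real.exp (-(q * L)) * energy m L (i + 1) u) := by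
  set K := (2 : ℕ) * L * (Real.exp (2 * m * ((2 : ℕ) * L)) *
    (128 * (((2 : ℕ) * L) ^ 2 + ((2 : ℕ) * L) ^ 4))) with hK
  have hK0 : 0 < K := by positivity
  set δ := min (min 1 δ₀) (√(ε ^ 2 / (32 * K)))
  have hδ0 : 0 < δ := by positivity
  have hδ1 : δ ≤ 1 := (min_le_left _ _).trans (min_le_left _ _)
  have hδδ : δ ≤ δ₀ := (min_le_left _ _).trans (min_le_right _ _)
  have hδK : K * δ ^ 2 ≤ ε ^ 2 / 32 := by
    have h1 : δ ^ 2 ≤ √(ε ^ 2 / (32 * K)) ^ 2 := by gcongr; exact min_le_right _ _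
    rw [Real.sq_sqrt (by positivity)] at h1
    have h2 : K * (ε ^ 2 / (32 * K)) = ε ^ 2 / 32 := by field_simp
    rw [← h2]
    gcongr
  refine ⟨δ, hδ0, fun n l u hu h => ?_⟩
  have he := Real.exp_pos (-(q * L))
  set e := Real.exp (-(q * L))
  have hE := fun i => energy_nonneg m (by linarith : 0 ≤ L) i u
  have hcast : ∀ {i : ℕ}, i ≤ l → (i : ℝ) * L ≤ l * L := fun hi => by
    have : (_ : ℝ) ≤ l := Nat.cast_le.2 hi
    gcongr
  have h3' := fun j i hj hjl h1 h2 hlam => h3 n _ u hu (h.mono hδδ) j i hj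
    (by simpa using hcast (i := j + 2) hjl) h1 h2 hlam
  have hph : ∀ i i' : ℕ, ∀ j, 1 ≤ j → j + 1 ≤ l → (i = j ∨ i = j + 1) → (i' = j ∨ i' = j + 1) →
      ‖phase m u (mid L i') - phase m u (mid L i)‖ ^ 2 ≤
        K * δ ^ 2 * (energy m L j u + energy m L (j + 1) u) := by
    intro i i' j hj hjl hi hi'
    have h1 := hu.norm_phase_mid_sub_sq_le m hδ1 h hL (j := j) (N := 2) (i := i') (i' := i) hj
      (by
        have := hcast hjl
        push_cast at this ⊢
        linarith) (by omega) (by omega) (by omega) (by omega)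
    simpa only [Finset.sum_range_succ, Finset.sum_range_zero, zero_add, add_zero] using h1
  refine exists_initial_final_stretch (P := fun i => lam m L i u < ε)
    (E := fun i => energy m L i u) (ϑ := 2 * e) (fun i h1 h2 hP => ?_) (fun i h1 h2 hP hEi => ?_)
    (fun i h1 h2 hP hEi => ?_)
  · have h4 := h3' i (i + 1) h1 h2 (by omega) (by omega) hP.le
    rcases le_total (energy m L i u) (energy m L (i + 2) u) with h5 | h5
    · right
      have := mul_le_mul_of_nonneg_left h5 he.le
      linarith
    · left
      have := mul_le_mul_of_nonneg_left h5 he.le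
      linarith
  · refine ⟨?_, fun h4 => ?_⟩
    · exact lam_lt_of_neighbour (by linarith) hε hϑ
        (hu.gam_le_of_lam_le m (by linarith) h1 (hcast (by omega)) hP.le) hEi hδK
        (hph i (i + 1) i h1 h2 (Or.inl rfl) (Or.inr rfl))
    · have h5 := h3' i i h1 h4 le_rfl (by omega) hP.le
      have h6 := mul_le_mul_of_nonneg_left hEi he.le
      have h7 : 2 * e * energy m L (i + 1) u ≤ 1 / 4 * energy m L (i + 1) u := by
        have := hE (i + 1)
        gcongr
      have h8 : e * energy m L i u ≤ e * energy m L (i + 1) u := by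
        gcongr
        have := hE (i + 1)
        linarith
      linarith [hE (i + 1)]
  · refine ⟨?_, fun k hk hik => ?_⟩
    · refine lam_lt_of_neighbour (K := K) (δ := δ) (by linarith) hε hϑ
        (hu.gam_le_of_lam_le m (by linarith) (by omega) (hcast h2) hP.le) hEi hδK ?_
      rw [add_comm (energy m L (i + 1) u)]
      exact hph (i + 1) i i h1 h2 (Or.inr rfl) (Or.inl rfl)
    · subst hik
      have h5 := h3' k (k + 2) hk (by omega) (by omega) le_rfl hP.le
      have h7 : 2 * e * energy m L (k + 1) u ≤ 1 / 4 * energy m L (k + 1) u := by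
        have := hE (k + 1)
        gcongr
      have h8 : e * energy m L (k + 2) u ≤ e * energy m L (k + 1) u := by
        gcongr
        have := hE (k + 1)
        linarith
      linarith [hE (k + 1)]

set_option maxHeartbeats 1600000 in
/-- On a stretch where no `λⱼ` is small, `u` is close to the neutral map `𝓕ᵢ(u)` in the middle: the
phase of the difference vanishes at the midpoint of `Qᵢ` and is small on the whole stretch, so that
the energy of the difference decays away from the ends of the stretch. -/
theorem exists_energy_sub_proj_le {m : ℕ} (hm : 1 ≤ m) {q L ε : ℝ} (hL : 3 ≤ L)
    (hLm : 4 * (m : ℝ) ^ 2 ≤ Real.pi * L) (hε : 0 < ε)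
    (hϑ : 2 * Real.exp (-(q * L)) ≤ 1 / 4)
    (hκ : 12 * L * ((2 + 3 * L) * Real.exp (2 * m) * Real.exp (-(L - 2))) ^ 2 ≤
      1 / 2 * Real.exp (-(q * L))) (N : ℕ) :
    ∃ δ : ℝ, 0 < δ ∧ ∀ (n : ℕ) (T : ℝ) (u : ℝ → ℝ → EuclideanSpace ℝ (Fin n)), IsC2 T u →
      NearHarmonic δ T u → ∀ i₀ : ℕ, 1 ≤ i₀ → ((i₀ : ℝ) + 2 * N) * L ≤ T →
      (∀ j, i₀ ≤ j → j ≤ i₀ + 2 * N → ε ≤ lam m L j u) →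
      energy m L (i₀ + N) (fun t θ => u t θ - proj m L (i₀ + N) u t θ) ≤
        5 * (1 + (ε ^ 2)⁻¹) * (2 * Real.exp (-(q * L))) ^ N *
          energy m L (i₀ + N) (proj m L (i₀ + N) u) := by
  have hpi := Real.pi_pos
  set K := L * (18 * L * (6 + 6 * L * Real.exp (2 * m)) ^ 2 + 6 * Real.pi) with hK
  set κ := 12 * L * ((2 + 3 * L) * Real.exp (2 * m) * Real.exp (-(L - 2))) ^ 2 with hκdef
  set K3 := Real.exp (2 * m * ((3 : ℕ) * L)) * (128 * (((3 : ℕ) * L) ^ 2 + ((3 : ℕ) * L) ^ 4))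
    with hK3
  set M : ℕ := 2 * N + 1 with hM
  set KM := M * L * (Real.exp (2 * m * (M * L)) * (128 * ((M * L) ^ 2 + (M * L) ^ 4))) with hKM
  have hK0 : 0 ≤ K := by positivity
  have hK30 : 0 ≤ K3 := by positivity
  have hKM0 : 0 ≤ KM := by positivity
  have he := Real.exp_pos (-(q * L))
  set e := Real.exp (-(q * L))
  have hϑ0 : 0 < 2 * e := by positivity
  have hpow1 : (2 * e) ^ N ≤ 1 := pow_le_one₀ hϑ0.le (by linarith)
  -- The choice of `D` and `x` makes `δ² ≤ x` sufficient for both bounds `b1` and `b2` below.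
  set D := 1 + 12 * M * KM + 2 * N * M * (K * (KM + K3)) with hD
  have hD0 : 0 < D := by positivity
  set x := ε ^ 2 * (2 * e) ^ N / D with hx
  have hx0 : 0 < x := by positivity
  have hxD : ∀ y, 0 ≤ y → y ≤ D → y * x ≤ ε ^ 2 * (2 * e) ^ N := fun y h0 hy => by
    have : D * x = ε ^ 2 * (2 * e) ^ N := by rw [hx]; field_simp
    rw [← this]
    gcongr
  refine ⟨min 1 (√x), by positivity, ?_⟩
  intro n T u hu h i₀ hi₀ hT hlam
  set δ := min 1 (√x)
  have hδ1 : δ ≤ 1 := min_le_left _ _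
  have hδx : δ ^ 2 ≤ x := by
    have h1 : δ ^ 2 ≤ √x ^ 2 := by gcongr; exact min_le_right _ _
    rwa [Real.sq_sqrt hx0.le] at h1
  have hδ2 : 0 ≤ δ ^ 2 := sq_nonneg _
  have b1 : 12 * M * KM * δ ^ 2 ≤ ε ^ 2 := by
    have h1 := hxD (12 * M * KM) (by positivity) (by
      have : 0 ≤ 2 * N * M * (K * (KM + K3)) := by positivity
      linarith)
    have h2 : 12 * M * KM * δ ^ 2 ≤ 12 * M * KM * x := by gcongr
    have h3 : ε ^ 2 * (2 * e) ^ N ≤ ε ^ 2 * 1 := by gcongr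
    linarith
  have b2 : 2 * N * M * (K * (KM + K3)) * δ ^ 2 ≤ ε ^ 2 * (2 * e) ^ N := by
    have h1 := hxD (2 * N * M * (K * (KM + K3))) (by positivity) (by
      have : 0 ≤ 12 * M * KM := by positivity
      linarith)
    have h2 : 2 * N * M * (K * (KM + K3)) * δ ^ 2 ≤ 2 * N * M * (K * (KM + K3)) * x := by gcongr
    linarith
  have hL0 : 0 ≤ L := by linarith
  clear_value e δ κ K x D K3 KM M
  have hi₀' : (1 : ℝ) ≤ i₀ := by exact_mod_cast hi₀
  have hcast : ∀ {j : ℕ}, j ≤ i₀ + 2 * N → (j : ℝ) * L ≤ T := fun {j} hj => by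
    have h1 : (j : ℝ) ≤ i₀ + 2 * N := by exact_mod_cast hj
    have h2 : (j : ℝ) * L ≤ (i₀ + 2 * N) * L := by gcongr
    linarith
  set i := i₀ + N with hi
  set w : ℝ → ℝ → EuclideanSpace ℝ (Fin n) := fun t θ => u t θ - proj m L i u t θ with hw
  set S := ∑ k ∈ Finset.range M, energy m L (i₀ + k) u with hS
  have hEn := fun j => energy_nonneg m hL0 j u
  have hS0 : 0 ≤ S := Finset.sum_nonneg fun k _ => hEn _
  set g := gam m L i u with hg
  -- The phases on the stretch differ little from the one in the middle.
  have hph : ∀ j, i₀ ≤ j → j ≤ i₀ + 2 * N →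
      ‖phase m u (mid L j) - phase m u (mid L i)‖ ^ 2 ≤ KM * δ ^ 2 * S := by
    intro j h1 h2
    rw [hKM]
    exact hu.norm_phase_mid_sub_sq_le m hδ1 h (by linarith) hi₀ (by
      have := hcast (le_refl (i₀ + 2 * N))
      rw [hM]
      push_cast at this ⊢
      linarith) h1 (by omega) (by omega) (by omega)
  clear_value S g
  have hgam : ∀ j, i₀ ≤ j → j ≤ i₀ + 2 * N →
      gam m L j u ^ 2 ≤ 3 / 2 * g ^ 2 + 3 * (KM * δ ^ 2 * S) := by
    intro j h1 h2
    have h3 := hph j h1 h2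
    have h4 := norm_sub_norm_le (phase m u (mid L j)) (phase m u (mid L i))
    rw [hg, gam_eq_norm_phase, gam_eq_norm_phase]
    have hx1 := norm_nonneg (phase m u (mid L j))
    set X := ‖phase m u (mid L j)‖
    set Y := ‖phase m u (mid L i)‖
    set Z := ‖phase m u (mid L j) - phase m u (mid L i)‖
    have h5 : X ^ 2 ≤ (Y + Z) ^ 2 := by
      gcongr
      linarith
    have h6 : (Y + Z) ^ 2 ≤ 3 / 2 * Y ^ 2 + 3 * Z ^ 2 := by nlinarith [sq_nonneg (Y - 2 * Z)]
    linarith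
  have hlamE : ∀ j, i₀ ≤ j → j ≤ i₀ + 2 * N → ε ^ 2 * energy m L j u ≤ gam m L j u ^ 2 := by
    intro j h1 h2
    have h3 := hlam j h1 h2
    have h4 : 0 < √(energy m L j u) := by
      refine lt_of_le_of_ne (Real.sqrt_nonneg _) fun h0 => ?_
      rw [lam, ← h0, div_zero] at h3
      linarith
    rw [lam, le_div_iff₀ h4] at h3
    have h5 : (ε * √(energy m L j u)) ^ 2 ≤ gam m L j u ^ 2 := by gcongr
    rwa [mul_pow, Real.sq_sqrt (hEn j)] at h5
  -- The whole energy of the stretch is controlled by the phase in the middle.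
  have hSg : ε ^ 2 * S ≤ 2 * M * g ^ 2 := by
    have h1 : ε ^ 2 * S ≤ M * (3 / 2 * g ^ 2 + 3 * (KM * δ ^ 2 * S)) := by
      have hsum : ε ^ 2 * S = ∑ k ∈ Finset.range M, ε ^ 2 * energy m L (i₀ + k) u := by
        rw [hS, Finset.mul_sum]
      rw [hsum]
      refine (Finset.sum_le_sum (g := fun _ => 3 / 2 * g ^ 2 + 3 * (KM * δ ^ 2 * S))
        fun k hk => ?_).trans ?_
      · have := Finset.mem_range.1 hk
        exact (hlamE (i₀ + k) (by omega) (by omega)).trans (hgam (i₀ + k) (by omega) (by omega))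
      · rw [Finset.sum_const, Finset.card_range, nsmul_eq_mul]
    have h2 := mul_le_mul_of_nonneg_right b1 hS0
    linarith
  have hδS : KM * δ ^ 2 * S ≤ g ^ 2 / 6 := by
    have h1 : ε ^ 2 * (KM * δ ^ 2 * S) ≤ ε ^ 2 * (g ^ 2 / 6) := by
      have h2 : ε ^ 2 * (KM * δ ^ 2 * S) = KM * δ ^ 2 * (ε ^ 2 * S) := by ring
      have h3 := mul_le_mul_of_nonneg_left hSg (by positivity : 0 ≤ KM * δ ^ 2)
      have h4 := mul_le_mul_of_nonneg_right b1 (sq_nonneg g)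
      linarith
    exact le_of_mul_le_mul_left h1 (by positivity)
  set F := energy m L i (proj m L i u) with hF
  clear_value F
  have hFg : F = Real.pi * L / (4 * m ^ 2) * g ^ 2 := by
    rw [hF, hg]
    exact energy_proj hm L i i u
  have hgF : g ^ 2 ≤ F := by
    rw [hFg]
    refine le_mul_of_one_le_left (sq_nonneg _) ?_
    rwa [one_le_div (by positivity)]
  have hF0 : 0 ≤ F := (sq_nonneg _).trans hgF
  have hwM : ∀ j, i₀ ≤ j → j ≤ i₀ + 2 * N → energy m L j w ≤ 4 * (1 + (ε ^ 2)⁻¹) * F := by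
    intro j h1 h2
    have h3 := energy_sub_proj_le hu hL0 i (m := m) (j := j) (by omega) (hcast h2)
    rw [energy_proj hm L i j u, ← hg, ← hFg] at h3
    have h4 : ε ^ 2 * energy m L j u ≤ 2 * F := by
      have := hlamE j h1 h2
      have := hgam j h1 h2
      linarith
    have h5 : energy m L j u ≤ (ε ^ 2)⁻¹ * (2 * F) := by
      rwa [inv_mul_eq_div, le_div_iff₀ (by positivity), mul_comm]
    refine h3.trans ?_
    linarith
  have hwC2 : IsC2 T w := by
    rw [hw, proj_eq_neutral]
    exact hu.sub_neutral m _ _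
  -- The three-circle inequality for `w`, with an error that is small compared with `F`.
  set err := K * (KM * δ ^ 2 * S + K3 * δ ^ 2 * S) with herr
  have herr0 : 0 ≤ err := by positivity
  have hstep : ∀ j, i₀ ≤ j → j + 2 ≤ i₀ + 2 * N →
      energy m L (j + 1) w ≤ 2 * e * max (energy m L j w) (energy m L (j + 2) w) + err := by
    intro j h1 h2
    have hj' : (1 : ℝ) ≤ j := by exact_mod_cast hi₀.trans h1
    have hjT : ((j : ℝ) + 2) * L ≤ T := by
      have := hcast h2
      push_cast at this
      exact this
    have hr : mid L (j + 1) ∈ Icc (((j : ℝ) - 1) * L + 1) (((j : ℝ) - 1) * L + 3 * L - 1) := by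
      constructor <;> · rw [mid]; push_cast; nlinarith
    have hc0 : 0 ≤ ((j : ℝ) - 1) * L := mul_nonneg (by linarith) hL0
    have hsub : Icc (((j : ℝ) - 1) * L + 1) (((j : ℝ) - 1) * L + 3 * L - 1) ⊆ Ioo 0 T :=
      fun y hy => ⟨by linarith [hy.1], by linarith [hy.2]⟩
    have h3 := hwC2.energy_le hm hL (by omega) hjT hr
    rw [← hκdef, ← hK, hw, phase_sub_proj hu hm L i (hsub hr), ← hw] at h3
    have h4 : ∫ t in (((j : ℝ) - 1) * L + 1)..(((j : ℝ) - 1) * L + 3 * L - 1), dens m (lap w) t =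
        ∫ t in (((j : ℝ) - 1) * L + 1)..(((j : ℝ) - 1) * L + 3 * L - 1), dens m (lap u) t := by
      refine intervalIntegral.integral_congr fun t ht => ?_
      rw [uIcc_of_le (by linarith)] at ht
      rw [hw, proj_eq_neutral]
      exact hu.dens_lap_sub_neutral m _ _ (hsub ht)
    have h5 := hu.integral_dens_lap_le_sum m hδ1 h (by linarith : 2 ≤ L) (j := j) (N := 3)
      (by omega) (by norm_num) (by push_cast; linarith)
    rw [← hK3, Nat.cast_ofNat, ← h4] at h5
    have h6 : ∑ k ∈ Finset.range 3, energy m L (j + k) u ≤ S := by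
      have h7 : ∑ k ∈ Finset.range 3, energy m L (j + k) u =
          ∑ k ∈ Finset.Ico (j - i₀) (j - i₀ + 3), energy m L (i₀ + k) u := by
        rw [Finset.sum_Ico_eq_sum_range, Nat.add_sub_cancel_left]
        refine Finset.sum_congr rfl fun k _ => ?_
        congr 1
        omega
      rw [h7, hS]
      refine Finset.sum_le_sum_of_subset_of_nonneg (fun k hk => ?_) fun k _ _ => hEn _
      have := Finset.mem_Ico.1 hk
      exact Finset.mem_range.2 (by omega)
    have h8 := h5.trans (mul_le_mul_of_nonneg_left h6 (by positivity : 0 ≤ K3 * δ ^ 2))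
    have h9 := mul_le_mul_of_nonneg_left (add_le_add (hph (j + 1) (by omega) (by omega)) h8) hK0
    have hwn := fun k => energy_nonneg m hL0 k w
    have h10 : κ * (energy m L j w + energy m L (j + 2) w) ≤
        1 / 2 * e * (2 * max (energy m L j w) (energy m L (j + 2) w)) := by
      refine mul_le_mul hκ ?_ (add_nonneg (hwn _) (hwn _)) (by positivity)
      have := le_max_left (energy m L j w) (energy m L (j + 2) w)
      have := le_max_right (energy m L j w) (energy m L (j + 2) w)
      linarith
    have h11 : 0 ≤ e * max (energy m L j w) (energy m L (j + 2) w) :=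
      mul_nonneg he.le ((hwn j).trans (le_max_left _ _))
    linarith
  have hfin := le_pow_mul_add_of_max (e := fun j => energy m L j w) hϑ0.le (by linarith) herr0
    hwM hstep
  have herrF : N * err ≤ (2 * e) ^ N * F := by
    have h1 : ε ^ 2 * (N * err) ≤ ε ^ 2 * ((2 * e) ^ N * F) := by
      have h2 := mul_le_mul_of_nonneg_left hSg (by positivity : 0 ≤ N * (K * (KM + K3)) * δ ^ 2)
      have h3 := mul_le_mul_of_nonneg_right b2 (sq_nonneg g)
      have h4 := mul_le_mul_of_nonneg_left hgF (by positivity : 0 ≤ ε ^ 2 * (2 * e) ^ N)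
      rw [herr]
      linarith
    exact le_of_mul_le_mul_left h1 (by positivity)
  have h12 : (2 * e) ^ N * F ≤ (1 + (ε ^ 2)⁻¹) * ((2 * e) ^ N * F) := by
    refine le_mul_of_one_le_left (by positivity) ?_
    have : 0 ≤ (ε ^ 2)⁻¹ := by positivity
    linarith
  linarith

end Decay

/-! ### The constants and the conclusion -/

/-- The conditions on the length `L` of the segments hold for all large `L`; the first one does
because `q < 2`. -/
theorem exists_length_threshold (m : ℕ) {q : ℝ} (hq : 0 < q) (hq2 : q < 2) :
    ∃ L₁ : ℝ, 0 < L₁ ∧ ∀ L : ℝ, L₁ < L →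
      12 * L * ((2 + 3 * L) * Real.exp (2 * m) * Real.exp (-(L - 2))) ^ 2 ≤
        1 / 2 * Real.exp (-(q * L)) ∧
      3 ≤ L ∧ 2 * Real.exp (-(q * L)) ≤ 1 / 4 ∧ 4 * (m : ℝ) ^ 2 ≤ Real.pi * L := by
  have hc : 0 < 2 - q := by linarith
  have t1 : Filter.Tendsto (fun L : ℝ => L ^ 3 * Real.exp (-((2 - q) * L))) Filter.atTop
      (nhds 0) := by
    have := (Real.tendsto_pow_mul_exp_neg_atTop_nhds_zero 3).comp
      (Filter.tendsto_id.const_mul_atTop hc)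
    have h2 := this.const_mul ((2 - q) ^ 3)⁻¹
    rw [mul_zero] at h2
    refine h2.congr fun L => ?_
    simp only [Function.comp, id]
    field_simp
  have t2 : Filter.Tendsto (fun L : ℝ => Real.exp (-(q * L))) Filter.atTop (nhds 0) :=
    Real.tendsto_exp_neg_atTop_nhds_zero.comp (Filter.tendsto_id.const_mul_atTop hq)
  have hB : 0 < 1 / (600 * Real.exp (4 * m + 4)) := by positivity
  obtain ⟨A, hA⟩ := Filter.eventually_atTop.1
    ((t1.eventually (eventually_le_nhds hB)).and (t2.eventually
      (eventually_le_nhds (by norm_num : (0 : ℝ) < 1 / 8))))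
  refine ⟨max A (max 3 (4 * (m : ℝ) ^ 2)), by positivity, fun L hL => ?_⟩
  have hLA := (le_max_left _ _).trans hL.le
  have hL3 := ((le_max_left _ _).trans (le_max_right _ _)).trans hL.le
  have hLm := ((le_max_right _ _).trans (le_max_right _ _)).trans hL.le
  obtain ⟨h1, h2⟩ := hA L hLA
  refine ⟨?_, hL3, by linarith, ?_⟩
  · have h3 : (2 + 3 * L) ^ 2 ≤ 16 * L ^ 2 := by nlinarith
    have h4 : 12 * L * ((2 + 3 * L) * Real.exp (2 * m) * Real.exp (-(L - 2))) ^ 2 =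
        12 * L * (2 + 3 * L) ^ 2 *
          (Real.exp (4 * m + 4) * Real.exp (-((2 - q) * L)) * Real.exp (-(q * L))) := by
      rw [← Real.exp_add, ← Real.exp_add, mul_assoc (2 + 3 * L), ← Real.exp_add, mul_pow,
        ← Real.exp_nat_mul, mul_assoc (12 * L)]
      congr 3
      push_cast
      ring
    rw [h4]
    have h5 : 12 * L * (2 + 3 * L) ^ 2 ≤ 200 * L ^ 3 := by
      nlinarith [pow_pos (by linarith : 0 < L) 3]
    rw [le_div_iff₀ (by positivity)] at h1
    calc _ ≤ 200 * L ^ 3 * (Real.exp (4 * m + 4) * Real.exp (-((2 - q) * L)) *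
          Real.exp (-(q * L))) := by gcongr
      _ = 1 / 3 * (L ^ 3 * Real.exp (-((2 - q) * L)) * (600 * Real.exp (4 * m + 4))) *
          Real.exp (-(q * L)) := by ring
      _ ≤ 1 / 3 * 1 * Real.exp (-(q * L)) := by gcongr
      _ ≤ _ := by
        have := Real.exp_pos (-(q * L))
        linarith
  · have := Real.pi_gt_three
    nlinarith

/-- `e^{-q'L} = 2e^{-qL}`. -/
theorem exp_neg_qPrime_mul {q L : ℝ} (hL : L ≠ 0) :
    Real.exp (-(qPrime q L * L)) = 2 * Real.exp (-(q * L)) := by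
  have h1 : -(qPrime q L * L) = Real.log 2 + -(q * L) := by
    rw [qPrime]
    field_simp
    ring
  rw [h1, Real.exp_add, Real.exp_log two_pos]

/-- If `λᵢ > 0`, then `𝓕ᵢ(u)` has positive energy, and `νᵢ` is a quotient of real numbers. -/
theorem nu_le {n m : ℕ} (hm : 1 ≤ m) {L c : ℝ} (hL : 0 < L)
    {u : ℝ → ℝ → EuclideanSpace ℝ (Fin n)} {i : ℕ} (hlam : 0 < lam m L i u)
    (h : energy m L i (fun t θ => u t θ - proj m L i u t θ) ≤ c * energy m L i (proj m L i u)) :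
    nu m L i u ≤ ENNReal.ofReal c := by
  have hg : gam m L i u ≠ 0 := by
    rintro h0
    rw [lam, h0, zero_div] at hlam
    exact hlam.false
  have hm' : (0 : ℝ) < m := by exact_mod_cast hm
  have hF : 0 < energy m L i (proj m L i u) := by
    rw [energy_proj hm]
    positivity
  rw [nu, ← ENNReal.ofReal_div_of_pos hF]
  exact ENNReal.ofReal_le_ofReal ((div_le_iff₀ hF).2 h)

end Cylinder

theorem theorem2p11 (m : ℕ) (hm : 1 ≤ m) (q : ℝ) (hq : q ∈ Set.Ioo (0 : ℝ) 2) :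
    ∃ L₁ : ℝ, 0 < L₁ ∧ ∀ L : ℝ, L₁ < L →
    ∃ ε₁ : ℝ, 0 < ε₁ ∧ Cylinder.IsThreeCircleThreshold m q L ε₁ ∧
    ∃ (C δ₂ : ℝ) (δ : ℝ → ℝ), 0 < C ∧ 0 < δ₂ ∧ (∀ s, 0 < δ s) ∧
    ∀ (n l : ℕ) (u : ℝ → ℝ → EuclideanSpace ℝ (Fin n))
      (φ : ℝ → ℝ → EuclideanSpace ℝ (Fin n) → EuclideanSpace ℝ (Fin n) →
        EuclideanSpace ℝ (Fin n) → EuclideanSpace ℝ (Fin n))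
      (ω : ℝ → ℝ → ℝ),
      Cylinder.IsSolution (l * L) u φ ω →
      ∃ a b : ℕ, a < b ∧ b ≤ l + 1 ∧
        (Cylinder.supNorm (l * L) ω < ENNReal.ofReal δ₂ →
          (∀ i ∈ Set.Icc 1 a, Cylinder.energy m L i u ≤
            C * Real.exp (-(i * Cylinder.qPrime q L * L)) *
              sSup ((fun k => Cylinder.energy m L k u) '' Set.Icc 1 l)) ∧
          (∀ i ∈ Set.Icc b l, Cylinder.energy m L i u ≤
            C * Real.exp (-(((l : ℝ) - i) * Cylinder.qPrime q L * L)) *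
              sSup ((fun k => Cylinder.energy m L k u) '' Set.Icc 1 l)) ∧
          (∀ i : ℕ, a + 1 ≤ i → i + 1 ≤ b → ε₁ ≤ Cylinder.lam m L i u) ∧
          (∀ i ∈ Set.Icc 1 a ∪ Set.Icc b l, Cylinder.lam m L i u < ε₁)) ∧
        (∀ s : ℝ, 2 < s → s < ((b : ℝ) - a) / 4 →
          Cylinder.supNorm (l * L) ω < ENNReal.ofReal (δ s) →
          ∀ i : ℕ, (a : ℝ) + s < i → (i : ℝ) < b - s →
            Cylinder.nu m L i u ≤ ENNReal.ofReal
              (2 * (1 + (ε₁ ^ 2)⁻¹) *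
                Real.exp (-(Cylinder.qPrime q L * (s - 2) * L / 2)))) := by
  obtain ⟨L₁, hL₁, hL₁'⟩ := Cylinder.exists_length_threshold m hq.1 hq.2
  refine ⟨L₁, hL₁, fun L hL => ?_⟩
  obtain ⟨hκ, hL3, hϑ, hLm⟩ := hL₁' L hL
  have hL0 : 0 < L := by linarith
  obtain ⟨ε, δ₀, hε, hδ₀, -, h3⟩ :=
    Cylinder.exists_three_circle hm hL3 (mul_nonneg hq.1.le hL0.le) hκ
  refine ⟨ε, hε, ⟨δ₀, hδ₀, fun n u φ ω hu hω hmin => ?_⟩, ?_⟩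
  · have h := h3 n _ u hu.isC2 (hu.nearHarmonic hω) 1
    norm_num at h
    rcases min_le_iff.1 hmin with h1 | h1
    · exact h 1 le_rfl (by norm_num) h1
    rcases min_le_iff.1 h1 with h1 | h1
    · exact h 2 (by norm_num) (by norm_num) h1
    · exact h 3 (by norm_num) le_rfl h1
  obtain ⟨δ₂, hδ₂, hdec⟩ := Cylinder.exists_decomposition (m := m) (by linarith) hε hδ₀ hϑ h3
  choose δN hδN hδN' using Cylinder.exists_energy_sub_proj_le hm hL3 hLm hε hϑ hκ
  have hexp := Cylinder.exp_neg_qPrime_mul (q := q) hL0.ne'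
  set ϑ := 2 * Real.exp (-(q * L)) with hϑdef
  have hϑ0 : 0 < ϑ := by positivity
  have hpow : ∀ d : ℕ, ϑ ^ d = Real.exp (-(d * Cylinder.qPrime q L * L)) := fun d => by
    rw [← hexp, ← Real.exp_nat_mul]
    congr 1
    ring
  refine ⟨ϑ⁻¹, δ₂, fun s => min δ₂ (δN (⌈s⌉₊ - 1)), by positivity, hδ₂,
    fun s => lt_min hδ₂ (hδN _), fun n l u φ ω hu => ?_⟩
  by_cases hω : Cylinder.supNorm (l * L) ω < ENNReal.ofReal δ₂
  swap
  · -- Without smallness of `ω` both assertions are void, and any `a` and `b` will do.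
    refine ⟨0, 1, one_pos, by omega, fun h => absurd h hω, fun s hs hs' => ?_⟩
    norm_num at hs'
    linarith
  obtain ⟨a, b, hab, hbl, ha, hmid, hb, hEa, hEb⟩ :=
    hdec n l u hu.isC2 (hu.nearHarmonic hω)
  have hsup : ∀ k, 1 ≤ k → k ≤ l → Cylinder.energy m L k u ≤
      sSup ((fun k => Cylinder.energy m L k u) '' Set.Icc 1 l) := fun k h1 h2 =>
    le_csSup ((Set.finite_Icc 1 l).image _).bddAbove ⟨k, ⟨h1, h2⟩, rfl⟩
  set R := sSup ((fun k => Cylinder.energy m L k u) '' Set.Icc 1 l)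
  have hEn := fun k => Cylinder.energy_nonneg m hL0.le k u
  refine ⟨a, b, hab, hbl, fun _ => ⟨fun i hi => ?_, fun i hi => ?_, fun i h1 h2 => ?_,
    fun i hi => ?_⟩, fun s hs hsab hωs i hi1 hi2 => ?_⟩
  · obtain ⟨d, rfl⟩ : ∃ d, i = d + 1 := ⟨i - 1, by have := hi.1; omega⟩
    have h1 := Cylinder.le_pow_mul_of_decay (E := fun k => Cylinder.energy m L k u) hϑ0.le hEa d hi.2
    rw [← hpow, pow_succ', inv_mul_cancel_left₀ hϑ0.ne']
    refine h1.trans (mul_le_mul_of_nonneg_left (hsup 1 le_rfl ?_) (by positivity))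
    have := hi.2
    omega
  · obtain ⟨d, rfl⟩ : ∃ d, l = i + d := ⟨l - i, by have := hi.2; omega⟩
    have h1 := Cylinder.le_pow_mul_of_growth (E := fun k => Cylinder.energy m L k u)
      hϑ0.le hEb d i hi.1 rfl
    have h2 : ((i + d : ℕ) : ℝ) - i = d := by push_cast; ring
    rw [h2, ← hpow]
    have h3 := hsup (i + d) (by have := hi.1; omega) le_rfl
    have h4 : 1 ≤ ϑ⁻¹ := (one_le_inv₀ hϑ0).2 (by linarith)
    have h5 : 0 ≤ R := (hEn _).trans h3
    calc _ ≤ ϑ ^ d * Cylinder.energy m L (i + d) u := h1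
      _ ≤ 1 * ϑ ^ d * R := by rw [one_mul]; gcongr
      _ ≤ _ := by gcongr
  · exact not_lt.1 (hmid i h1 h2)
  · rcases hi with hi | hi
    · exact ha i hi.1 hi.2
    · exact hb i hi.1 hi.2
  · have hN0 : 2 < ⌈s⌉₊ := Nat.lt_ceil.2 (by exact_mod_cast hs)
    obtain ⟨N, hN⟩ : ∃ N, ⌈s⌉₊ = N + 1 := ⟨⌈s⌉₊ - 1, by omega⟩
    have hsN : s ≤ N + 1 := by
      have := Nat.le_ceil s
      rw [hN] at this
      exact_mod_cast this
    have hNs : (N : ℝ) < s := by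
      have := Nat.ceil_lt_add_one (by linarith : 0 ≤ s)
      rw [hN] at this
      push_cast at this
      linarith
    have hi1' : a + N < i := by
      have : ((a + N : ℕ) : ℝ) < i := by push_cast; linarith
      exact_mod_cast this
    have hi2' : i + N < b := by
      have : ((i + N : ℕ) : ℝ) < b := by push_cast; linarith
      exact_mod_cast this
    obtain ⟨i₀, rfl⟩ : ∃ i₀, i = i₀ + N := ⟨i - N, by omega⟩
    simp only [hN, Nat.add_sub_cancel] at hωs
    have hlam : ∀ j, i₀ ≤ j → j ≤ i₀ + 2 * N → ε ≤ Cylinder.lam m L j u := fun j h1 h2 =>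
      not_lt.1 (hmid j (by omega) (by omega))
    have hmain := hδN' N n _ u hu.isC2 (hu.nearHarmonic (hωs.trans_le
      (ENNReal.ofReal_le_ofReal (min_le_right _ _)))) i₀ (by omega) (by
        have : ((i₀ + 2 * N : ℕ) : ℝ) ≤ l := by exact_mod_cast (by omega : i₀ + 2 * N ≤ l)
        push_cast at this
        gcongr) hlam
    refine Cylinder.nu_le hm hL0
      (hε.trans_le (hlam _ (by omega) (by omega))) (hmain.trans ?_)
    refine mul_le_mul_of_nonneg_right ?_ (Cylinder.energy_nonneg m hL0.le _ _)
    -- `N ≥ s - 1 ≥ (s - 2) / 2 + 1`, and the surplus factor `ϑ ≤ 1/4` absorbs the constant.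
    have hq' : 0 ≤ Cylinder.qPrime q L * L := by
      have : Real.exp (-(Cylinder.qPrime q L * L)) ≤ 1 := by rw [hexp]; linarith
      rw [Real.exp_le_one_iff] at this
      linarith
    have h1 : ϑ ^ N ≤ ϑ * Real.exp (-(Cylinder.qPrime q L * (s - 2) * L / 2)) := by
      rw [hpow, ← hexp, ← Real.exp_add, Real.exp_le_exp]
      have := mul_le_mul_of_nonneg_right (by linarith : (s - 2) / 2 + 1 ≤ N) hq'
      linarith
    have h2 : 5 * ϑ ^ N ≤ 2 * Real.exp (-(Cylinder.qPrime q L * (s - 2) * L / 2)) := by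
      have h3 := Real.exp_pos (-(Cylinder.qPrime q L * (s - 2) * L / 2))
      have h4 := mul_le_mul_of_nonneg_right hϑ h3.le
      linarith
    have h5 := mul_le_mul_of_nonneg_left h2 (by positivity : 0 ≤ 1 + (ε ^ 2)⁻¹)
    linarith
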